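/- Let $F$ be a number field with ring of integers $\mathcal O_F$, and let $f_1,\dots,f_m\in\mathcal O_F[X_0,\dots,X_N]$ be homogeneous polynomials, all of the same degree $d\ge 1$, that define a smooth complete intersection $V\subset\mathbf P^N_F$ of dimension $n=N-m$ (the case $m=0$, $V=\mathbf P^N_F$, is allowed). Put $\boldsymbol f=(f_1,\dots,f_m)$ and assume $\delta=N+1-md\ge 1$. Fix a finite place $\mathfrak p$ of $F$; let $F_{\mathfrak p}$ be the completion, $\mathcal O_{\mathfrak p}$ its ring of integers, $\mathfrak p$ also the maximal ideal of $\mathcal O_{\mathfrak p}$, $q=\#(\mathcal O_{\mathfrak p}/\mathfrak p)$, and $|\cdot|$ the absolute value on $F_{\mathfrak p}$ for which uniformizers have absolute value $q^{-1}$. Let $W\subset\mathbf A^{N+1}_F-\{0\}$ be the cone above $V$, of dimension $n+1$. Let $\omega_L$ be the Leray form on $W$, given up to sign, wherever the minor does not vanish, by $$\omega_L=\pm\det\Bigl(\frac{\partial f_i}{\partial X_{k_j}}\Bigr)_{1\le i,j\le m}^{-1}\bigwedge_{l\notin\{k_1,\dots,k_m\}}dX_l .$$ The equations $f_i$ define an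 isomorphism $\omega_V^{-1}\cong\mathcal O_V(\delta)$: if $y\in W(F_{\mathfrak p})$ lies above $x\in V(F_{\mathfrak p})$ and $t_1,\dots,t_n\in T_xV$ are lifted to $T_yW$, then $t_1\wedge\dots\wedge t_n$ corresponds to the homogeneous function of degree $\delta$ on the line above $x$ with value $\omega_L(y,t_1,\dots,t_n)$ at $y$. The metric on $\mathcal O_V(\delta)$ induced by the monomials of degree $\delta$ thus gives the metric $$\|t_1\wedge\dots\wedge t_n\|=\frac{|\omega_L(y,t_1,\dots,t_n)|}{\max_{0\le i\le N}|y_i|^{\delta}}$$ on $\omega_V^{-1}$. For a Haar measure $dx$ on $F_{\mathfrak p}$, let $\omega_{\mathbf H,\mathfrak p}$ be the measure on $V(F_{\mathfrak p})$ given in any local analytic coordinates $x_1,\dots,x_n$ by $$\Bigl\|\frac{\partial}{\partial x_1}\wedge\dots\wedge\frac{\partial}{\partial x_n}\Bigr\|\,dx_1\cdots dx_n .$$ Then the limit $$L=\lim_{r\to\infty}\frac{\#\{x\in(\mathcal O_{\mathfrak p}/\mathfrak p^r)^{N+1}\mid \boldsymbol f(x)=0\text{ in }(\mathcal O_{\mathfrak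 p}/\mathfrak p^r)^m\}}{q^{\,r\dim W}}$$ exists in $\mathbf R$, and: 1. if the Haar measure $dx$ is normalized by $\int_{\mathcal O_{\mathfrak p}}dx=1$, then $$\omega_{\mathbf H,\mathfrak p}(V(F_{\mathfrak p}))=\frac{1-q^{-\delta}}{1-q^{-1}}\,L ;$$ 2. if the Haar measure $dx$ is normalized by $\int_{\mathcal O_{\mathfrak p}}dx=\#(\mathcal O_{\mathfrak p}/\mathfrak d_{\mathfrak p})^{-1/2}$, where $\mathfrak d_{\mathfrak p}$ is the absolute different at $\mathfrak p$, then $$\omega_{\mathbf H,\mathfrak p}(V(F_{\mathfrak p}))=\#(\mathcal O_{\mathfrak p}/\mathfrak d_{\mathfrak p})^{-n/2}\,\frac{1-q^{-\delta}}{1-q^{-1}}\,L .$$ -/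

import Mathlib

open scoped LinearAlgebra.Projectivization NumberField ENNReal

namespace LocalDensity

noncomputable section

/-- The completion of a number field at a finite place, with its normalised absolute value
(a uniformizer has absolute value the inverse of the cardinality of the residue field). -/
instance instNontriviallyNormedFieldAdicCompletion {F : Type*} [Field F] [NumberField F]
    (v : IsDedekindDomain.HeightOneSpectrum (𝓞 F)) :
    NontriviallyNormedField (v.adicCompletion F) :=
  Valued.toNontriviallyNormedField (v.adicCompletion F) (WithZero (Multiplicative ℤ))

/-- The topology of the projective space over a topological field: the quotient topology. -/
instance instTopologicalSpaceProjectivization {K V : Type*} [DivisionRing K] [AddCommGroup V]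
    [Module K V] [TopologicalSpace V] : TopologicalSpace (ℙ K V) :=
  inferInstanceAs (TopologicalSpace (Quotient (projectivizationSetoid K V)))

/-- The Borel `σ`-algebra of the projective space. -/
instance instMeasurableSpaceProjectivization {K V : Type*} [DivisionRing K] [AddCommGroup V]
    [Module K V] [TopologicalSpace V] : MeasurableSpace (ℙ K V) :=
  borel _

/-- The closed subscheme `V` of `ℙ^N` over the field `F` that is defined by the `m` homogeneous
polynomials `f i` (with coefficients in a ring `R` mapping to `F`) is a smooth complete
intersection: at every geometric point of `V` the Jacobian matrix of `f` has rank `m`. -/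
def IsSmoothCompleteIntersection {R : Type*} [CommRing R] (F : Type*) [Field F]
    [Algebra R (AlgebraicClosure F)] {N m : ℕ} (f : Fin m → MvPolynomial (Fin (N + 1)) R) : Prop :=
  ∀ x : Fin (N + 1) → AlgebraicClosure F, x ≠ 0 → (∀ i, MvPolynomial.aeval x (f i) = 0) →
    LinearIndependent (AlgebraicClosure F)
      (fun (i : Fin m) (j : Fin (N + 1)) => MvPolynomial.aeval x (MvPolynomial.pderiv j (f i)))

section LocalField

variable {K : Type*} [NontriviallyNormedField K] {N m : ℕ}

/-- The set `V(K)` of `K`-points of the subscheme `V` of `ℙ^N` defined by the homogeneous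
polynomials `f i`. -/
def points (f : Fin m → MvPolynomial (Fin (N + 1)) K) : Set (ℙ K (Fin (N + 1) → K)) :=
  {x | ∀ (y : Fin (N + 1) → K) (hy : y ≠ 0), Projectivization.mk K y hy = x →
    ∀ i, MvPolynomial.eval y (f i) = 0}

/-- The absolute value `|ω_L(t_0, …, t_n)|` of the Leray form `ω_L` of the affine cone
`W = {f = 0}` (`dim W = n + 1`), at the point `y` of the cone, on vectors `t_0, …, t_n` tangent to
the cone at `y`. For each splitting `e` of the coordinates into `m` coordinates `X_{k_1}, …` and
`n + 1` remaining ones for which the minor `det (∂f_i/∂X_{k_j})(y)` does not vanish, the form is,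
up to sign, the inverse of that minor times the wedge product of the differentials of the remaining
coordinates. On tangent vectors all these `e` give the same value; those for which the minor
vanishes contribute `0` to the supremum, because of the convention `0⁻¹ = 0`. -/
def absLeray (f : Fin m → MvPolynomial (Fin (N + 1)) K) {n : ℕ} (y : Fin (N + 1) → K)
    (t : Fin (n + 1) → Fin (N + 1) → K) : ℝ :=
  ⨆ e : Fin m ⊕ Fin (n + 1) ≃ Fin (N + 1),
    ‖(Matrix.of fun i j : Fin m =>
        MvPolynomial.eval y (MvPolynomial.pderiv (e (Sum.inl j)) (f i))).det‖⁻¹ *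
      ‖(Matrix.of fun i j : Fin (n + 1) => t i (e (Sum.inr j))).det‖

/-- The metric on the anticanonical bundle of `V` (`dim V = n`) induced by the monomials of degree
`δ`. At a point `x` of `V` with homogeneous coordinates `y`, let `t_1, …, t_n` be tangent vectors
of `V` at `x`, lifted to tangent vectors of the cone at `y`. The isomorphism of `ω_V^{-1}` with
`O_V(δ)` given by the equations `f i` sends `t_1 ∧ … ∧ t_n` to the element of the fibre of
`O_V(δ)` at `x` with value `ω_L(y, t_1, …, t_n)` at `y`, and the metric on `O_V(δ)` divides
the absolute value of this by the largest absolute value of a monomial of degree `δ` at `y`, which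
is the `δ`-th power of `max_i |y_i| = ‖y‖`. -/
def anticanonicalNorm (f : Fin m → MvPolynomial (Fin (N + 1)) K) (δ : ℕ) {n : ℕ}
    (y : Fin (N + 1) → K) (t : Fin n → Fin (N + 1) → K) : ℝ :=
  absLeray f y (Fin.cons y t : Fin (n + 1) → Fin (N + 1) → K) / ‖y‖ ^ δ

/-- A system of local analytic coordinates `x_1, …, x_n` on the `n`-dimensional analytic manifold
`V(K)`, presented by its inverse: an injective analytic immersion of an open subset of `K^n` into
`V(K)`, written in homogeneous coordinates. -/
structure LocalCoordinates (f : Fin m → MvPolynomial (Fin (N + 1)) K) (n : ℕ) where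
  /-- the open subset of `K^n` that is the range of the coordinates -/
  domain : Set (Fin n → K)
  isOpen_domain : IsOpen domain
  /-- homogeneous coordinates of the point with given local coordinates -/
  lift : (Fin n → K) → (Fin (N + 1) → K)
  analytic : AnalyticOnNhd K lift domain
  lift_ne_zero : ∀ u ∈ domain, lift u ≠ 0
  eval_lift : ∀ u ∈ domain, ∀ i, MvPolynomial.eval (lift u) (f i) = 0
  injective : ∀ u ∈ domain, ∀ u' ∈ domain, ∀ c : K, lift u = c • lift u' → u = u'
  immersion : ∀ u ∈ domain, LinearIndependent K
    (Fin.cons (lift u) (fun j => fderiv K lift u (Pi.single j 1)) :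
      Fin (n + 1) → Fin (N + 1) → K)

namespace LocalCoordinates

variable {f : Fin m → MvPolynomial (Fin (N + 1)) K} {n : ℕ}

/-- The point of the projective space with given local coordinates. -/
def toPoint (c : LocalCoordinates f n) (u : c.domain) : ℙ K (Fin (N + 1) → K) :=
  Projectivization.mk K (c.lift u) (c.lift_ne_zero u u.2)

/-- The norm `‖∂/∂x_1 ∧ … ∧ ∂/∂x_n‖`, as a function of the local coordinates. -/
def density (c : LocalCoordinates f n) (δ : ℕ) (u : c.domain) : ℝ :=
  anticanonicalNorm f δ (c.lift u) (fun j => fderiv K c.lift u (Pi.single j 1))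

/-- The measure `‖∂/∂x_1 ∧ … ∧ ∂/∂x_n‖ dx_1 … dx_n` on the coordinate neighbourhood, extended by
`0`. Here `μ` is the Haar measure `dx_j` of `K`. -/
def measure [MeasurableSpace K] (c : LocalCoordinates f n) (δ : ℕ)
    (μ : MeasureTheory.Measure K) : MeasureTheory.Measure (ℙ K (Fin (N + 1) → K)) :=
  ((((MeasureTheory.Measure.pi fun _ : Fin n => μ).comap
    (Subtype.val : c.domain → Fin n → K)).withDensity
      fun u => ENNReal.ofReal (c.density δ u)).map c.toPoint)

end LocalCoordinates

/-- The measure `ω_H` on `V(K)`, as a measure on `ℙ^N(K)` carried by `V(K)`: the measure that on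
each coordinate neighbourhood is `‖∂/∂x_1 ∧ … ∧ ∂/∂x_n‖ dx_1 … dx_n`. As these local
measures agree on the intersections of coordinate neighbourhoods, and as the neighbourhoods cover
`V(K)`, the measure glued from them is their least upper bound. -/
def tamagawaMeasure [MeasurableSpace K] (f : Fin m → MvPolynomial (Fin (N + 1)) K) (n δ : ℕ)
    (μ : MeasureTheory.Measure K) : MeasureTheory.Measure (ℙ K (Fin (N + 1) → K)) :=
  ⨆ c : LocalCoordinates f n, c.measure δ μ

end LocalField

section Place

variable {F : Type*} [Field F] [NumberField F] (v : IsDedekindDomain.HeightOneSpectrum (𝓞 F))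

/-- The cardinality of the residue field at the finite place `v`. -/
def residueCard : ℕ :=
  Nat.card (IsLocalRing.ResidueField (v.adicCompletionIntegers F))

/-- The quotient of the ring of integers at `v` by the `r`-th power of its maximal ideal. -/
abbrev ModPow (r : ℕ) : Type _ :=
  v.adicCompletionIntegers F ⧸ IsLocalRing.maximalIdeal (v.adicCompletionIntegers F) ^ r

/-- The number of solutions of `f = 0` modulo the `r`-th power of the prime. -/
def solutionCount {N m : ℕ} (f : Fin m → MvPolynomial (Fin (N + 1)) (𝓞 F)) (r : ℕ) : ℕ :=
  Nat.card {x : Fin (N + 1) → ModPow v r // ∀ i, MvPolynomial.aeval x (f i) = 0}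

/-- The index in the ring of integers at `v` of the absolute different of `v`. -/
def differentIndex : ℕ :=
  Nat.card (v.adicCompletionIntegers F ⧸
    (differentIdeal ℤ (𝓞 F)).map (algebraMap (𝓞 F) (v.adicCompletionIntegers F)))

end Place

end

end LocalDensity

/-! Both sides are read off from one number α, the volume for |ω_L| of the vectors of norm one on
the cone. In the code α is `∑ i, (P i).leray μ univ`, where the finitely many disjoint compact open
pieces `P i` cover these vectors and on each of them the cone is a graph (`exists_pieces`).

On the geometric side, the cone over a chart u ↦ lift u is parametrized by (t, u) ↦ t • lift u.
Homogeneity of the equations makes |ω_L| equal to |t|^(δ-1) times its value at t = 1. The condition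
‖t • lift u‖ = 1 confines t to a dilate of the units, and integrating over t leaves the volume of
the units times ‖lift u‖^(-δ), which is exactly the denominator of the metric. Gluing finitely many
charts gives α = (1 - q⁻¹) ω_H(V) (`sum_leray_eq`, `measure_sphere_mul_tamagawaMeasure`,
`measure_sphere_one`).

On the arithmetic side, the solutions modulo 𝔭^r are counted by the volume of the tube |f| ≤ q^(-r)
in the unit ball (`solutionCount_mul_eq_measure_tube`). Using the values of f as m of the
coordinates turns a thin tube near the unit sphere into a product, so its volume divided by the m-th
power of its radius is exactly α (`measure_tube_sphere`). The shell ‖y‖ = q^(-k) is a dilate of the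
unit sphere; its tube has relative radius q^(kd-r), and after normalization it enters with weight
q^(-kδ). Dominated convergence over k gives L = α / (1 - q^(-δ)) (`tendsto_measure_tube`).
Eliminating α proves the formula, and good reduction plays no role.

The analysis rests on the change of variables `measure_image_eq_lintegral_det`. It is elementary
here because in an ultrametric space a map close enough to the identity preserves distances, and
because nonvanishing continuous functions have locally constant absolute value. Smoothness, given
over the algebraic closure of F, is carried to the completion by the Nullstellensatz
(`IsSmoothCompleteIntersection.linearIndependent`). Other Haar measures differ by a constant c,
which enters as c^n (`tamagawaMeasure_smul`). -/

namespace LocalDensity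

open MeasureTheory Metric Set Filter Topology

/-! ### Ultrametric change of variables for Haar measure -/

section ChangeOfVariables

/-- A map that does not increase distances does not increase the Haar measure of an ultrametric
normed group. -/
theorem measure_image_le_of_lipschitz {E : Type*} [NormedAddCommGroup E] [IsUltrametricDist E]
    [SecondCountableTopology E] [MeasurableSpace E] [BorelSpace E] (μ : Measure E)
    [μ.IsAddLeftInvariant] [μ.OuterRegular] {ψ : E → E} {S : Set E}
    (hψ : ∀ x ∈ S, ∀ y ∈ S, dist (ψ x) (ψ y) ≤ dist x y) : μ (ψ '' S) ≤ μ S := by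
  rcases eq_or_ne (μ S) ⊤ with hS | hS
  · rw [hS]; exact le_top
  refine ENNReal.le_of_forall_pos_le_add fun ε hε _ => ?_
  obtain ⟨U, hSU, hU, hlt⟩ := S.exists_isOpen_lt_add hS (ENNReal.coe_pos.2 hε).ne'
  refine le_trans ?_ hlt.le
  have hpos : ∀ k : ℕ, (0 : ℝ) < (1 / 2) ^ k := fun k => by positivity
  have hex : ∀ x ∈ S, ∃ k : ℕ, closedBall x ((1 / 2 : ℝ) ^ k) ⊆ U := by
    intro x hx
    obtain ⟨ε, hε, h⟩ := Metric.isOpen_iff.1 hU x (hSU hx)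
    obtain ⟨k, hk⟩ := exists_pow_lt_of_lt_one hε (by norm_num : (1 / 2 : ℝ) < 1)
    exact ⟨k, (closedBall_subset_ball hk).trans h⟩
  classical
  let k : E → ℕ := fun x => sInf {k : ℕ | closedBall x ((1 / 2 : ℝ) ^ k) ⊆ U}
  have hk : ∀ x ∈ S, closedBall x ((1 / 2 : ℝ) ^ k x) ⊆ U := fun x hx => Nat.sInf_mem (hex x hx)
  have hk' : ∀ x, ∀ j : ℕ, closedBall x ((1 / 2 : ℝ) ^ j) ⊆ U → k x ≤ j :=
    fun x j h => Nat.sInf_le h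
  let b : E → Set E := fun x => closedBall x ((1 / 2 : ℝ) ^ k x)
  -- `b x` is the largest ball of dyadic radius about x inside U. If two such balls meet, the larger
  -- one is also a ball about the other centre, so maximality forces them to coincide. Hence the
  -- distinct balls are disjoint and lose nothing of the measure of U.
  have key : ∀ x ∈ S, ∀ y ∈ S, (b x ∩ b y).Nonempty → k x ≤ k y → b x = b y := by
    intro x hx y hy hxy hle
    have hr : (1 / 2 : ℝ) ^ k y ≤ (1 / 2 : ℝ) ^ k x :=
      pow_le_pow_of_le_one (by norm_num) (by norm_num) hle
    obtain ⟨z, hzx, hzy⟩ := hxy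
    have hyx : y ∈ closedBall x ((1 / 2 : ℝ) ^ k x) := by
      have h1 : dist y z ≤ (1 / 2 : ℝ) ^ k x := (mem_closedBall'.1 hzy).trans hr
      exact mem_closedBall.2 ((dist_triangle_max y z x).trans (max_le h1 hzx))
    have heq : closedBall x ((1 / 2 : ℝ) ^ k x) = closedBall y ((1 / 2 : ℝ) ^ k x) :=
      IsUltrametricDist.closedBall_eq_of_mem hyx
    have : k y = k x := le_antisymm (hk' y _ (heq ▸ hk x hx)) hle
    simp only [b, this, heq]
  have hb : ∀ B ∈ b '' S, ∃ x ∈ S, b x = B := fun B hB => hB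
  choose! c hcS hcb using hb
  have hdisj : (b '' S).PairwiseDisjoint id := by
    rintro _ ⟨x, hx, rfl⟩ _ ⟨y, hy, rfl⟩ hne
    by_contra h
    rw [Function.onFun, Set.not_disjoint_iff_nonempty_inter] at h
    rcases le_total (k x) (k y) with h' | h'
    · exact hne (key x hx y hy h h')
    · exact hne (key y hy x hx (by simpa [inter_comm] using h) h').symm
  have hcount : (b '' S).Countable := by
    refine hdisj.countable_of_isOpen ?_ ?_
    · rintro _ ⟨x, _, rfl⟩
      exact IsUltrametricDist.isOpen_closedBall x (hpos _).ne'
    · rintro _ ⟨x, _, rfl⟩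
      exact ⟨x, mem_closedBall_self (hpos _).le⟩
  -- The image of the part of S in a ball stays in a ball of the same radius, which has the same
  -- measure by translation invariance.
  have hcover : ψ '' S ⊆ ⋃ B ∈ b '' S, closedBall (ψ (c B)) ((1 / 2 : ℝ) ^ k (c B)) := by
    rintro _ ⟨x, hx, rfl⟩
    have hB : b x ∈ b '' S := mem_image_of_mem b hx
    refine mem_iUnion₂.2 ⟨b x, hB, mem_closedBall.2 ((hψ x hx _ (hcS _ hB)).trans ?_)⟩
    have : x ∈ b (c (b x)) := by
      rw [hcb _ hB]; exact mem_closedBall_self (hpos _).le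
    exact this
  have hball : ∀ (x y : E) (r : ℝ), μ (closedBall x r) = μ (closedBall y r) := by
    intro x y r
    have : (fun z => (x - y) + z) ⁻¹' closedBall x r = closedBall y r := by
      ext z
      simp only [mem_preimage, mem_closedBall, dist_eq_norm]
      rw [show x - y + z - x = z - y by abel]
    rw [← this, measure_preimage_add]
  calc μ (ψ '' S) ≤ μ (⋃ B ∈ b '' S, closedBall (ψ (c B)) ((1 / 2 : ℝ) ^ k (c B))) :=
        measure_mono hcover
    _ ≤ ∑' B : b '' S, μ (closedBall (ψ (c B)) ((1 / 2 : ℝ) ^ k (c B))) :=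
        measure_biUnion_le _ hcount _
    _ = ∑' B : b '' S, μ (B : Set E) := by
        refine tsum_congr fun B => ?_
        rw [hball _ (c B)]
        exact congrArg μ (hcb B B.2)
    _ = μ (⋃ B ∈ b '' S, B) := by
        refine (measure_biUnion hcount hdisj ?_).symm
        rintro _ ⟨x, _, rfl⟩
        exact isClosed_closedBall.measurableSet
    _ ≤ μ U := by
        refine measure_mono (iUnion₂_subset ?_)
        rintro _ ⟨x, hx, rfl⟩
        exact hk x hx

/-- A map that preserves distances on a set preserves the Haar measure of this set. -/
theorem measure_image_of_isometryOn {E : Type*} [NormedAddCommGroup E] [IsUltrametricDist E]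
    [SecondCountableTopology E] [MeasurableSpace E] [BorelSpace E] (μ : Measure E)
    [μ.IsAddLeftInvariant] [μ.OuterRegular] {ψ : E → E} {S : Set E}
    (hψ : ∀ x ∈ S, ∀ y ∈ S, dist (ψ x) (ψ y) = dist x y) : μ (ψ '' S) = μ S := by
  refine le_antisymm (measure_image_le_of_lipschitz μ fun x hx y hy => (hψ x hx y hy).le) ?_
  have hinj : InjOn ψ S := fun x hx y hy h => by
    rw [← dist_eq_zero, ← hψ x hx y hy, h, dist_self]
  -- The inverse also preserves distances on the image, so the inequality applied to it gives the
  -- reverse estimate.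
  have hinv := hinj.leftInvOn_invFunOn
  conv_lhs => rw [← hinv.image_image]
  refine measure_image_le_of_lipschitz μ ?_
  rintro _ ⟨x, hx, rfl⟩ _ ⟨y, hy, rfl⟩
  rw [hinv hx, hinv hy, hψ x hx y hy]

variable {K : Type*} [NontriviallyNormedField K] [MeasurableSpace K]

/-- The measure `μ` is multiplied by `‖a‖` under the homothety of ratio `a`. -/
def ScalesByNorm (μ : Measure K) : Prop :=
  ∀ a : K, a ≠ 0 → ∀ s : Set K, ‖a‖ₑ * μ ((a * ·) ⁻¹' s) = μ s

variable [BorelSpace K] [ProperSpace K] {ι : Type*} [Fintype ι]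
  {μ : Measure K} [μ.IsAddHaarMeasure]

open Matrix

theorem smul_map_diagonal_pi [DecidableEq ι] (hμ : ScalesByNorm μ) {D : ι → K}
    (h : det (diagonal D) ≠ 0) :
    ‖det (diagonal D)‖ₑ • Measure.map (toLin' (diagonal D)) (Measure.pi fun _ : ι => μ) =
      Measure.pi fun _ : ι => μ := by
  refine (Measure.pi_eq fun s hs => ?_).symm
  simp only [det_diagonal, Measure.coe_smul, smul_eq_mul, Pi.smul_apply]
  rw [Measure.map_apply _ (MeasurableSet.univ_pi hs)]
  swap; · exact Continuous.measurable (LinearMap.continuous_on_pi _)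
  have : (Matrix.toLin' (diagonal D) ⁻¹' Set.pi Set.univ fun i : ι => s i) =
      Set.pi Set.univ fun i : ι => (D i * ·) ⁻¹' s i := by
    ext f
    simp only [LinearMap.coe_proj, smul_eq_mul, LinearMap.smul_apply, mem_univ_pi,
      mem_preimage, LinearMap.pi_apply, diagonal_toLin']
  have hD : ∀ i, D i ≠ 0 := by
    simp only [det_diagonal, Ne] at h
    exact fun i => Finset.prod_ne_zero_iff.1 h i (Finset.mem_univ i)
  have hprod : ‖∏ i, D i‖ₑ = ∏ i, ‖D i‖ₑ := by
    simp only [enorm, nnnorm_prod, ENNReal.ofNNReal_finsetProd]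
  rw [this, Measure.pi_pi, hprod, ← Finset.prod_mul_distrib]
  exact Finset.prod_congr rfl fun i _ => hμ (D i) (hD i) (s i)

/-- A transvection translates one coordinate by an amount depending on another one, so integrating
over the moved coordinate first reduces the claim to translation invariance of μ. -/
theorem measurePreserving_transvection_pi [DecidableEq ι] (t : TransvectionStruct ι K) :
    MeasurePreserving (toLin' t.toMatrix) (Measure.pi fun _ : ι => μ)
      (Measure.pi fun _ : ι => μ) := by
  have ht : Measurable (toLin' t.toMatrix) :=
    (LinearMap.continuous_on_pi _).measurable
  refine ⟨ht, ?_⟩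
  refine (Measure.pi_eq fun s hs ↦ ?_).symm
  have h2s : MeasurableSet (univ.pi s) := .pi countable_univ fun i _ ↦ hs i
  simp_rw [← Measure.pi_pi, ← lintegral_indicator_one h2s]
  rw [lintegral_map (measurable_one.indicator h2s) ht]
  refine lintegral_eq_of_lmarginal_eq {t.i} ((measurable_one.indicator h2s).comp ht)
    (measurable_one.indicator h2s) ?_
  simp_rw [lmarginal_singleton]
  ext x
  cases t with | mk t_i t_j t_hij t_c =>
  simp [transvection, single_mulVec, t_hij.symm, ← Function.update_add,
    lintegral_add_right_eq_self fun xᵢ ↦ indicator (univ.pi s) 1 (Function.update x t_i xᵢ)]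

/-- Invertible matrices are products of diagonal matrices and transvections, and both sides are
multiplicative in the matrix. -/
theorem smul_map_matrix_pi [DecidableEq ι] (hμ : ScalesByNorm μ) {M : Matrix ι ι K}
    (hM : det M ≠ 0) :
    ‖det M‖ₑ • Measure.map (toLin' M) (Measure.pi fun _ : ι => μ) =
      Measure.pi fun _ : ι => μ := by
  apply diagonal_transvection_induction_of_det_ne_zero _ M hM
  · intro D hD
    exact smul_map_diagonal_pi hμ hD
  · intro t
    rw [Matrix.TransvectionStruct.det, (measurePreserving_transvection_pi t).map_eq]
    simp
  · intro A B _ _ IHA IHB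
    rw [toLin'_mul, det_mul, LinearMap.coe_comp, ← Measure.map_map, enorm_mul, ← smul_smul,
      ← Measure.map_smul, IHB, IHA]
    · apply Continuous.measurable
      apply LinearMap.continuous_on_pi
    · apply Continuous.measurable
      apply LinearMap.continuous_on_pi

/-- An invertible linear map multiplies the Haar measure by the absolute value of its
determinant. -/
theorem measure_image_continuousLinearEquiv (hμ : ScalesByNorm μ)
    (A : (ι → K) ≃L[K] (ι → K)) (S : Set (ι → K)) :
    (Measure.pi fun _ : ι => μ) (A '' S) =
      ‖LinearMap.det (A : (ι → K) →ₗ[K] (ι → K))‖ₑ * (Measure.pi fun _ : ι => μ) S := by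
  classical
  set L : (ι → K) →ₗ[K] (ι → K) := (A : (ι → K) →ₗ[K] (ι → K)) with hL
  have hdet : det (LinearMap.toMatrix' L) ≠ 0 := by
    rw [LinearMap.det_toMatrix']
    exact (LinearEquiv.isUnit_det' A.toLinearEquiv).ne_zero
  have h := smul_map_matrix_pi hμ hdet
  rw [toLin'_toMatrix', LinearMap.det_toMatrix'] at h
  have h2 := congrArg (fun ν : Measure (ι → K) => ν (A '' S)) h
  simp only [Measure.smul_apply, smul_eq_mul] at h2
  have hm : (L : (ι → K) → (ι → K)) = A.toHomeomorph.toMeasurableEquiv := rfl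
  rw [hm, MeasurableEquiv.map_apply] at h2
  rw [← h2]
  congr 2
  exact A.toEquiv.preimage_image S

variable [IsUltrametricDist K]

/-- Near a point where its derivative is invertible, a strictly differentiable map multiplies the
Haar measure by the absolute value of the determinant of this derivative. -/
theorem eventually_measure_image_eq (hμ : ScalesByNorm μ) {φ : (ι → K) → (ι → K)}
    {A : (ι → K) →L[K] (ι → K)} {a : ι → K} (hφ : HasStrictFDerivAt φ A a)
    (hA : A.det ≠ 0) :
    ∃ U ∈ 𝓝 a, ∀ S ⊆ U, (Measure.pi fun _ : ι => μ) (φ '' S) =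
      ‖A.det‖ₑ * (Measure.pi fun _ : ι => μ) S := by
  let B : (ι → K) ≃L[K] (ι → K) := A.toContinuousLinearEquivOfDetNeZero hA
  have hB : (B : (ι → K) →L[K] (ι → K)) = A := ContinuousLinearMap.ext fun _ => rfl
  have h1 : HasStrictFDerivAt (fun x => B.symm (φ x)) (ContinuousLinearMap.id K (ι → K)) a := by
    have := (B.symm : (ι → K) →L[K] (ι → K)).hasStrictFDerivAt (x := φ a) |>.comp a hφ
    have he : ((B.symm : (ι → K) →L[K] (ι → K)).comp A) = ContinuousLinearMap.id K (ι → K) := by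
      rw [← hB]
      exact B.coe_symm_comp_coe
    rw [he] at this
    exact this
  -- Any constant below 1 would do: the error is then strictly smaller than x - y, and an
  -- ultrametric norm is unaffected by a strictly smaller perturbation. So B⁻¹ ∘ φ is an isometry on
  -- U, and B alone accounts for the change of measure.
  obtain ⟨U, hU, hLip⟩ := h1.approximates_deriv_on_nhds (c := 1 / 2) (Or.inr (by norm_num))
  refine ⟨U, hU, fun S hS => ?_⟩
  have hiso : ∀ x ∈ S, ∀ y ∈ S, dist (B.symm (φ x)) (B.symm (φ y)) = dist x y := by
    intro x hx y hy
    rcases eq_or_ne x y with rfl | hxy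
    · simp
    have h := hLip x (hS hx) y (hS hy)
    simp only [ContinuousLinearMap.coe_id', id] at h
    have hpos : 0 < ‖x - y‖ := norm_pos_iff.2 (sub_ne_zero.2 hxy)
    have hlt : ‖B.symm (φ x) - B.symm (φ y) - (x - y)‖ < ‖x - y‖ := by
      refine h.trans_lt ?_
      push_cast
      linarith
    rw [dist_eq_norm, dist_eq_norm]
    have := IsUltrametricDist.norm_add_eq_max_of_norm_ne_norm hlt.ne
    rw [sub_add_cancel, max_eq_right hlt.le] at this
    exact this
  have h2 := measure_image_of_isometryOn (Measure.pi fun _ : ι => μ) hiso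
  have h3 := measure_image_continuousLinearEquiv hμ B ((fun x => B.symm (φ x)) '' S)
  rw [h2, image_image] at h3
  simp only [ContinuousLinearEquiv.apply_symm_apply] at h3
  rw [h3]
  congr 1

/-- The change of variables formula for an injective map with invertible strict derivatives. -/
theorem measure_image_eq_lintegral_det (hμ : ScalesByNorm μ) {φ : (ι → K) → (ι → K)}
    {φ' : (ι → K) → (ι → K) →L[K] (ι → K)} {s Q : Set (ι → K)}
    (hφ : ∀ x ∈ s, HasStrictFDerivAt φ (φ' x) x) (hdet : ∀ x ∈ s, (φ' x).det ≠ 0)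
    (hcont : ∀ x ∈ s, ∀ᶠ y in 𝓝 x, ‖(φ' y).det‖ₑ = ‖(φ' x).det‖ₑ) (hinj : InjOn φ s)
    (hQ : MeasurableSet Q) (hQs : Q ⊆ s) :
    (Measure.pi fun _ : ι => μ) (φ '' Q) =
      ∫⁻ x in Q, ‖(φ' x).det‖ₑ ∂(Measure.pi fun _ : ι => μ) := by
  have hloc : ∀ x : ι → K, ∃ V : Set (ι → K), x ∈ s → IsOpen V ∧ x ∈ V ∧
      (∀ S ⊆ V, (Measure.pi fun _ : ι => μ) (φ '' S) =
        ‖(φ' x).det‖ₑ * (Measure.pi fun _ : ι => μ) S) ∧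
      ∀ y ∈ V, ‖(φ' y).det‖ₑ = ‖(φ' x).det‖ₑ := by
    intro x
    by_cases hx : x ∈ s
    · obtain ⟨U, hU, h⟩ := eventually_measure_image_eq hμ (hφ x hx) (hdet x hx)
      obtain ⟨V, hV, hVo, hxV⟩ := _root_.mem_nhds_iff.1 (inter_mem hU (hcont x hx))
      exact ⟨V, fun _ => ⟨hVo, hxV, fun S hS => h S (hS.trans (hV.trans inter_subset_left)),
        fun y hy => (hV hy).2⟩⟩
    · exact ⟨∅, fun h => absurd h hx⟩
  choose V hV using hloc
  obtain ⟨t, hts, htc, hcov⟩ := TopologicalSpace.countable_cover_nhdsWithin (f := V) (s := s)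
    fun x hx => mem_nhdsWithin_of_mem_nhds ((hV x hx).1.mem_nhds (hV x hx).2.1)
  rcases t.eq_empty_or_nonempty with rfl | hne
  · have : Q = ∅ := by
      refine subset_empty_iff.1 (hQs.trans (hcov.trans ?_))
      simp
    simp [this]
  obtain ⟨x, rfl⟩ := htc.exists_eq_range hne
  have hx : ∀ i, x i ∈ s := fun i => hts (mem_range_self i)
  -- Countably many neighbourhoods suffice by second countability. Made disjoint, they cut Q into
  -- parts on which the Jacobian factor is constant and the local formula holds for every subset.
  let P : ℕ → Set (ι → K) := fun i => Q ∩ disjointed (fun i => V (x i)) i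
  have hPm : ∀ i, MeasurableSet (P i) := fun i =>
    hQ.inter (MeasurableSet.disjointed (fun i => (hV _ (hx i)).1.measurableSet) i)
  have hPV : ∀ i, P i ⊆ V (x i) := fun i =>
    inter_subset_right.trans (disjointed_subset _ i)
  have hPd : Pairwise (Function.onFun Disjoint P) := fun i j hij =>
    (disjoint_disjointed (fun i => V (x i)) hij).mono inter_subset_right inter_subset_right
  have hPQ : ⋃ i, P i = Q := by
    rw [← inter_iUnion, iUnion_disjointed]
    refine inter_eq_left.2 (hQs.trans (hcov.trans ?_))
    simp
  have hPs : ∀ i, P i ⊆ s := fun i => inter_subset_left.trans hQs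
  have hcφ : ContinuousOn φ s := fun y hy => (hφ y hy).continuousAt.continuousWithinAt
  rw [← hPQ, image_iUnion, measure_iUnion _ _, lintegral_iUnion hPm hPd]
  · refine tsum_congr fun i => ?_
    rw [(hV _ (hx i)).2.2.1 _ (hPV i),
      setLIntegral_congr_fun (hPm i) fun y hy => (hV _ (hx i)).2.2.2 y (hPV i hy),
      setLIntegral_const]
  · intro i j hij
    exact disjoint_image_image fun y hy z hz h =>
      Set.disjoint_left.1 (hPd hij) hy (hinj (hPs i hy) (hPs j hz) h ▸ hz)
  · exact fun i => (hPm i).image_of_continuousOn_injOn (hcφ.mono (hPs i)) (hinj.mono (hPs i))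

end ChangeOfVariables

end LocalDensity

namespace LocalDensity

open MeasureTheory Metric Set Filter Topology
open scoped Matrix

/-! ### Jacobian minors and the Leray form -/

section Minors

variable {N m n : ℕ}

/-- Among the columns of a matrix with independent rows there are some that form an invertible
square matrix. -/
theorem exists_equiv_det_ne_zero {K : Type*} [Field K] (hn : n + m = N)
    {J : Matrix (Fin m) (Fin (N + 1)) K} (hJ : LinearIndependent K J) :
    ∃ e : Fin m ⊕ Fin (n + 1) ≃ Fin (N + 1),
      (Matrix.of fun i j : Fin m => J i (e (Sum.inl j))).det ≠ 0 := by
  have hrank : Module.finrank K (Submodule.span K (range J.col)) = m := by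
    rw [← Matrix.rank_eq_finrank_span_cols, Matrix.rank_eq_finrank_span_row]
    exact (finrank_span_eq_card hJ).trans (Fintype.card_fin m)
  obtain ⟨g', hg', -, hli'⟩ := Submodule.exists_fun_fin_finrank_span_eq K (range J.col)
  let g : Fin m → Fin m → K := g' ∘ finCongr hrank.symm
  have hg : ∀ i, ∃ j, J.col j = g i := fun i => hg' _
  have hli : LinearIndependent K g := hli'.comp _ (finCongr hrank.symm).injective
  choose k hk using hg
  have hkinj : Function.Injective k := fun i j h => hli.injective (by rw [← hk, ← hk, h])
  -- The columns `k` form a basis of the column space. The others, N + 1 - m = n + 1 in number, may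
  -- be enumerated in any order.
  have hcard : Fintype.card (Fin (n + 1)) = Fintype.card ((range k)ᶜ : Set (Fin (N + 1))) := by
    classical
    rw [Fintype.card_compl_set, Fintype.card_fin, Fintype.card_fin, Set.card_range_of_injective hkinj,
      Fintype.card_fin]
    omega
  let e : Fin m ⊕ Fin (n + 1) ≃ Fin (N + 1) :=
    ((Equiv.ofInjective k hkinj).sumCongr (Fintype.equivOfCardEq hcard)).trans
      (Equiv.Set.sumCompl (range k))
  refine ⟨e, ?_⟩
  have he : (Matrix.of fun i j : Fin m => J i (e (Sum.inl j)))ᵀ = Matrix.of g := by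
    ext i j
    simp [e, ← hk]
  rw [← Matrix.det_transpose, he]
  exact ((Matrix.isUnit_iff_isUnit_det _).1
    (Matrix.linearIndependent_rows_iff_isUnit.1 hli)).ne_zero

/-- The minors of a matrix with independent rows are proportional, up to sign, to the complementary
minors of a frame of its kernel. -/
theorem exists_norm_minor_eq {K : Type*} [NormedField K] {J : Fin m → Fin (N + 1) → K}
    {T : Fin (n + 1) → Fin (N + 1) → K} (hT : LinearIndependent K T)
    (hJT : ∀ i k, ∑ j, J i j * T k j = 0) :
    ∃ c : ℝ, ∀ e : Fin m ⊕ Fin (n + 1) ≃ Fin (N + 1),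
      ‖(Matrix.of fun i j : Fin m => J i (e (Sum.inl j))).det‖ =
        c * ‖(Matrix.of fun i j : Fin (n + 1) => T i (e (Sum.inr j))).det‖ := by
  classical
  -- A left inverse Z of the frame completes J to a square matrix. Its determinant, up to sign, does
  -- not depend on how the columns are ordered, and it is the constant of proportionality.
  obtain ⟨g, hg⟩ := (Fintype.linearCombination K T).exists_leftInverse_of_injective
    (LinearMap.ker_eq_bot.2 hT.fintypeLinearCombination_injective)
  let Z : Matrix (Fin (n + 1)) (Fin (N + 1)) K := LinearMap.toMatrix' g
  have hZT : ∀ k l, ∑ j, Z k j * T l j = if k = l then 1 else 0 := by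
    intro k l
    have h := LinearMap.congr_fun hg (Pi.single l 1)
    have h' := congrFun h k
    rw [LinearMap.comp_apply, Fintype.linearCombination_apply_single, one_smul,
      LinearMap.id_apply, ← LinearMap.toMatrix'_mulVec g, Matrix.mulVec, dotProduct,
      Pi.single_apply] at h'
    exact h'
  by_cases hne : Nonempty (Fin m ⊕ Fin (n + 1) ≃ Fin (N + 1))
  swap
  · exact ⟨0, fun e => absurd ⟨e⟩ hne⟩
  obtain ⟨e₀⟩ := hne
  let G : (Fin m ⊕ Fin (n + 1) ≃ Fin (N + 1)) →
      Matrix (Fin m ⊕ Fin (n + 1)) (Fin m ⊕ Fin (n + 1)) K :=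
    fun e => (Matrix.fromRows (Matrix.of J) Z).submatrix id e
  refine ⟨‖(G e₀).det‖, fun e => ?_⟩
  have hG : ‖(G e).det‖ = ‖(G e₀).det‖ := by
    have : G e = (G e₀).submatrix id (e.trans e₀.symm) := by
      ext i j; simp [G]
    rw [this, Matrix.det_permute', norm_mul]
    rcases Int.units_eq_one_or (Equiv.Perm.sign (e.trans e₀.symm)) with h | h <;> simp [h]
  -- Multiplying the completed matrix by C uses J T = 0 and Z T = 1. The product is block triangular
  -- with the minor of J on its diagonal, while det C is the complementary minor of T.
  let C : Matrix (Fin m ⊕ Fin (n + 1)) (Fin m ⊕ Fin (n + 1)) K :=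
    Matrix.fromBlocks 1 (Matrix.of fun i k => T k (e (Sum.inl i))) 0
      (Matrix.of fun i k => T k (e (Sum.inr i)))
  have hC : C.det = (Matrix.of fun i j : Fin (n + 1) => T i (e (Sum.inr j))).det := by
    rw [Matrix.det_fromBlocks_zero₂₁, Matrix.det_one, one_mul, ← Matrix.det_transpose]
    rfl
  have hGC : G e * C = Matrix.fromBlocks (Matrix.of fun i j : Fin m => J i (e (Sum.inl j))) 0
      (Matrix.of fun i j => Z i (e (Sum.inl j))) 1 := by
    have hsum : ∀ u w : Fin (N + 1) → K, ∑ j, u j * w j =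
        ∑ j, u (e (Sum.inl j)) * w (e (Sum.inl j)) +
          ∑ j, u (e (Sum.inr j)) * w (e (Sum.inr j)) := by
      intro u w
      rw [← Equiv.sum_comp e, Fintype.sum_sum_type]
    ext i j
    rw [Matrix.mul_apply, Fintype.sum_sum_type]
    rcases i with i | i <;> rcases j with j | j
    · simp [G, C, Matrix.one_apply]
    · have := hJT i j
      rw [hsum] at this
      simpa [G, C] using this
    · simp [G, C, Matrix.one_apply]
    · have := hZT i j
      rw [hsum] at this
      simpa [G, C, Matrix.one_apply] using this
  have := congrArg Matrix.det hGC
  rw [Matrix.det_mul, hC, Matrix.det_fromBlocks_zero₁₂, Matrix.det_one, mul_one] at this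
  rw [← this, norm_mul, hG]

variable {K : Type*} [NontriviallyNormedField K]

/-- The minor of the Jacobian matrix of `f` at `y` formed by the columns `e (inl j)`. -/
noncomputable def jacobianMinor (f : Fin m → MvPolynomial (Fin (N + 1)) K)
    (e : Fin m ⊕ Fin (n + 1) ≃ Fin (N + 1)) (y : Fin (N + 1) → K) : K :=
  (Matrix.of fun i j : Fin m =>
    MvPolynomial.eval y (MvPolynomial.pderiv (e (Sum.inl j)) (f i))).det

/-- The minor of a frame formed by the columns `e (inr j)`. -/
noncomputable def frameMinor (e : Fin m ⊕ Fin (n + 1) ≃ Fin (N + 1))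
    (t : Fin (n + 1) → Fin (N + 1) → K) : K :=
  (Matrix.of fun i j : Fin (n + 1) => t i (e (Sum.inr j))).det

/-- On a frame of the tangent space of the cone, all splittings of the coordinates with a nonzero
Jacobian minor give the same value of the Leray form. -/
theorem absLeray_eq {f : Fin m → MvPolynomial (Fin (N + 1)) K} {y : Fin (N + 1) → K}
    {t : Fin (n + 1) → Fin (N + 1) → K} (ht : LinearIndependent K t)
    (hft : ∀ i k, ∑ j, MvPolynomial.eval y (MvPolynomial.pderiv j (f i)) * t k j = 0)
    {e : Fin m ⊕ Fin (n + 1) ≃ Fin (N + 1)} (he : jacobianMinor f e y ≠ 0) :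
    frameMinor e t ≠ 0 ∧
      absLeray f y t = ‖jacobianMinor f e y‖⁻¹ * ‖frameMinor e t‖ := by
  obtain ⟨c, hc⟩ := exists_norm_minor_eq
    (J := fun i j => MvPolynomial.eval y (MvPolynomial.pderiv j (f i))) ht hft
  replace hc : ∀ e : Fin m ⊕ Fin (n + 1) ≃ Fin (N + 1),
    ‖jacobianMinor f e y‖ = c * ‖frameMinor e t‖ := hc
  have hne : c ≠ 0 ∧ frameMinor e t ≠ 0 := by
    have h := hc e
    constructor
    · rintro rfl
      rw [zero_mul, norm_eq_zero] at h
      exact he h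
    · intro h0
      rw [h0, norm_zero, mul_zero, norm_eq_zero] at h
      exact he h
  have hc0 : 0 < c := by
    have h1 : 0 < c * ‖frameMinor e t‖ := hc e ▸ norm_pos_iff.2 he
    exact pos_of_mul_pos_left h1 (norm_nonneg _)
  have hval : ∀ e' : Fin m ⊕ Fin (n + 1) ≃ Fin (N + 1), frameMinor e' t ≠ 0 →
      ‖jacobianMinor f e' y‖⁻¹ * ‖frameMinor e' t‖ = c⁻¹ := by
    intro e' h
    rw [hc e', mul_inv, mul_assoc, inv_mul_cancel₀ (norm_ne_zero_iff.2 h), mul_one]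
  refine ⟨hne.2, ?_⟩
  rw [hval e hne.2]
  refine le_antisymm ?_ ?_
  · have : Nonempty (Fin m ⊕ Fin (n + 1) ≃ Fin (N + 1)) := ⟨e⟩
    refine ciSup_le fun e' => ?_
    change ‖jacobianMinor f e' y‖⁻¹ * ‖frameMinor e' t‖ ≤ c⁻¹
    -- When the frame minor vanishes the term is 0, below c⁻¹; every other splitting gives exactly
    -- c⁻¹, so the supremum is attained at e.
    by_cases h : frameMinor e' t = 0
    · rw [h, norm_zero, mul_zero]
      exact inv_nonneg.2 hc0.le
    · exact (hval e' h).le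
  · rw [← hval e hne.2]
    exact le_ciSup (f := fun e' : Fin m ⊕ Fin (n + 1) ≃ Fin (N + 1) =>
      ‖jacobianMinor f e' y‖⁻¹ * ‖frameMinor e' t‖) (Set.finite_range _).bddAbove e

theorem eval_smul_of_isHomogeneous {R σ : Type*} [CommSemiring R] {p : MvPolynomial σ R} {d : ℕ}
    (hp : p.IsHomogeneous d) (c : R) (y : σ → R) :
    MvPolynomial.eval (c • y) p = c ^ d * MvPolynomial.eval y p := by
  rw [MvPolynomial.eval_eq, MvPolynomial.eval_eq, Finset.mul_sum]
  refine Finset.sum_congr rfl fun s hs => ?_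
  have hd : ∑ i ∈ s.support, s i = d := by
    have := hp (MvPolynomial.mem_support_iff.1 hs)
    rw [Finsupp.weight_apply, Finsupp.sum] at this
    simpa using this
  simp only [Pi.smul_apply, smul_eq_mul, mul_pow, Finset.prod_mul_distrib,
    Finset.prod_pow_eq_pow_sum, hd]
  ring

theorem jacobianMinor_smul {f : Fin m → MvPolynomial (Fin (N + 1)) K} {d : ℕ}
    (hf : ∀ i, (f i).IsHomogeneous d) (e : Fin m ⊕ Fin (n + 1) ≃ Fin (N + 1)) (c : K)
    (y : Fin (N + 1) → K) :
    jacobianMinor f e (c • y) = c ^ (m * (d - 1)) * jacobianMinor f e y := by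
  have : (Matrix.of fun i j : Fin m =>
      MvPolynomial.eval (c • y) (MvPolynomial.pderiv (e (Sum.inl j)) (f i))) =
      c ^ (d - 1) • Matrix.of fun i j : Fin m =>
        MvPolynomial.eval y (MvPolynomial.pderiv (e (Sum.inl j)) (f i)) := by
    ext i j
    simp only [Matrix.of_apply, Matrix.smul_apply, smul_eq_mul]
    exact eval_smul_of_isHomogeneous (hf i).pderiv c y
  rw [jacobianMinor, this, Matrix.det_smul, Fintype.card_fin, ← pow_mul, mul_comm (d - 1)]
  rfl

/-- Euler's identity. It makes the radial vector y tangent to the cone at y. -/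
theorem sum_pderiv_mul_self {f : Fin m → MvPolynomial (Fin (N + 1)) K} {d : ℕ}
    (hf : ∀ i, (f i).IsHomogeneous d) {y : Fin (N + 1) → K}
    (hy : ∀ i, MvPolynomial.eval y (f i) = 0) (i : Fin m) :
    ∑ j, MvPolynomial.eval y (MvPolynomial.pderiv j (f i)) * y j = 0 := by
  have := congrArg (MvPolynomial.eval y) (hf i).sum_X_mul_pderiv
  simpa [hy i, mul_comm] using this

/-- The derivative of a polynomial function. -/
noncomputable def evalDeriv (p : MvPolynomial (Fin N) K) (y : Fin N → K) :
    (Fin N → K) →L[K] K :=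
  ∑ j, MvPolynomial.eval y (MvPolynomial.pderiv j p) • ContinuousLinearMap.proj j

theorem evalDeriv_apply (p : MvPolynomial (Fin N) K) (y t : Fin N → K) :
    evalDeriv p y t = ∑ j, MvPolynomial.eval y (MvPolynomial.pderiv j p) * t j := by
  simp [evalDeriv]

theorem hasStrictFDerivAt_eval (p : MvPolynomial (Fin N) K) (y : Fin N → K) :
    HasStrictFDerivAt (fun y => MvPolynomial.eval y p) (evalDeriv p y) y := by
  classical
  induction p using MvPolynomial.induction_on with
  | C a =>
    have : evalDeriv (MvPolynomial.C a) y = 0 := by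
      ext t; simp [evalDeriv_apply]
    rw [this]
    simpa using hasStrictFDerivAt_const a y
  | add p q hp hq =>
    have : evalDeriv (p + q) y = evalDeriv p y + evalDeriv q y := by
      ext1 t; simp [evalDeriv_apply, add_mul, Finset.sum_add_distrib]
    rw [this]
    simp only [map_add]
    exact hp.add hq
  | mul_X p i hp =>
    have h := hp.mul (ContinuousLinearMap.proj (R := K) (φ := fun _ : Fin N => K)
      i).hasStrictFDerivAt
    have he : evalDeriv (p * MvPolynomial.X i) y = MvPolynomial.eval y p •
        ContinuousLinearMap.proj (R := K) (φ := fun _ : Fin N => K) i +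
          y i • evalDeriv p y := by
      ext1 t
      simp only [evalDeriv_apply, MvPolynomial.pderiv_mul, map_add, map_mul,
        MvPolynomial.eval_X, MvPolynomial.pderiv_X, _root_.add_apply,
        _root_.smul_apply, ContinuousLinearMap.proj_apply, smul_eq_mul,
        add_mul, Finset.sum_add_distrib, Finset.mul_sum]
      rw [add_comm]
      congr 1
      · rw [Finset.sum_eq_single i]
        · simp
        · intro b _ hb
          simp [hb]
        · simp
      · exact Finset.sum_congr rfl fun _ _ => by ring
    rw [he]
    simp only [map_mul, MvPolynomial.eval_X]
    exact h

theorem continuous_jacobianMinor (f : Fin m → MvPolynomial (Fin (N + 1)) K)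
    (e : Fin m ⊕ Fin (n + 1) ≃ Fin (N + 1)) : Continuous (jacobianMinor f e) :=
  Continuous.matrix_det (continuous_matrix fun _ _ => MvPolynomial.continuous_eval _)

end Minors

end LocalDensity

namespace LocalDensity

open MeasureTheory Metric Set Filter Topology
open scoped Matrix

/-! ### Product measures along a splitting of the coordinates -/

section

variable {K : Type*} [MeasurableSpace K] {μ : Measure K} {N m n : ℕ}

theorem measure_closedBall_norm [NontriviallyNormedField K] (hμ : ScalesByNorm μ) (h1 : μ (closedBall 0 1) = 1) {a : K}
    (ha : a ≠ 0) : μ (closedBall 0 ‖a‖) = ‖a‖ₑ := by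
  rw [← hμ a ha]
  have : (a * ·) ⁻¹' closedBall 0 ‖a‖ = closedBall (0 : K) 1 := by
    ext x
    simp [norm_pos_iff.2 ha]
  rw [this, h1, mul_one]

/-- The product measure in terms of a splitting of the coordinates. -/
theorem measure_pi_splitting [SigmaFinite μ]
    (e : Fin m ⊕ Fin (n + 1) ≃ Fin (N + 1)) (A : Set (Fin m → K))
    (B : Set (Fin (n + 1) → K)) :
    (Measure.pi fun _ : Fin (N + 1) => μ)
        {z | (fun i => z (e (Sum.inl i))) ∈ A ∧ (fun j => z (e (Sum.inr j))) ∈ B} =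
      (Measure.pi fun _ : Fin m => μ) A * (Measure.pi fun _ : Fin (n + 1) => μ) B := by
  have h1 := measurePreserving_sumPiEquivProdPi (fun _ : Fin m ⊕ Fin (n + 1) => μ)
  have h2 := (measurePreserving_piCongrLeft (fun _ : Fin (N + 1) => μ) e).symm
  have h := h1.comp h2
  have h3 := ((MeasurableEquiv.piCongrLeft (fun _ : Fin (N + 1) => K) e).symm.trans
    (MeasurableEquiv.sumPiEquivProdPi fun _ : Fin m ⊕ Fin (n + 1) => K)).map_apply
      (μ := Measure.pi fun _ : Fin (N + 1) => μ) (A ×ˢ B)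
  rw [MeasurableEquiv.coe_trans, h.map_eq, Measure.prod_prod] at h3
  rw [h3]
  rfl

end

/-! ### Straightening the cone, and the volume of thin tubes -/

section Pieces

variable {K : Type*} [NontriviallyNormedField K] {N m n : ℕ}

/-- The maximum defining the norm is attained. For a vector over K its norm is therefore the
absolute value of a scalar, which can be used to rescale it to norm one. -/
theorem exists_norm_apply_eq {ι E : Type*} [Fintype ι] [Nonempty ι] [SeminormedAddGroup E]
    (y : ι → E) : ∃ j, ‖y j‖ = ‖y‖ := by
  obtain ⟨j, -, hj⟩ := Finset.exists_mem_eq_sup' (Finset.univ_nonempty (α := ι)) fun j => ‖y j‖₊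
  refine ⟨j, ?_⟩
  rw [← coe_nnnorm, ← coe_nnnorm, Pi.nnnorm_def, ← Finset.sup'_eq_sup Finset.univ_nonempty, hj]

/-- The affine cone defined by `f`. -/
def cone (f : Fin m → MvPolynomial (Fin (N + 1)) K) : Set (Fin (N + 1) → K) :=
  {y | ∀ i, MvPolynomial.eval y (f i) = 0}

theorem isClosed_cone (f : Fin m → MvPolynomial (Fin (N + 1)) K) : IsClosed (cone f) := by
  have : cone f = ⋂ i, {y | MvPolynomial.eval y (f i) = 0} := by
    ext y; simp [cone]
  rw [this]
  exact isClosed_iInter fun i => isClosed_eq (MvPolynomial.continuous_eval _) continuous_const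

/-- The tube `|f| ≤ ε` around the cone. -/
def tube (f : Fin m → MvPolynomial (Fin (N + 1)) K) (ε : ℝ) : Set (Fin (N + 1) → K) :=
  {y | ∀ i, ‖MvPolynomial.eval y (f i)‖ ≤ ε}

theorem isClosed_tube (f : Fin m → MvPolynomial (Fin (N + 1)) K) (ε : ℝ) :
    IsClosed (tube f ε) := by
  have : tube f ε = ⋂ i, {y | ‖MvPolynomial.eval y (f i)‖ ≤ ε} := by
    ext y; simp [tube]
  rw [this]
  exact isClosed_iInter fun i =>
    isClosed_le (MvPolynomial.continuous_eval _).norm continuous_const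

/-- The projection to the coordinates `e (inr j)`. -/
def coordProj (e : Fin m ⊕ Fin (n + 1) ≃ Fin (N + 1)) :
    (Fin (N + 1) → K) →L[K] (Fin (n + 1) → K) :=
  ContinuousLinearMap.pi fun j => ContinuousLinearMap.proj (e (Sum.inr j))

@[simp]
theorem coordProj_apply (e : Fin m ⊕ Fin (n + 1) ≃ Fin (N + 1)) (y : Fin (N + 1) → K)
    (j : Fin (n + 1)) : coordProj e y j = y (e (Sum.inr j)) := rfl

/-- The map that replaces the coordinates `e (inl i)` by the values of the polynomials `f i`. -/
noncomputable def straighten (f : Fin m → MvPolynomial (Fin (N + 1)) K)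
    (e : Fin m ⊕ Fin (n + 1) ≃ Fin (N + 1)) (y : Fin (N + 1) → K) : Fin (N + 1) → K :=
  fun j => Sum.elim (fun i => MvPolynomial.eval y (f i)) (coordProj e y) (e.symm j)

@[simp]
theorem straighten_inl (f : Fin m → MvPolynomial (Fin (N + 1)) K)
    (e : Fin m ⊕ Fin (n + 1) ≃ Fin (N + 1)) (y : Fin (N + 1) → K) (i : Fin m) :
    straighten f e y (e (Sum.inl i)) = MvPolynomial.eval y (f i) := by
  simp [straighten]

@[simp]
theorem straighten_inr (f : Fin m → MvPolynomial (Fin (N + 1)) K)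
    (e : Fin m ⊕ Fin (n + 1) ≃ Fin (N + 1)) (y : Fin (N + 1) → K) (j : Fin (n + 1)) :
    straighten f e y (e (Sum.inr j)) = y (e (Sum.inr j)) := by
  simp [straighten]

theorem coordProj_straighten (f : Fin m → MvPolynomial (Fin (N + 1)) K)
    (e : Fin m ⊕ Fin (n + 1) ≃ Fin (N + 1)) (y : Fin (N + 1) → K) :
    coordProj e (straighten f e y) = coordProj e y := by
  ext j; simp

/-- The derivative of `straighten f e`. -/
noncomputable def straightenDeriv (f : Fin m → MvPolynomial (Fin (N + 1)) K)
    (e : Fin m ⊕ Fin (n + 1) ≃ Fin (N + 1)) (y : Fin (N + 1) → K) :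
    (Fin (N + 1) → K) →L[K] (Fin (N + 1) → K) :=
  ContinuousLinearMap.pi fun j => Sum.elim (fun i => evalDeriv (f i) y)
    (fun k => ContinuousLinearMap.proj (e (Sum.inr k))) (e.symm j)

theorem hasStrictFDerivAt_straighten (f : Fin m → MvPolynomial (Fin (N + 1)) K)
    (e : Fin m ⊕ Fin (n + 1) ≃ Fin (N + 1)) (y : Fin (N + 1) → K) :
    HasStrictFDerivAt (straighten f e) (straightenDeriv f e y) y := by
  refine hasStrictFDerivAt_pi.2 fun j => ?_
  obtain ⟨s, rfl⟩ := e.surjective j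
  rcases s with i | k
  · simpa using hasStrictFDerivAt_eval (f i) y
  · have h := (ContinuousLinearMap.proj (R := K) (φ := fun _ : Fin (N + 1) => K)
      (e (Sum.inr k))).hasStrictFDerivAt (x := y)
    simp only [straighten, Equiv.symm_apply_apply, Sum.elim_inr]
    exact h

/-- With rows and columns ordered by e the matrix is block triangular with an identity block. The
Jacobian factor of straightening is thus the denominator of the Leray form. -/
theorem det_straightenDeriv (f : Fin m → MvPolynomial (Fin (N + 1)) K)
    (e : Fin m ⊕ Fin (n + 1) ≃ Fin (N + 1)) (y : Fin (N + 1) → K) :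
    (straightenDeriv f e y).det = jacobianMinor f e y := by
  classical
  rw [ContinuousLinearMap.det, ← LinearMap.det_toMatrix', ← Matrix.det_submatrix_equiv_self e]
  have : (LinearMap.toMatrix' (straightenDeriv f e y : (Fin (N + 1) → K) →ₗ[K] _)).submatrix e e =
      Matrix.fromBlocks
        (Matrix.of fun i j : Fin m =>
          MvPolynomial.eval y (MvPolynomial.pderiv (e (Sum.inl j)) (f i)))
        (Matrix.of fun (i : Fin m) (j : Fin (n + 1)) =>
          MvPolynomial.eval y (MvPolynomial.pderiv (e (Sum.inr j)) (f i))) 0 1 := by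
    ext i j
    rcases i with i | i <;> rcases j with j | j <;>
      simp [LinearMap.toMatrix'_apply, straightenDeriv, evalDeriv_apply, Pi.single_apply,
        Matrix.one_apply]
  rw [this, Matrix.det_fromBlocks_zero₂₁, Matrix.det_one, mul_one]
  rfl

/-- A compact open set of vectors of norm one on which the cone `f = 0` is a graph over the
coordinates `e (inr j)`, with Jacobian minor of constant absolute value. -/
structure Piece (f : Fin m → MvPolynomial (Fin (N + 1)) K) (n : ℕ) where
  /-- the splitting of the coordinates -/
  e : Fin m ⊕ Fin (n + 1) ≃ Fin (N + 1)
  /-- the compact open set -/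
  carrier : Set (Fin (N + 1) → K)
  /-- an element with the absolute value of the Jacobian minor -/
  minor : K
  isCompact : IsCompact carrier
  isOpen : IsOpen carrier
  norm_eq_one : ∀ y ∈ carrier, ‖y‖ = 1
  injOn : InjOn (straighten f e) carrier
  minor_ne_zero : minor ≠ 0
  norm_minor : ∀ y ∈ carrier, ‖jacobianMinor f e y‖ = ‖minor‖

namespace Piece

variable {f : Fin m → MvPolynomial (Fin (N + 1)) K}

/-- The difference of a piece and a compact open set. -/
def diff (P : Piece f n) (E : Set (Fin (N + 1) → K)) (hE : IsCompact E) (hE' : IsOpen E) :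
    Piece f n where
  e := P.e
  carrier := P.carrier \ E
  minor := P.minor
  isCompact := P.isCompact.diff hE'
  isOpen := P.isOpen.sdiff hE.isClosed
  norm_eq_one y hy := P.norm_eq_one y hy.1
  injOn := P.injOn.mono sdiff_subset
  minor_ne_zero := P.minor_ne_zero
  norm_minor y hy := P.norm_minor y hy.1

/-- On the cone the coordinates that straightening replaces by the values of f are zero, so the
remaining ones already determine the point. -/
theorem injOn_coordProj (P : Piece f n) : InjOn (coordProj (K := K) P.e) (P.carrier ∩ cone f) := by
  intro y hy y' hy' h
  refine P.injOn hy.1 hy'.1 ?_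
  ext j
  obtain ⟨s, rfl⟩ := P.e.surjective j
  rcases s with i | k
  · simp [hy.2 i, hy'.2 i]
  · simpa using congrFun h k

theorem jacobianMinor_ne_zero (P : Piece f n) {y : Fin (N + 1) → K} (hy : y ∈ P.carrier) :
    jacobianMinor f P.e y ≠ 0 := by
  rw [← norm_ne_zero_iff, P.norm_minor y hy]
  exact norm_ne_zero_iff.2 P.minor_ne_zero

end Piece

/-- All elements at distance less than ‖g x‖ from g x have the norm of g x. This makes the absolute
values of nonvanishing minors, and hence all densities below, locally constant. -/
theorem eventually_norm_eq {E : Type*} [TopologicalSpace E] [IsUltrametricDist K] {g : E → K}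
    {x : E} (hg : ContinuousAt g x) (hx : g x ≠ 0) : ∀ᶠ y in 𝓝 x, ‖g y‖ = ‖g x‖ := by
  have := hg (Metric.ball_mem_nhds (g x) (norm_pos_iff.2 hx))
  filter_upwards [this] with y hy
  rw [mem_preimage, mem_ball, dist_eq_norm] at hy
  have h := IsUltrametricDist.norm_add_eq_max_of_norm_ne_norm hy.ne
  rwa [sub_add_cancel, max_eq_right hy.le] at h

variable [ProperSpace K] [IsUltrametricDist K]
  (f : Fin m → MvPolynomial (Fin (N + 1)) K)

/-- The inverse function theorem, the derivative being invertible by the determinant formula. -/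
theorem straighten_injOn_nhds {e : Fin m ⊕ Fin (n + 1) ≃ Fin (N + 1)} {y : Fin (N + 1) → K}
    (he : jacobianMinor f e y ≠ 0) : ∃ U ∈ 𝓝 y, InjOn (straighten f e) U := by
  have hdet : (straightenDeriv f e y).det ≠ 0 := by rwa [det_straightenDeriv]
  have h := hasStrictFDerivAt_straighten f e y
  rw [← ContinuousLinearMap.coe_toContinuousLinearEquivOfDetNeZero _ hdet] at h
  exact ⟨_, (h.toOpenPartialHomeomorph (straighten f e)).open_source.mem_nhds
    h.mem_toOpenPartialHomeomorph_source, (h.toOpenPartialHomeomorph (straighten f e)).injOn⟩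

theorem exists_piece (hn : n + m = N) {y : Fin (N + 1) → K} (hy : ‖y‖ = 1)
    (hli : LinearIndependent K
      (fun (i : Fin m) (j : Fin (N + 1)) => MvPolynomial.eval y (MvPolynomial.pderiv j (f i)))) :
    ∃ P : Piece f n, y ∈ P.carrier := by
  obtain ⟨e, he⟩ := exists_equiv_det_ne_zero hn hli
  replace he : jacobianMinor f e y ≠ 0 := he
  obtain ⟨U, hU, hinj⟩ := straighten_injOn_nhds f he
  have hev := eventually_norm_eq (continuous_jacobianMinor f e).continuousAt he
  -- In a proper ultrametric space closed balls of nonzero radius and spheres are open as well as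
  -- closed, so their intersection is a compact open carrier.
  obtain ⟨ρ, hρ, hball⟩ := Metric.nhds_basis_closedBall.mem_iff.1 (inter_mem hU hev)
  refine ⟨⟨e, closedBall y ρ ∩ sphere 0 1, jacobianMinor f e y,
    (isCompact_closedBall y ρ).inter_right isClosed_sphere,
    (IsUltrametricDist.isOpen_closedBall y hρ.ne').inter
      (IsUltrametricDist.isOpen_sphere 0 one_ne_zero), fun z hz => by simpa using hz.2,
    hinj.mono fun z hz => (hball hz.1).1, he, fun z hz => (hball hz.1).2⟩,
    mem_closedBall_self hρ.le, by simpa using hy⟩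

/-- The vectors of norm one on the cone are covered by finitely many disjoint pieces. -/
theorem exists_pieces (hn : n + m = N)
    (hli : ∀ y ∈ cone f, y ≠ 0 → LinearIndependent K
      (fun (i : Fin m) (j : Fin (N + 1)) => MvPolynomial.eval y (MvPolynomial.pderiv j (f i)))) :
    ∃ (ι : Type) (_ : Fintype ι) (P : ι → Piece f n),
      Pairwise (Function.onFun Disjoint fun i => (P i).carrier) ∧
        sphere 0 1 ∩ cone f ⊆ ⋃ i, (P i).carrier := by
  refine ((isCompact_sphere (0 : Fin (N + 1) → K) 1).inter_right (isClosed_cone f)).induction_on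
    (p := fun s => ∃ (ι : Type) (_ : Fintype ι) (P : ι → Piece f n),
      Pairwise (Function.onFun Disjoint fun i => (P i).carrier) ∧ s ⊆ ⋃ i, (P i).carrier)
    ⟨Empty, inferInstance, Empty.elim, fun i => i.elim, empty_subset _⟩ ?_ ?_ ?_
  · rintro s t hst ⟨ι, hι, P, hP, ht⟩
    exact ⟨ι, hι, P, hP, hst.trans ht⟩
  · rintro s t ⟨ι, hι, P, hP, hs⟩ ⟨ι', hι', P', hP', ht⟩
    have hc : IsCompact (⋃ i, (P i).carrier) := isCompact_iUnion fun i => (P i).isCompact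
    have ho : IsOpen (⋃ i, (P i).carrier) := isOpen_iUnion fun i => (P i).isOpen
    -- Disjointness is kept by removing the first family from every piece of the second. Compact
    -- open sets are stable under such differences.
    refine ⟨ι ⊕ ι', inferInstance, Sum.elim P fun i => (P' i).diff _ hc ho, ?_, ?_⟩
    · rintro (i | i) (j | j) hij
      · exact hP fun h => hij (h ▸ rfl)
      · exact Set.disjoint_left.2 fun y hy hy' => hy'.2 (mem_iUnion.2 ⟨i, hy⟩)
      · exact Set.disjoint_left.2 fun y hy hy' => hy.2 (mem_iUnion.2 ⟨j, hy'⟩)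
      · exact (hP' fun h => hij (congrArg Sum.inr h)).mono sdiff_subset sdiff_subset
    · rintro y (hy | hy)
      · obtain ⟨i, hi⟩ := mem_iUnion.1 (hs hy)
        exact mem_iUnion.2 ⟨Sum.inl i, hi⟩
      · by_cases h : y ∈ ⋃ i, (P i).carrier
        · obtain ⟨i, hi⟩ := mem_iUnion.1 h
          exact mem_iUnion.2 ⟨Sum.inl i, hi⟩
        · obtain ⟨i, hi⟩ := mem_iUnion.1 (ht hy)
          exact mem_iUnion.2 ⟨Sum.inr i, hi, h⟩
  · rintro y ⟨hy, hyc⟩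
    have hy1 : ‖y‖ = 1 := by simpa using hy
    have hy0 : y ≠ 0 := by rintro rfl; simp at hy1
    obtain ⟨P, hP⟩ := exists_piece f hn hy1 (hli y hyc hy0)
    exact ⟨P.carrier, mem_nhdsWithin_of_mem_nhds (P.isOpen.mem_nhds hP), Unit, inferInstance,
      fun _ => P, fun i j h => absurd rfl h, fun z hz => mem_iUnion.2 ⟨(), hz⟩⟩

/-- At every point of the carrier the derivative is invertible, so straightening sends
neighbourhoods to neighbourhoods. -/
theorem isOpen_straighten_image {f : Fin m → MvPolynomial (Fin (N + 1)) K} (P : Piece f n) :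
    IsOpen (straighten f P.e '' P.carrier) := by
  refine isOpen_iff_mem_nhds.2 ?_
  rintro _ ⟨y, hy, rfl⟩
  have hdet : (straightenDeriv f P.e y).det ≠ 0 := by
    rw [det_straightenDeriv]
    exact P.jacobianMinor_ne_zero hy
  have h := hasStrictFDerivAt_straighten f P.e y
  rw [← ContinuousLinearMap.coe_toContinuousLinearEquivOfDetNeZero _ hdet] at h
  rw [← h.map_nhds_eq_of_equiv]
  exact image_mem_map (P.isOpen.mem_nhds hy)

/-- The image of a thin tube in a piece under `straighten f e` is a product. -/
theorem eventually_straighten_image_tube {f : Fin m → MvPolynomial (Fin (N + 1)) K}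
    (P : Piece f n) :
    ∃ ε₀ > 0, ∀ ε, 0 ≤ ε → ε < ε₀ → straighten f P.e '' (P.carrier ∩ tube f ε) =
      {z | (fun i => z (P.e (Sum.inl i))) ∈ closedBall (0 : Fin m → K) ε ∧
        (fun j => z (P.e (Sum.inr j))) ∈ coordProj P.e '' (P.carrier ∩ cone f)} := by
  have hcont : Continuous (straighten f P.e) := continuous_iff_continuousAt.2 fun y =>
    (hasStrictFDerivAt_straighten f P.e y).continuousAt
  -- The straightened piece is both compact and open, so it contains its own ε₀-thickening: points
  -- may be moved by less than ε₀ without leaving it. Changing the values of f between 0 and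
  -- anything of norm at most ε < ε₀ is such a move, and this makes the image a full product.
  obtain ⟨ε₀, hε₀, hsub⟩ := (P.isCompact.image hcont).exists_thickening_subset_open
    (isOpen_straighten_image P) subset_rfl
  have hclose : ∀ ε, 0 ≤ ε → ε < ε₀ → ∀ z w : Fin (N + 1) → K,
      (∀ i, ‖z (P.e (Sum.inl i))‖ ≤ ε) → (∀ i, w (P.e (Sum.inl i)) = 0) →
      (∀ j, z (P.e (Sum.inr j)) = w (P.e (Sum.inr j))) → dist z w < ε₀ := by
    intro ε hε hlt z w h1 h2 h3
    refine lt_of_le_of_lt ((dist_pi_le_iff hε).2 fun j => ?_) hlt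
    obtain ⟨s, rfl⟩ := P.e.surjective j
    rcases s with i | k
    · rw [h2, dist_zero_right]; exact h1 i
    · rw [h3, dist_self]; exact hε
  refine ⟨ε₀, hε₀, fun ε hε hlt => ?_⟩
  ext z
  constructor
  · rintro ⟨y, ⟨hyP, hyt⟩, rfl⟩
    refine ⟨?_, ?_⟩
    · rw [mem_closedBall, dist_zero_right, pi_norm_le_iff_of_nonneg hε]
      intro i
      simpa using hyt i
    -- The point w has the same free coordinates but value 0 for f; its preimage lies on the cone.
    · let w : Fin (N + 1) → K := fun j => Sum.elim (fun _ => 0)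
        (coordProj P.e y) (P.e.symm j)
      have hw : w ∈ straighten f P.e '' P.carrier := by
        refine hsub (mem_thickening_iff.2 ⟨straighten f P.e y, mem_image_of_mem _ hyP, ?_⟩)
        rw [dist_comm]
        exact hclose ε hε hlt _ _ (fun i => by simpa using hyt i) (by simp [w]) (by simp [w])
      obtain ⟨y', hy', hyw⟩ := hw
      refine ⟨y', ⟨hy', fun i => ?_⟩, ?_⟩
      · rw [← straighten_inl f P.e y' i, hyw]; simp [w]
      · ext j
        rw [← coordProj_straighten f P.e y', hyw]
        simp [w]
  · rintro ⟨hz, y, ⟨hyP, hyc⟩, hyz⟩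
    rw [mem_closedBall, dist_zero_right, pi_norm_le_iff_of_nonneg hε] at hz
    have hmem : z ∈ straighten f P.e '' P.carrier := by
      refine hsub (mem_thickening_iff.2 ⟨straighten f P.e y, mem_image_of_mem _ hyP, ?_⟩)
      exact hclose ε hε hlt _ _ hz (fun i => by simpa using hyc i)
        (fun j => by simpa using (congrFun hyz j).symm)
    obtain ⟨y', hy', rfl⟩ := hmem
    exact ⟨y', ⟨hy', fun i => by simpa using hz i⟩, rfl⟩

variable [MeasurableSpace K] [BorelSpace K] {μ : Measure K} [μ.IsAddHaarMeasure]

theorem measure_straighten_image (hμ : ScalesByNorm μ) {f : Fin m → MvPolynomial (Fin (N + 1)) K}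
    (P : Piece f n) {Q : Set (Fin (N + 1) → K)} (hQ : MeasurableSet Q) (hQP : Q ⊆ P.carrier) :
    (Measure.pi fun _ : Fin (N + 1) => μ) (straighten f P.e '' Q) =
      ‖P.minor‖ₑ * (Measure.pi fun _ : Fin (N + 1) => μ) Q := by
  have hen : ∀ y ∈ P.carrier, ‖(straightenDeriv f P.e y).det‖ₑ = ‖P.minor‖ₑ := by
    intro y hy
    rw [det_straightenDeriv, enorm_eq_iff_norm_eq, P.norm_minor y hy]
  rw [measure_image_eq_lintegral_det hμ (s := P.carrier)
    (fun y _ => hasStrictFDerivAt_straighten f P.e y) _ _ P.injOn hQ hQP,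
    setLIntegral_congr_fun hQ fun y hy => hen y (hQP hy), setLIntegral_const]
  · intro y hy
    rw [det_straightenDeriv]
    exact P.jacobianMinor_ne_zero hy
  · intro y hy
    filter_upwards [P.isOpen.mem_nhds hy] with z hz
    rw [hen z hz, hen y hy]

/-- The measure of the part of the cone in a piece with respect to the absolute value of the Leray
form. -/
noncomputable def Piece.leray {f : Fin m → MvPolynomial (Fin (N + 1)) K} (P : Piece f n)
    (μ : Measure K) (Y : Set (Fin (N + 1) → K)) : ℝ≥0∞ :=
  ‖P.minor‖ₑ⁻¹ * (Measure.pi fun _ : Fin (n + 1) => μ)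
    (coordProj P.e '' (P.carrier ∩ cone f ∩ Y))

/-- The volume of a thin tube around the cone in a piece. -/
theorem measure_tube_piece (hμ : ScalesByNorm μ) (h1 : μ (closedBall 0 1) = 1)
    {f : Fin m → MvPolynomial (Fin (N + 1)) K} (P : Piece f n) :
    ∃ ε₀ > 0, ∀ a : K, a ≠ 0 → ‖a‖ < ε₀ →
      (Measure.pi fun _ : Fin (N + 1) => μ) (P.carrier ∩ tube f ‖a‖) =
        ‖a‖ₑ ^ m * P.leray μ univ := by
  obtain ⟨ε₀, hε₀, h⟩ := eventually_straighten_image_tube P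
  refine ⟨ε₀, hε₀, fun a ha hlt => ?_⟩
  have hvol := measure_straighten_image hμ P
    (P.isOpen.measurableSet.inter (isClosed_tube f ‖a‖).measurableSet) inter_subset_left
  -- The product has volume ‖a‖^m times that of its base. Dividing by the constant Jacobian factor
  -- turns the volume of the base into the Leray measure.
  rw [h _ (norm_nonneg a) hlt, measure_pi_splitting, Measure.pi_closedBall _ _ (norm_nonneg a)]
    at hvol
  simp only [Pi.zero_apply, measure_closedBall_norm hμ h1 ha, Finset.prod_const,
    Finset.card_univ, Fintype.card_fin] at hvol
  have hD : ‖P.minor‖ₑ ≠ 0 := by simpa using P.minor_ne_zero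
  rw [Piece.leray, inter_univ, mul_left_comm, hvol, ← mul_assoc,
    ENNReal.inv_mul_cancel hD enorm_ne_top, one_mul]

/-- The volume of a thin tube around the cone in the vectors of norm one. -/
theorem measure_tube_sphere (hμ : ScalesByNorm μ) (h1 : μ (closedBall 0 1) = 1)
    {f : Fin m → MvPolynomial (Fin (N + 1)) K} {ι : Type*} [Fintype ι] {P : ι → Piece f n}
    (hP : Pairwise (Function.onFun Disjoint fun i => (P i).carrier))
    (hcov : sphere 0 1 ∩ cone f ⊆ ⋃ i, (P i).carrier) :
    ∃ ε₀ > 0, ∀ a : K, a ≠ 0 → ‖a‖ < ε₀ →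
      (Measure.pi fun _ : Fin (N + 1) => μ) (sphere 0 1 ∩ tube f ‖a‖) =
        ‖a‖ₑ ^ m * ∑ i, (P i).leray μ univ := by
  choose ε hε h using fun i => measure_tube_piece hμ h1 (P i)
  obtain ⟨ε₁, hε₁, h₁⟩ : ∃ ε₁ > 0, ∀ i, ε₁ ≤ ε i := by
    cases isEmpty_or_nonempty ι
    · exact ⟨1, one_pos, fun i => isEmptyElim i⟩
    · refine ⟨Finset.univ.inf' Finset.univ_nonempty ε, ?_, fun i =>
        Finset.inf'_le _ (Finset.mem_univ i)⟩
      exact (Finset.lt_inf'_iff _).2 fun i _ => hε i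
  -- The rest of the sphere is compact and f has no common zero on it, so |f| is bounded below
  -- there. Thinner tubes lie entirely in the pieces.
  obtain ⟨ε₂, hε₂, h₂⟩ : ∃ ε₂ > 0, ∀ y ∈ sphere (0 : Fin (N + 1) → K) 1 \ ⋃ i, (P i).carrier,
      ε₂ ≤ ‖fun i => MvPolynomial.eval y (f i)‖ := by
    have hc : IsCompact (sphere (0 : Fin (N + 1) → K) 1 \ ⋃ i, (P i).carrier) :=
      (isCompact_sphere _ _).diff (isOpen_iUnion fun i => (P i).isOpen)
    rcases (sphere (0 : Fin (N + 1) → K) 1 \ ⋃ i, (P i).carrier).eq_empty_or_nonempty with h | h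
    · rw [h]; exact ⟨1, one_pos, by simp⟩
    · have hcont : Continuous fun y : Fin (N + 1) → K =>
          ‖fun i => MvPolynomial.eval y (f i)‖ :=
        (continuous_pi fun i => MvPolynomial.continuous_eval _).norm
      obtain ⟨y, hy, hmin⟩ := hc.exists_isMinOn h hcont.continuousOn
      refine ⟨_, norm_pos_iff.2 fun h0 => hy.2 (hcov ⟨hy.1, fun i => congrFun h0 i⟩),
        fun z hz => hmin hz⟩
  refine ⟨min ε₁ ε₂, lt_min hε₁ hε₂, fun a ha hlt => ?_⟩
  have hunion : sphere 0 1 ∩ tube f ‖a‖ = ⋃ i, (P i).carrier ∩ tube f ‖a‖ := by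
    rw [← iUnion_inter]
    ext y
    refine and_congr_left fun hy => ⟨fun hs => ?_, fun hs => ?_⟩
    · by_contra hn
      have := h₂ y ⟨hs, hn⟩
      refine absurd ((this.trans ?_).trans_lt hlt) (not_lt.2 (min_le_right _ _))
      exact (pi_norm_le_iff_of_nonneg (norm_nonneg a)).2 hy
    · obtain ⟨i, hi⟩ := mem_iUnion.1 hs
      simpa using (P i).norm_eq_one y hi
  rw [hunion, measure_iUnion, tsum_fintype, Finset.mul_sum]
  · exact Finset.sum_congr rfl fun i _ =>
      h i a ha (hlt.trans_le ((min_le_left _ _).trans (h₁ i)))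
  · exact fun i j hij => (hP hij).mono inter_subset_left inter_subset_left
  · exact fun i => (P i).isOpen.measurableSet.inter (isClosed_tube f ‖a‖).measurableSet

end Pieces

end LocalDensity

namespace LocalDensity

open MeasureTheory Metric Set Filter Topology
open scoped Matrix

/-! ### The Leray measure over a coordinate neighbourhood -/

section Charts

variable {K : Type*} [NontriviallyNormedField K] {N m n : ℕ}
  {f : Fin m → MvPolynomial (Fin (N + 1)) K}

namespace LocalCoordinates

/-- The frame of the tangent space of the cone given by local coordinates. -/
noncomputable def frame (c : LocalCoordinates f n) (u : Fin n → K) :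
    Fin (n + 1) → Fin (N + 1) → K :=
  Fin.cons (c.lift u) fun j => fderiv K c.lift u (Pi.single j 1)

/-- The parametrization of the cone given by local coordinates. -/
def coneLift (c : LocalCoordinates f n) (x : Fin (n + 1) → K) : Fin (N + 1) → K :=
  x 0 • c.lift (Fin.tail x)

/-- The linear map that omits the first coordinate. -/
def tailCLM (K : Type*) [NontriviallyNormedField K] (n : ℕ) :
    (Fin (n + 1) → K) →L[K] (Fin n → K) :=
  ContinuousLinearMap.pi fun j => ContinuousLinearMap.proj j.succ

/-- The derivative of `coneLift`. -/
noncomputable def coneLiftDeriv (c : LocalCoordinates f n) (x : Fin (n + 1) → K) :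
    (Fin (n + 1) → K) →L[K] (Fin (N + 1) → K) :=
  x 0 • (fderiv K c.lift (Fin.tail x)).comp (tailCLM K n) +
    (ContinuousLinearMap.proj 0 : (Fin (n + 1) → K) →L[K] K).smulRight (c.lift (Fin.tail x))

theorem hasStrictFDerivAt_lift [CompleteSpace K] (c : LocalCoordinates f n) {u : Fin n → K}
    (hu : u ∈ c.domain) : HasStrictFDerivAt c.lift (fderiv K c.lift u) u :=
  (c.analytic u hu).hasStrictFDerivAt

theorem hasStrictFDerivAt_coneLift [CompleteSpace K] (c : LocalCoordinates f n)
    {x : Fin (n + 1) → K} (hx : Fin.tail x ∈ c.domain) :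
    HasStrictFDerivAt c.coneLift (c.coneLiftDeriv x) x := by
  have h1 : HasStrictFDerivAt (fun x : Fin (n + 1) → K => x 0)
      (ContinuousLinearMap.proj 0 : (Fin (n + 1) → K) →L[K] K) x :=
    (ContinuousLinearMap.proj (R := K) (φ := fun _ : Fin (n + 1) => K) 0).hasStrictFDerivAt
  have h2 : HasStrictFDerivAt (fun x : Fin (n + 1) → K => c.lift (Fin.tail x))
      ((fderiv K c.lift (Fin.tail x)).comp (tailCLM K n)) x :=
    HasStrictFDerivAt.comp (f := tailCLM K n) x (c.hasStrictFDerivAt_lift hx)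
      (tailCLM K n).hasStrictFDerivAt
  exact h1.smul h2

theorem coneLiftDeriv_single_zero (c : LocalCoordinates f n) (x : Fin (n + 1) → K) :
    c.coneLiftDeriv x (Pi.single 0 1) = c.lift (Fin.tail x) := by
  have : tailCLM K n (Pi.single 0 1) = 0 := by
    ext j; simp [tailCLM]
  simp [coneLiftDeriv, this]

theorem coneLiftDeriv_single_succ (c : LocalCoordinates f n) (x : Fin (n + 1) → K) (j : Fin n) :
    c.coneLiftDeriv x (Pi.single j.succ 1) =
      x 0 • fderiv K c.lift (Fin.tail x) (Pi.single j 1) := by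
  have : tailCLM K n (Pi.single j.succ 1) = Pi.single j 1 := by
    ext i; simp [tailCLM, Pi.single_apply]
  simp [coneLiftDeriv, this]

/-- The radial derivative is the lift itself, while each of the n derivatives along the chart
carries a factor x 0. -/
theorem det_coordProj_coneLiftDeriv (c : LocalCoordinates f n)
    (e : Fin m ⊕ Fin (n + 1) ≃ Fin (N + 1)) (x : Fin (n + 1) → K) :
    ((coordProj e).comp (c.coneLiftDeriv x)).det =
      x 0 ^ n * frameMinor e (c.frame (Fin.tail x)) := by
  rw [ContinuousLinearMap.det, ← LinearMap.det_toMatrix', ← Matrix.det_transpose]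
  have : (LinearMap.toMatrix' ((coordProj e).comp (c.coneLiftDeriv x) :
      (Fin (n + 1) → K) →ₗ[K] _))ᵀ = Matrix.of fun i j =>
        (Fin.cons 1 (fun _ => x 0) : Fin (n + 1) → K) i *
          (Matrix.of fun i j : Fin (n + 1) => c.frame (Fin.tail x) i (e (Sum.inr j))) i j := by
    ext i j
    rw [Matrix.transpose_apply, LinearMap.toMatrix'_apply]
    refine Fin.cases ?_ (fun k => ?_) i
    · simp [coneLiftDeriv_single_zero, frame]
    · simp [coneLiftDeriv_single_succ, frame]
  rw [this, Matrix.det_mul_column, Fin.prod_univ_succ]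
  simp [frameMinor]

/-- The radial vector is tangent by Euler's identity; the others by differentiating the equations,
which hold identically on the open domain. -/
theorem sum_pderiv_mul_frame [CompleteSpace K] (c : LocalCoordinates f n) {d : ℕ}
    (hf : ∀ i, (f i).IsHomogeneous d) {u : Fin n → K} (hu : u ∈ c.domain) (i : Fin m)
    (k : Fin (n + 1)) :
    ∑ j, MvPolynomial.eval (c.lift u) (MvPolynomial.pderiv j (f i)) * c.frame u k j = 0 := by
  refine Fin.cases ?_ (fun k => ?_) k
  · exact sum_pderiv_mul_self hf (c.eval_lift u hu) i
  · have h1 : HasFDerivAt (fun u => MvPolynomial.eval (c.lift u) (f i))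
        ((evalDeriv (f i) (c.lift u)).comp (fderiv K c.lift u)) u :=
      HasFDerivAt.comp (g := fun y => MvPolynomial.eval y (f i)) u
        (hasStrictFDerivAt_eval (f i) (c.lift u)).hasFDerivAt (c.hasStrictFDerivAt_lift hu).hasFDerivAt
    have h2 : HasFDerivAt (fun u => MvPolynomial.eval (c.lift u) (f i))
        (0 : (Fin n → K) →L[K] K) u := by
      refine (hasFDerivAt_const (0 : K) u).congr_of_eventuallyEq ?_
      filter_upwards [c.isOpen_domain.mem_nhds hu] with w hw
      exact c.eval_lift w hw i
    have h3 := congrArg (fun A : (Fin n → K) →L[K] K => A (Pi.single k 1)) (h1.unique h2)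
    simpa [evalDeriv_apply, frame] using h3

theorem linearIndependent_frame (c : LocalCoordinates f n) {u : Fin n → K} (hu : u ∈ c.domain) :
    LinearIndependent K (c.frame u) := c.immersion u hu

/-- The absolute value of the Leray form on the frame given by local coordinates is locally
constant. -/
theorem eventually_absLeray_eq [CompleteSpace K] [IsUltrametricDist K] (hn : n + m = N)
    (c : LocalCoordinates f n) {d : ℕ} (hf : ∀ i, (f i).IsHomogeneous d)
    (hli : ∀ y ∈ cone f, y ≠ 0 → LinearIndependent K
      (fun (i : Fin m) (j : Fin (N + 1)) => MvPolynomial.eval y (MvPolynomial.pderiv j (f i))))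
    {u : Fin n → K} (hu : u ∈ c.domain) :
    ∀ᶠ w in 𝓝 u, absLeray f (c.lift w) (c.frame w) = absLeray f (c.lift u) (c.frame u) := by
  obtain ⟨e, he⟩ := exists_equiv_det_ne_zero hn
    (hli _ (fun i => c.eval_lift u hu i) (c.lift_ne_zero u hu))
  replace he : jacobianMinor f e (c.lift u) ≠ 0 := he
  have hc : ContinuousAt c.lift u := (c.analytic u hu).continuousAt
  have h1 := eventually_norm_eq (g := fun w => jacobianMinor f e (c.lift w))
    ((continuous_jacobianMinor f e).continuousAt.comp hc) he
  have hd : ContinuousAt (fderiv K c.lift) u := (c.analytic u hu).fderiv.continuousAt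
  have hframe : ContinuousAt c.frame u := by
    refine continuousAt_pi.2 fun k => ?_
    refine Fin.cases ?_ (fun k => ?_) k
    · simpa [frame] using hc
    · simpa [frame] using hd.clm_apply continuousAt_const
  have hfm : Continuous (frameMinor e : (Fin (n + 1) → Fin (N + 1) → K) → K) :=
    Continuous.matrix_det (continuous_matrix fun i j => by fun_prop)
  obtain ⟨hne, heq⟩ := absLeray_eq (c.linearIndependent_frame hu)
    (c.sum_pderiv_mul_frame hf hu) he
  have h2 := eventually_norm_eq (g := fun w => frameMinor e (c.frame w))
    (hfm.continuousAt.comp hframe) hne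
  filter_upwards [h1, h2, c.isOpen_domain.mem_nhds hu] with w hw1 hw2 hw
  have hne' : jacobianMinor f e (c.lift w) ≠ 0 := by
    rw [← norm_ne_zero_iff, hw1]; exact norm_ne_zero_iff.2 he
  rw [heq, (absLeray_eq (c.linearIndependent_frame hw) (c.sum_pderiv_mul_frame hf hw) hne').2,
    hw1, hw2]

theorem coneLift_injOn (c : LocalCoordinates f n) :
    InjOn c.coneLift {x | Fin.tail x ∈ c.domain ∧ x 0 ≠ 0} := by
  rintro x ⟨hx, hx0⟩ y ⟨hy, hy0⟩ h
  simp only [coneLift] at h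
  have ht : Fin.tail x = Fin.tail y := by
    refine c.injective _ hx _ hy ((x 0)⁻¹ * y 0) ?_
    rw [← smul_smul, ← h, smul_smul, inv_mul_cancel₀ hx0, one_smul]
  rw [ht] at h
  have h0 : x 0 = y 0 := smul_left_injective K (c.lift_ne_zero _ hy) h
  rw [← Fin.cons_self_tail x, ← Fin.cons_self_tail y, h0, ht]

variable [ProperSpace K] [IsUltrametricDist K] [MeasurableSpace K] [BorelSpace K]
  {μ : Measure K} [μ.IsAddHaarMeasure]

/-- The Leray measure of the part in a piece of the cone over a set of points in a coordinate
neighbourhood. -/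
theorem leray_coneLift_image (c : LocalCoordinates f n) {d δ : ℕ}
    (hf : ∀ i, (f i).IsHomogeneous d) (hn : n + m = N) (hd : 1 ≤ d)
    (hδ : δ + m * d = N + 1) (hδ1 : 1 ≤ δ) (hμ : ScalesByNorm μ) (P : Piece f n)
    (hli : ∀ y ∈ cone f, y ≠ 0 → LinearIndependent K
      (fun (i : Fin m) (j : Fin (N + 1)) => MvPolynomial.eval y (MvPolynomial.pderiv j (f i))))
    {B : Set (Fin n → K)} (hB : B ⊆ c.domain)
    (hQ : MeasurableSet {x : Fin (n + 1) → K | Fin.tail x ∈ B ∧ c.coneLift x ∈ P.carrier}) :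
    P.leray μ {y | ∃ u ∈ B, ∃ t : K, y = t • c.lift u} =
      ∫⁻ x in {x | Fin.tail x ∈ B ∧ c.coneLift x ∈ P.carrier},
        ‖x 0‖ₑ ^ (δ - 1) *
          ENNReal.ofReal (absLeray f (c.lift (Fin.tail x)) (c.frame (Fin.tail x)))
        ∂(Measure.pi fun _ : Fin (n + 1) => μ) := by
  set Q : Set (Fin (n + 1) → K) := {x | Fin.tail x ∈ B ∧ c.coneLift x ∈ P.carrier} with hQdef
  -- The change of variables is set up on this open set, since it needs information on
  -- neighbourhoods and B is only a subset of the domain.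
  let s : Set (Fin (n + 1) → K) := {x | Fin.tail x ∈ c.domain ∧ c.coneLift x ∈ P.carrier}
  have hs0 : ∀ x ∈ s, x 0 ≠ 0 := by
    rintro x ⟨_, hx⟩ h0
    have := P.norm_eq_one _ hx
    simp [coneLift, h0] at this
  have hlift : ∀ x ∈ s, c.lift (Fin.tail x) ∈ cone f := fun x hx i => c.eval_lift _ hx.1 i
  have hcone : ∀ x ∈ s, c.coneLift x ∈ cone f := fun x hx i => by
    rw [coneLift, eval_smul_of_isHomogeneous (hf i), hlift x hx i, mul_zero]
  have hminor : ∀ x ∈ s, jacobianMinor f P.e (c.lift (Fin.tail x)) ≠ 0 := by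
    intro x hx h
    have := P.jacobianMinor_ne_zero hx.2
    rw [coneLift, jacobianMinor_smul hf, h, mul_zero] at this
    exact this rfl
  have hder : ∀ x ∈ s, HasStrictFDerivAt (fun x => coordProj P.e (c.coneLift x))
      ((coordProj P.e).comp (c.coneLiftDeriv x)) x := fun x hx =>
    (coordProj P.e).hasStrictFDerivAt.comp x (c.hasStrictFDerivAt_coneLift hx.1)
  have hdet : ∀ x ∈ s, ‖((coordProj P.e).comp (c.coneLiftDeriv x)).det‖ₑ =
      ‖P.minor‖ₑ * (‖x 0‖ₑ ^ (δ - 1) *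
        ENNReal.ofReal (absLeray f (c.lift (Fin.tail x)) (c.frame (Fin.tail x)))) := by
    intro x hx
    rw [det_coordProj_coneLiftDeriv,
      (absLeray_eq (c.linearIndependent_frame hx.1) (c.sum_pderiv_mul_frame hf hx.1)
        (hminor x hx)).2, ← ofReal_norm, ← ofReal_norm, ← ofReal_norm,
      ← ENNReal.ofReal_pow (norm_nonneg _), ← ENNReal.ofReal_mul (by positivity),
      ← ENNReal.ofReal_mul (by positivity), ← P.norm_minor _ hx.2, coneLift,
      jacobianMinor_smul hf, norm_mul, norm_mul, norm_pow, norm_pow]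
    congr 1
    have hM : ‖jacobianMinor f P.e (c.lift (Fin.tail x))‖ ≠ 0 := norm_ne_zero_iff.2 (hminor x hx)
    -- The determinant contributes |x 0|^n and the homogeneous minor takes away |x 0|^(m(d-1)). The
    -- relation δ + md = n + m + 1 leaves the exponent δ - 1.
    have hexp : n = m * (d - 1) + (δ - 1) := by
      obtain ⟨d, rfl⟩ := Nat.exists_eq_add_of_le' hd
      rw [Nat.add_sub_cancel]
      rw [Nat.mul_add, Nat.mul_one] at hδ
      omega
    have hpow : ‖x 0‖ ^ n = ‖x 0‖ ^ (m * (d - 1)) * ‖x 0‖ ^ (δ - 1) := by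
      rw [← pow_add]
      exact congrArg (‖x 0‖ ^ ·) hexp
    rw [hpow]
    field_simp
  have hen : ∀ x ∈ s, ∀ᶠ y in 𝓝 x, y ∈ s := by
    intro x hx
    have h1 : ContinuousAt (fun x : Fin (n + 1) → K => Fin.tail x) x :=
      (tailCLM K n).continuous.continuousAt
    exact inter_mem (h1 (c.isOpen_domain.mem_nhds hx.1))
      ((c.hasStrictFDerivAt_coneLift hx.1).continuousAt (P.isOpen.mem_nhds hx.2))
  have himage : coordProj P.e '' (P.carrier ∩ cone f ∩ {y | ∃ u ∈ B, ∃ t : K, y = t • c.lift u}) =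
      (fun x => coordProj P.e (c.coneLift x)) '' Q := by
    rw [← image_image (coordProj P.e) c.coneLift]
    congr 1
    ext y
    constructor
    · rintro ⟨⟨hyP, _⟩, u, hu, t, rfl⟩
      exact ⟨Fin.cons t u, ⟨by simpa using hu, by simpa [coneLift] using hyP⟩, by simp [coneLift]⟩
    · rintro ⟨x, hx, rfl⟩
      exact ⟨⟨hx.2, hcone x ⟨hB hx.1, hx.2⟩⟩, Fin.tail x, hx.1, x 0, rfl⟩
  have hQs : Q ⊆ s := fun x hx => ⟨hB hx.1, hx.2⟩
  rw [Piece.leray, himage, measure_image_eq_lintegral_det hμ (s := s) hder _ _ _ hQ hQs,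
    setLIntegral_congr_fun hQ fun x hx => hdet x (hQs hx), lintegral_const_mul' _ _ enorm_ne_top,
    ← mul_assoc, ENNReal.inv_mul_cancel (by simpa using P.minor_ne_zero) enorm_ne_top, one_mul]
  · intro x hx h
    rw [det_coordProj_coneLiftDeriv, mul_eq_zero] at h
    rcases h with h | h
    · exact hs0 x hx (eq_zero_of_pow_eq_zero h)
    · exact (absLeray_eq (c.linearIndependent_frame hx.1) (c.sum_pderiv_mul_frame hf hx.1)
        (hminor x hx)).1 h
  · intro x hx
    have h0 : ∀ᶠ y in 𝓝 x, ‖y 0‖ = ‖x 0‖ :=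
      eventually_norm_eq (continuous_apply 0).continuousAt (hs0 x hx)
    have h1 : ContinuousAt (fun x : Fin (n + 1) → K => Fin.tail x) x :=
      (tailCLM K n).continuous.continuousAt
    filter_upwards [hen x hx, h0, h1.eventually (c.eventually_absLeray_eq hn hf hli hx.1)]
      with y hy hy0 hy1
    rw [hdet x hx, hdet y hy, hy1, enorm_eq_iff_norm_eq.2 hy0]
  · intro x hx y hy h
    refine c.coneLift_injOn ⟨hx.1, hs0 x hx⟩ ⟨hy.1, hs0 y hy⟩ ?_
    exact P.injOn_coordProj ⟨hx.2, hcone x hx⟩ ⟨hy.2, hcone y hy⟩ h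

/-- The Leray measure of the vectors of norm one on the cone over a set of points in a coordinate
neighbourhood. -/
theorem sum_leray_eq (c : LocalCoordinates f n) {d δ : ℕ}
    (hf : ∀ i, (f i).IsHomogeneous d) (hn : n + m = N) (hd : 1 ≤ d)
    (hδ : δ + m * d = N + 1) (hδ1 : 1 ≤ δ) (hμ : ScalesByNorm μ)
    (hli : ∀ y ∈ cone f, y ≠ 0 → LinearIndependent K
      (fun (i : Fin m) (j : Fin (N + 1)) => MvPolynomial.eval y (MvPolynomial.pderiv j (f i))))
    {ι : Type*} [Fintype ι] {P : ι → Piece f n}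
    (hP : Pairwise (Function.onFun Disjoint fun i => (P i).carrier))
    (hcov : sphere 0 1 ∩ cone f ⊆ ⋃ i, (P i).carrier)
    {B : Set (Fin n → K)} (hB : B ⊆ c.domain) (hBm : MeasurableSet B) :
    ∑ i, (P i).leray μ {y | ∃ u ∈ B, ∃ t : K, y = t • c.lift u} =
      μ (sphere 0 1) * ∫⁻ u in B, ENNReal.ofReal
        (anticanonicalNorm f δ (c.lift u) (fun j => fderiv K c.lift u (Pi.single j 1)))
        ∂(Measure.pi fun _ : Fin n => μ) := by
  classical
  have htail : Continuous fun x : Fin (n + 1) → K => (Fin.tail x : Fin n → K) :=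
    (tailCLM K n).continuous
  have hT : MeasurableSet {x : Fin (n + 1) → K | Fin.tail x ∈ B} := htail.measurable hBm
  have hcl : ContinuousOn c.coneLift {x : Fin (n + 1) → K | Fin.tail x ∈ B} := fun x hx =>
    (c.hasStrictFDerivAt_coneLift (hB hx)).continuousAt.continuousWithinAt
  have hQ : ∀ i, MeasurableSet
      {x : Fin (n + 1) → K | Fin.tail x ∈ B ∧ c.coneLift x ∈ (P i).carrier} := by
    intro i
    obtain ⟨U, hU, h⟩ := _root_.continuousOn_iff'.1 hcl _ (P i).isOpen
    have : {x : Fin (n + 1) → K | Fin.tail x ∈ B ∧ c.coneLift x ∈ (P i).carrier} =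
        U ∩ {x : Fin (n + 1) → K | Fin.tail x ∈ B} := by
      rw [← h, inter_comm]; rfl
    rw [this]
    exact hU.measurableSet.inter hT
  -- the integrand and the domain of integration in coordinates
  let g : (Fin n → K) → ℝ≥0∞ := B.piecewise
    (fun u => ENNReal.ofReal (absLeray f (c.lift u) (c.frame u))) fun _ => 0
  let l : (Fin n → K) → ℝ := B.piecewise (fun u => ‖c.lift u‖) fun _ => 0
  have hg : Measurable g := by
    refine ContinuousOn.measurable_piecewise (fun u hu => ?_) continuousOn_const hBm
    refine ContinuousAt.continuousWithinAt ?_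
    refine (tendsto_const_nhds (x := ENNReal.ofReal (absLeray f (c.lift u) (c.frame u)))).congr' ?_
    filter_upwards [c.eventually_absLeray_eq hn hf hli (hB hu)] with w hw
    rw [hw]
  have hl : Measurable l :=
    ContinuousOn.measurable_piecewise (fun u hu =>
      (c.analytic u (hB hu)).continuousAt.norm.continuousWithinAt) continuousOn_const hBm
  let E : Set (K × (Fin n → K)) := {p | ‖p.1‖ * l p.2 = 1}
  have hE : MeasurableSet E :=
    measurableSet_eq_fun (measurable_fst.norm.mul (hl.comp measurable_snd)) measurable_const
  let H : K × (Fin n → K) → ℝ≥0∞ := E.indicator fun p => ‖p.1‖ₑ ^ (δ - 1) * g p.2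
  have hH : Measurable H :=
    ((measurable_fst.enorm.pow_const _).mul (hg.comp measurable_snd)).indicator hE
  have hlB : ∀ u ∈ B, l u = ‖c.lift u‖ := fun u hu => piecewise_eq_of_mem _ _ _ hu
  have hgB : ∀ u ∈ B, g u = ENNReal.ofReal (absLeray f (c.lift u) (c.frame u)) :=
    fun u hu => piecewise_eq_of_mem _ _ _ hu
  have hunion : ⋃ i, {x : Fin (n + 1) → K | Fin.tail x ∈ B ∧ c.coneLift x ∈ (P i).carrier} =
      {x : Fin (n + 1) → K | (x 0, (Fin.tail x : Fin n → K)) ∈ E} := by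
    ext x
    simp only [mem_iUnion, mem_ofPred_eq, E]
    constructor
    · rintro ⟨i, hx, hi⟩
      have := (P i).norm_eq_one _ hi
      rwa [coneLift, norm_smul, ← hlB _ hx] at this
    · intro h
      have hx : Fin.tail x ∈ B := by
        by_contra hx
        simp [l, hx] at h
      rw [hlB _ hx, ← norm_smul] at h
      obtain ⟨i, hi⟩ := mem_iUnion.1 (hcov ⟨mem_sphere_zero_iff_norm.2 h, fun i => by
        rw [eval_smul_of_isHomogeneous (hf i), c.eval_lift _ (hB hx) i, mul_zero]⟩)
      exact ⟨i, hx, hi⟩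
  -- With a an entry of the lift of largest absolute value, t runs over a⁻¹ times the unit sphere.
  -- Its volume gives ‖a‖⁻¹ and the integrand ‖a‖^(-(δ-1)); together they form the factor ‖lift
  -- u‖^(-δ) of the metric.
  have hinner : ∀ u ∈ B, ∫⁻ t, H (t, u) ∂μ = μ (sphere 0 1) * ENNReal.ofReal
      (anticanonicalNorm f δ (c.lift u) (fun j => fderiv K c.lift u (Pi.single j 1))) := by
    intro u hu
    obtain ⟨j, hj⟩ := exists_norm_apply_eq (c.lift u)
    set a := c.lift u j with ha
    have hl0 : ‖c.lift u‖ ≠ 0 := norm_ne_zero_iff.2 (c.lift_ne_zero u (hB hu))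
    have ha0 : a ≠ 0 := by rw [← norm_ne_zero_iff, hj]; exact hl0
    have hset : ∀ t : K, (t, u) ∈ E ↔ a * t ∈ sphere (0 : K) 1 := by
      intro t
      simp only [E, mem_ofPred_eq, hlB u hu, mem_sphere_zero_iff_norm, norm_mul, hj]
      rw [mul_comm]
    have hfun : ∀ t, H (t, u) = ((a * ·) ⁻¹' sphere (0 : K) 1).indicator
        (fun _ => (‖a‖ₑ⁻¹) ^ (δ - 1) * g u) t := by
      intro t
      by_cases h : a * t ∈ sphere (0 : K) 1
      · simp only [H]
        rw [indicator_of_mem ((hset t).2 h), indicator_of_mem (by exact h)]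
        have h1 : ‖a‖ₑ * ‖t‖ₑ = 1 := by
          rw [← enorm_mul, ← ofReal_norm, mem_sphere_zero_iff_norm.1 h, ENNReal.ofReal_one]
        rw [ENNReal.eq_inv_of_mul_eq_one_left (a := ‖t‖ₑ) (by rwa [mul_comm] at h1)]
      · simp only [H]
        rw [indicator_of_notMem (fun h' => h ((hset t).1 h')), indicator_of_notMem (by exact h)]
    have hsph : MeasurableSet ((a * ·) ⁻¹' sphere (0 : K) 1) :=
      (isClosed_sphere.preimage (continuous_const_mul a)).measurableSet
    have hae : ‖a‖ₑ ≠ 0 := by simpa using ha0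
    have hscale : μ ((a * ·) ⁻¹' sphere (0 : K) 1) = ‖a‖ₑ⁻¹ * μ (sphere 0 1) := by
      rw [← hμ a ha0 (sphere 0 1), ← mul_assoc, ENNReal.inv_mul_cancel hae enorm_ne_top, one_mul]
    simp only [hfun]
    rw [lintegral_indicator_const hsph, hscale, hgB u hu, anticanonicalNorm]
    change _ = _ * ENNReal.ofReal (absLeray f (c.lift u) (c.frame u) / _)
    rw [div_eq_mul_inv, mul_comm (absLeray f _ _), ENNReal.ofReal_mul (by positivity),
      ENNReal.ofReal_inv_of_pos (by positivity), ENNReal.ofReal_pow (norm_nonneg _), ← hj,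
      ofReal_norm, ENNReal.inv_pow]
    obtain ⟨k, rfl⟩ := Nat.exists_eq_add_of_le' hδ1
    rw [Nat.add_sub_cancel, pow_succ]
    ring
  calc ∑ i, (P i).leray μ {y | ∃ u ∈ B, ∃ t : K, y = t • c.lift u}
      = ∑ i, ∫⁻ x in {x | Fin.tail x ∈ B ∧ c.coneLift x ∈ (P i).carrier},
          ‖x 0‖ₑ ^ (δ - 1) *
            ENNReal.ofReal (absLeray f (c.lift (Fin.tail x)) (c.frame (Fin.tail x)))
          ∂(Measure.pi fun _ : Fin (n + 1) => μ) :=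
        Finset.sum_congr rfl fun i _ =>
          c.leray_coneLift_image hf hn hd hδ hδ1 hμ (P i) hli hB (hQ i)
    _ = ∑ i, ∫⁻ x in {x | Fin.tail x ∈ B ∧ c.coneLift x ∈ (P i).carrier},
          H (x 0, Fin.tail x) ∂(Measure.pi fun _ : Fin (n + 1) => μ) := by
        refine Finset.sum_congr rfl fun i _ => setLIntegral_congr_fun (hQ i) fun x hx => ?_
        have hxE : (x 0, Fin.tail x) ∈ E := by
          have : x ∈ ⋃ i, {x : Fin (n + 1) → K |
            Fin.tail x ∈ B ∧ c.coneLift x ∈ (P i).carrier} := mem_iUnion.2 ⟨i, hx⟩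
          rwa [hunion] at this
        simp only [H, indicator_of_mem hxE, hgB _ hx.1]
    _ = ∫⁻ x in {x : Fin (n + 1) → K | (x 0, (Fin.tail x : Fin n → K)) ∈ E}, H (x 0, Fin.tail x)
          ∂(Measure.pi fun _ : Fin (n + 1) => μ) := by
        rw [← hunion, lintegral_iUnion hQ, tsum_fintype]
        exact fun i j hij => Set.disjoint_left.2 fun x hx hx' =>
          Set.disjoint_left.1 (hP hij) hx.2 hx'.2
    _ = ∫⁻ x, H (x 0, Fin.tail x) ∂(Measure.pi fun _ : Fin (n + 1) => μ) := by
        refine setLIntegral_eq_of_support_subset fun x hx => ?_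
        by_contra h
        exact hx (indicator_of_notMem (s := E) h _)
    -- Tonelli, separating the radial variable from the coordinates of the chart.
    _ = ∫⁻ p, H p ∂(μ.prod (Measure.pi fun _ : Fin n => μ)) := by
        exact (measurePreserving_piFinSuccAbove (fun _ : Fin (n + 1) => μ) 0).lintegral_comp hH
    _ = ∫⁻ u, ∫⁻ t, H (t, u) ∂μ ∂(Measure.pi fun _ : Fin n => μ) := lintegral_prod_symm' _ hH
    _ = ∫⁻ u in B, ∫⁻ t, H (t, u) ∂μ ∂(Measure.pi fun _ : Fin n => μ) := by
        refine (setLIntegral_eq_of_support_subset fun u hu => ?_).symm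
        by_contra h
        refine hu ?_
        simp [H, g, h, indicator]
    _ = ∫⁻ u in B, μ (sphere 0 1) * ENNReal.ofReal
        (anticanonicalNorm f δ (c.lift u) (fun j => fderiv K c.lift u (Pi.single j 1)))
        ∂(Measure.pi fun _ : Fin n => μ) := setLIntegral_congr_fun hBm hinner
    _ = _ := by
        refine lintegral_const_mul' _ _ ?_
        exact ((isCompact_sphere _ _).measure_lt_top).ne

end LocalCoordinates

end Charts

end LocalDensity

namespace LocalDensity

open MeasureTheory Metric Set Filter Topology
open scoped Matrix

/-! ### Local coordinates around every point of V -/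

section ChartExistence

variable {K : Type*} [NontriviallyNormedField K] {N m n : ℕ}
  {f : Fin m → MvPolynomial (Fin (N + 1)) K}

theorem mk_rep_smul {V : Type*} [AddCommGroup V] [Module K V] {v : V} (hv : v ≠ 0) :
    ∃ a : K, a ≠ 0 ∧ (Projectivization.mk K v hv).rep = a • v := by
  obtain ⟨a, ha⟩ := Projectivization.exists_smul_eq_mk_rep K v hv
  exact ⟨a, a.ne_zero, ha.symm⟩

theorem mem_points_mk {d : ℕ} (hf : ∀ i, (f i).IsHomogeneous d) {y : Fin (N + 1) → K}
    (hy : y ≠ 0) : Projectivization.mk K y hy ∈ points f ↔ y ∈ cone f := by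
  constructor
  · exact fun h => h y hy rfl
  · intro h z hz hzy i
    obtain ⟨a, ha⟩ := (Projectivization.mk_eq_mk_iff K z y hz hy).1 hzy
    rw [← ha]
    change MvPolynomial.eval ((a : K) • y) (f i) = 0
    rw [eval_smul_of_isHomogeneous (hf i), h i, mul_zero]

/-- A subset of the projective space whose cone is open is open. -/
theorem isOpen_projectivization {V : Type*} [AddCommGroup V] [Module K V] [TopologicalSpace V]
    {U : Set V} (hU : IsOpen U) (hs : ∀ a : K, a ≠ 0 → ∀ y ∈ U, a • y ∈ U) :
    IsOpen {x : ℙ K V | x.rep ∈ U} := by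
  change IsOpen ((fun v : {v : V // v ≠ 0} => Projectivization.mk K v.1 v.2) ⁻¹'
    {x : ℙ K V | x.rep ∈ U})
  have : (fun v : {v : V // v ≠ 0} => Projectivization.mk K v.1 v.2) ⁻¹'
      {x : ℙ K V | x.rep ∈ U} = Subtype.val ⁻¹' U := by
    ext v
    obtain ⟨a, ha, h⟩ := mk_rep_smul (K := K) v.2
    simp only [mem_preimage, mem_ofPred_eq, h]
    refine ⟨fun h' => ?_, hs a ha _⟩
    have := hs a⁻¹ (inv_ne_zero ha) _ h'
    rwa [smul_smul, inv_mul_cancel₀ ha, one_smul] at this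
  rw [this]
  exact hU.preimage continuous_subtype_val

theorem analyticAt_straighten [CompleteSpace K] (f : Fin m → MvPolynomial (Fin (N + 1)) K)
    (e : Fin m ⊕ Fin (n + 1) ≃ Fin (N + 1)) (y : Fin (N + 1) → K) :
    AnalyticAt K (straighten f e) y := by
  refine analyticAt_pi_iff.2 fun j => ?_
  obtain ⟨s, rfl⟩ := e.surjective j
  rcases s with i | k
  · simp only [straighten_inl]
    exact AnalyticOnNhd.eval_mvPolynomial (𝕜 := K) (f i) y (mem_univ _)
  · simp only [straighten_inr]
    exact (ContinuousLinearMap.proj (R := K) (φ := fun _ : Fin (N + 1) => K)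
      (e (Sum.inr k))).analyticAt y

/-- The point of `K ^ (N + 1)` with vanishing coordinates `e (inl i)` and with coordinates
`e (inr k)` given by `b` for `k = k₀` and by `u` otherwise. -/
def sliceVec (e : Fin m ⊕ Fin (n + 1) ≃ Fin (N + 1)) (k₀ : Fin (n + 1)) (b : K)
    (u : Fin n → K) : Fin (N + 1) → K :=
  fun j => Sum.elim (fun _ => 0) (k₀.insertNth b u : Fin (n + 1) → K) (e.symm j)

theorem analyticAt_sliceVec (e : Fin m ⊕ Fin (n + 1) ≃ Fin (N + 1)) (k₀ : Fin (n + 1)) (b : K)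
    (u : Fin n → K) : AnalyticAt K (sliceVec e k₀ b) u := by
  refine analyticAt_pi_iff.2 fun j => ?_
  obtain ⟨s, rfl⟩ := e.surjective j
  rcases s with i | k
  · simpa [sliceVec] using analyticAt_const
  · simp only [sliceVec, Equiv.symm_apply_apply, Sum.elim_inr]
    rcases Fin.eq_self_or_eq_succAbove k₀ k with rfl | ⟨l, rfl⟩
    · simpa using analyticAt_const
    · simp only [Fin.insertNth_apply_succAbove]
      exact (ContinuousLinearMap.proj (R := K) (φ := fun _ : Fin n => K) l).analyticAt u

/-- Every point of `V(K)` has an open neighbourhood in the projective space whose intersection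
with `V(K)` is contained in a coordinate neighbourhood. -/
theorem exists_localCoordinates [CompleteSpace K] (hn : n + m = N) {d : ℕ}
    (hf : ∀ i, (f i).IsHomogeneous d)
    (hli : ∀ y ∈ cone f, y ≠ 0 → LinearIndependent K
      (fun (i : Fin m) (j : Fin (N + 1)) => MvPolynomial.eval y (MvPolynomial.pderiv j (f i))))
    {y₀ : Fin (N + 1) → K} (hy₀ : y₀ ≠ 0) (hy₀c : y₀ ∈ cone f) :
    ∃ (c : LocalCoordinates f n) (O : Set (ℙ K (Fin (N + 1) → K))), IsOpen O ∧
      Projectivization.mk K y₀ hy₀ ∈ O ∧ O ∩ points f ⊆ range c.toPoint := by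
  obtain ⟨e, he⟩ := exists_equiv_det_ne_zero hn (hli y₀ hy₀c hy₀)
  replace he : jacobianMinor f e y₀ ≠ 0 := he
  have hdet : (straightenDeriv f e y₀).det ≠ 0 := by rwa [det_straightenDeriv]
  -- If all free coordinates of y₀ vanished, Euler's identity would put y₀ in the kernel of the
  -- invertible derivative.
  obtain ⟨k₀, hk₀⟩ : ∃ k₀, y₀ (e (Sum.inr k₀)) ≠ 0 := by
    by_contra! h
    have h0 : straightenDeriv f e y₀ y₀ = 0 := by
      ext j
      obtain ⟨s, rfl⟩ := e.surjective j
      rcases s with i | k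
      · simp [straightenDeriv, evalDeriv_apply, sum_pderiv_mul_self hf hy₀c i]
      · simp [straightenDeriv, h k]
    rw [← ContinuousLinearMap.toContinuousLinearEquivOfDetNeZero_apply _ hdet] at h0
    exact hy₀ ((ContinuousLinearEquiv.map_eq_zero_iff _).1 h0)
  set b := y₀ (e (Sum.inr k₀)) with hb
  have h := hasStrictFDerivAt_straighten f e y₀
  rw [← ContinuousLinearMap.coe_toContinuousLinearEquivOfDetNeZero _ hdet] at h
  let R := h.toOpenPartialHomeomorph (straighten f e)
  have hR : ∀ y, R y = straighten f e y := fun y => rfl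
  -- The chart dehomogenizes: f is set to 0, the free coordinate k₀ is fixed at its value b at y₀,
  -- and the other free coordinates are the parameters. The lift is the local inverse of
  -- straightening on this slice.
  let z : (Fin n → K) → (Fin (N + 1) → K) := sliceVec e k₀ b
  have hzl : ∀ u i, z u (e (Sum.inl i)) = 0 := fun u i => by simp [z, sliceVec]
  have hzk : ∀ u, z u (e (Sum.inr k₀)) = b := fun u => by simp [z, sliceVec]
  have hzs : ∀ u j, z u (e (Sum.inr (k₀.succAbove j))) = u j := fun u j => by simp [z, sliceVec]
  have hzc : Continuous z := continuous_iff_continuousAt.2 fun u =>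
    (analyticAt_sliceVec e k₀ b u).continuousAt
  have hMo : IsOpen {y : Fin (N + 1) → K | jacobianMinor f e y ≠ 0} :=
    isOpen_ne_fun (continuous_jacobianMinor f e) continuous_const
  -- The minor has to be nonzero at each point of the lift, because analyticity of the inverse is
  -- established point by point from invertibility of the derivative.
  let D : Set (Fin n → K) := {u | z u ∈ R.target ∧ jacobianMinor f e (R.symm (z u)) ≠ 0}
  have hD : IsOpen D := (R.symm.isOpen_inter_preimage hMo).preimage hzc
  have hst : ∀ u ∈ D, straighten f e (R.symm (z u)) = z u := fun u hu => R.right_inv hu.1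
  have hcoord : ∀ u ∈ D, ∀ k, R.symm (z u) (e (Sum.inr k)) = z u (e (Sum.inr k)) := by
    intro u hu k
    rw [← straighten_inr f e (R.symm (z u)) k, hst u hu]
  have han : AnalyticOnNhd K (fun u => R.symm (z u)) D := by
    intro u hu
    have hdet' : (straightenDeriv f e (R.symm (z u))).det ≠ 0 := by
      rw [det_straightenDeriv]; exact hu.2
    have h1 : AnalyticAt K R.symm (z u) := by
      refine R.analyticAt_symm (i := ContinuousLinearMap.toContinuousLinearEquivOfDetNeZero _ hdet')
        hu.1 (analyticAt_straighten f e _) ?_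
      rw [ContinuousLinearMap.coe_toContinuousLinearEquivOfDetNeZero]
      exact (hasStrictFDerivAt_straighten f e _).hasFDerivAt.fderiv
    exact h1.comp (analyticAt_sliceVec e k₀ b u)
  have hderiv : ∀ u ∈ D, ∀ (k : Fin (n + 1)) (j : Fin n),
      fderiv K (fun u => R.symm (z u)) u (Pi.single j 1) (e (Sum.inr k)) =
        (k₀.insertNth 0 (Pi.single j 1) : Fin (n + 1) → K) k := by
    intro u hu k j
    have h1 := hasFDerivAt_pi'.1 (han u hu).differentiableAt.hasFDerivAt (e (Sum.inr k))
    have heq : (fun u => z u (e (Sum.inr k))) =ᶠ[𝓝 u] fun u => R.symm (z u) (e (Sum.inr k)) := by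
      filter_upwards [hD.mem_nhds hu] with w hw
      exact (hcoord w hw k).symm
    have h2 := h1.congr_of_eventuallyEq heq
    rcases Fin.eq_self_or_eq_succAbove k₀ k with rfl | ⟨l, rfl⟩
    · simp only [hzk] at h2
      have h3 := congrArg (fun A : (Fin n → K) →L[K] K => A (Pi.single j 1))
        (h2.unique (hasFDerivAt_const _ _))
      simpa using h3
    · simp only [hzs] at h2
      have h3 := congrArg (fun A : (Fin n → K) →L[K] K => A (Pi.single j 1))
        (h2.unique (ContinuousLinearMap.proj (R := K) (φ := fun _ : Fin n => K) l).hasFDerivAt)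
      simpa using h3
  let c : LocalCoordinates f n :=
    { domain := D
      isOpen_domain := hD
      lift := fun u => R.symm (z u)
      analytic := han
      lift_ne_zero := by
        intro u hu h0
        have := hcoord u hu k₀
        rw [h0, hzk] at this
        exact hk₀ this.symm
      eval_lift := by
        intro u hu i
        rw [← straighten_inl f e, hst u hu, hzl]
      injective := by
        intro u hu u' hu' a ha
        have h1 := congrFun ha (e (Sum.inr k₀))
        rw [Pi.smul_apply, hcoord u hu, hcoord u' hu', hzk, hzk, smul_eq_mul] at h1
        have ha1 : a = 1 := by
          exact mul_right_cancel₀ hk₀ (by rw [one_mul]; exact h1.symm)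
        rw [ha1, one_smul] at ha
        ext j
        rw [← hzs u, ← hzs u', ← hst u hu, ← hst u' hu', ha]
      immersion := by
        intro u hu
        rw [Fintype.linearIndependent_iff]
        intro g hg
        rw [Fin.sum_univ_succ] at hg
        simp only [Fin.cons_zero, Fin.cons_succ] at hg
        have hk : ∀ k, g 0 * z u (e (Sum.inr k)) + ∑ j : Fin n, g j.succ *
            (k₀.insertNth 0 (Pi.single j 1) : Fin (n + 1) → K) k = 0 := by
          intro k
          have h1 := congrFun hg (e (Sum.inr k))
          simp only [Pi.add_apply, Pi.smul_apply, Finset.sum_apply, smul_eq_mul, Pi.zero_apply,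
            hderiv u hu, hcoord u hu] at h1
          exact h1
        -- On coordinate k₀ the lift equals b ≠ 0 while all its derivatives vanish, which isolates
        -- the radial coefficient. The other free coordinates then isolate the remaining ones.
        have hg0 : g 0 = 0 := by
          have h1 := hk k₀
          simp only [hzk, Fin.insertNth_apply_same, mul_zero, Finset.sum_const_zero,
            add_zero] at h1
          exact (mul_eq_zero.1 h1).resolve_right hk₀
        refine Fin.cases hg0 fun j => ?_
        have h1 := hk (k₀.succAbove j)
        rw [hg0, zero_mul, zero_add, Finset.sum_eq_single j] at h1
        · simpa using h1
        · intro l _ hl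
          simp [hl.symm]
        · simp }
  -- This rescales to the representative on the slice. It is invariant under scalars, so the
  -- condition on ρ y defines an open set of points of the projective space.
  let ρ : (Fin (N + 1) → K) → (Fin (N + 1) → K) := fun y => (b / y (e (Sum.inr k₀))) • y
  let U₀ : Set (Fin (N + 1) → K) := {y | y (e (Sum.inr k₀)) ≠ 0}
  have hU₀ : IsOpen U₀ := isOpen_ne_fun (continuous_apply _) continuous_const
  have hρ : ContinuousOn ρ U₀ :=
    (continuousOn_const.div (continuous_apply _).continuousOn fun y hy => hy).smul continuousOn_id
  let U : Set (Fin (N + 1) → K) :=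
    U₀ ∩ ρ ⁻¹' (R.source ∩ {y | jacobianMinor f e y ≠ 0})
  have hU : IsOpen U := hρ.isOpen_inter_preimage hU₀ (R.open_source.inter hMo)
  have hρa : ∀ a : K, a ≠ 0 → ∀ y, ρ (a • y) = ρ y := by
    intro a ha y
    simp only [ρ, Pi.smul_apply, smul_eq_mul, smul_smul]
    congr 1
    by_cases h0 : y (e (Sum.inr k₀)) = 0
    · simp [h0]
    · field_simp
  have hUa : ∀ a : K, a ≠ 0 → ∀ y ∈ U, a • y ∈ U := by
    intro a ha y hy
    refine ⟨mul_ne_zero ha hy.1, ?_⟩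
    rw [mem_preimage, hρa a ha]
    exact hy.2
  refine ⟨c, {x | x.rep ∈ U}, isOpen_projectivization hU hUa, ?_, ?_⟩
  · obtain ⟨a, ha, h1⟩ := mk_rep_smul (K := K) hy₀
    rw [mem_ofPred_eq, h1]
    refine hUa a ha _ ⟨hk₀, ?_⟩
    have : ρ y₀ = y₀ := by
      simp only [ρ]
      rw [← hb, div_self hk₀, one_smul]
    rw [mem_preimage, this]
    exact ⟨h.mem_toOpenPartialHomeomorph_source, he⟩
  · rintro x ⟨hx, hxp⟩
    have hx1 : x.rep (e (Sum.inr k₀)) ≠ 0 := hx.1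
    set y := ρ x.rep with hy
    have hscal : b / x.rep (e (Sum.inr k₀)) ≠ 0 := div_ne_zero hk₀ hx1
    have hyc : y ∈ cone f := by
      intro i
      rw [hy]
      simp only [ρ]
      rw [eval_smul_of_isHomogeneous (hf i), hxp x.rep x.rep_nonzero x.mk_rep i, mul_zero]
    have hyk : y (e (Sum.inr k₀)) = b := by
      simp only [hy, ρ, Pi.smul_apply, smul_eq_mul]
      field_simp
    let u : Fin n → K := fun j => y (e (Sum.inr (k₀.succAbove j)))
    have hzu : z u = R y := by
      rw [hR]
      ext j
      obtain ⟨s, rfl⟩ := e.surjective j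
      rcases s with i | k
      · rw [hzl, straighten_inl, hyc i]
      · rw [straighten_inr]
        rcases Fin.eq_self_or_eq_succAbove k₀ k with rfl | ⟨l, rfl⟩
        · rw [hzk, hyk]
        · rw [hzs]
    have hsymm : R.symm (z u) = y := by rw [hzu, R.left_inv hx.2.1]
    have hu : u ∈ D := ⟨by rw [hzu]; exact R.map_source hx.2.1, by rw [hsymm]; exact hx.2.2⟩
    refine ⟨⟨u, hu⟩, ?_⟩
    rw [← x.mk_rep]
    refine (Projectivization.mk_eq_mk_iff' K _ _ _ _).2 ⟨b / x.rep (e (Sum.inr k₀)), ?_⟩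
    exact hsymm.symm

end ChartExistence

end LocalDensity

namespace LocalDensity

open MeasureTheory Metric Set Filter Topology
open scoped Matrix

/-! ### Gluing the chart measures into ω_H -/

section Gluing

variable {K : Type*} [NontriviallyNormedField K] {N m n : ℕ}
  {f : Fin m → MvPolynomial (Fin (N + 1)) K}

/-- The nonzero vectors above a set of points of the projective space. -/
def coneOver (A : Set (ℙ K (Fin (N + 1) → K))) : Set (Fin (N + 1) → K) :=
  {y | ∃ hy : y ≠ 0, Projectivization.mk K y hy ∈ A}

theorem coneOver_eq_image (A : Set (ℙ K (Fin (N + 1) → K))) :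
    coneOver A = Subtype.val ''
      ((fun v : {v : Fin (N + 1) → K // v ≠ 0} => Projectivization.mk K v.1 v.2) ⁻¹' A) := by
  ext y
  simp [coneOver]

theorem continuous_mk : Continuous fun v : {v : Fin (N + 1) → K // v ≠ 0} =>
    Projectivization.mk K v.1 v.2 :=
  continuous_quotient_mk'

theorem isOpen_coneOver {A : Set (ℙ K (Fin (N + 1) → K))} (hA : IsOpen A) :
    IsOpen (coneOver A) := by
  rw [coneOver_eq_image]
  exact (isOpen_ne.isOpenEmbedding_subtypeVal).isOpenMap _ (hA.preimage continuous_mk)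

instance : BorelSpace (ℙ K (Fin (N + 1) → K)) := ⟨rfl⟩

theorem isClosed_points {d : ℕ} (hf : ∀ i, (f i).IsHomogeneous d) : IsClosed (points f) := by
  rw [← isOpen_compl_iff]
  have : (points f)ᶜ = {x : ℙ K (Fin (N + 1) → K) | x.rep ∈ (cone f)ᶜ} := by
    ext x
    rw [mem_compl_iff, mem_ofPred_eq, mem_compl_iff, ← mem_points_mk hf x.rep_nonzero, x.mk_rep]
  rw [this]
  refine isOpen_projectivization (isClosed_cone f).isOpen_compl fun a ha y hy h => hy fun i => ?_
  have h1 := h i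
  rw [eval_smul_of_isHomogeneous (hf i)] at h1
  exact (mul_eq_zero.1 h1).resolve_left (pow_ne_zero _ ha)

namespace Piece

variable [MeasurableSpace K] {μ : Measure K}

theorem leray_congr (P : Piece f n) {Y Y' : Set (Fin (N + 1) → K)}
    (h : ∀ y ∈ cone f, y ≠ 0 → (y ∈ Y ↔ y ∈ Y')) : P.leray μ Y = P.leray μ Y' := by
  have : P.carrier ∩ cone f ∩ Y = P.carrier ∩ cone f ∩ Y' := by
    ext y
    refine and_congr_right fun hy => h y hy.2 ?_
    rintro rfl
    simpa using P.norm_eq_one _ hy.1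
  rw [leray, leray, this]

/-- Subadditivity, which as for any outer measure needs no measurability. -/
theorem leray_le_sum (P : Piece f n) {κ : Type*} [Fintype κ] {Y : Set (Fin (N + 1) → K)}
    {Z : κ → Set (Fin (N + 1) → K)} (h : ∀ y ∈ cone f, y ≠ 0 → y ∈ Y → ∃ j, y ∈ Z j) :
    P.leray μ Y ≤ ∑ j, P.leray μ (Z j) := by
  simp only [leray, ← Finset.mul_sum]
  gcongr
  refine (measure_mono ?_).trans (measure_iUnion_fintype_le _ _)
  rw [← image_iUnion]
  refine image_mono fun y hy => ?_
  obtain ⟨j, hj⟩ := h y hy.1.2 (by rintro rfl; simpa using P.norm_eq_one _ hy.1.1) hy.2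
  exact mem_iUnion.2 ⟨j, hy.1, hj⟩

/-- Projection to the free coordinates is injective on the cone inside a piece, so disjoint sets
have disjoint images, and these are measurable as injective continuous images of Borel sets. -/
theorem sum_leray_le [BorelSpace K] [ProperSpace K] (P : Piece f n) {κ : Type*} [Fintype κ]
    {Z : κ → Set (Fin (N + 1) → K)} (hZ : Pairwise (Function.onFun Disjoint Z))
    (hZm : ∀ j, MeasurableSet (Z j)) : ∑ j, P.leray μ (Z j) ≤ P.leray μ univ := by
  simp only [leray, ← Finset.mul_sum]
  gcongr
  rw [← tsum_fintype (L := .unconditional κ), ← measure_iUnion]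
  · refine measure_mono (iUnion_subset fun j => image_mono ?_)
    exact inter_subset_inter_right _ (subset_univ _)
  · intro i j hij
    refine Set.disjoint_left.2 ?_
    rintro _ ⟨y, hy, rfl⟩ ⟨y', hy', h⟩
    have := P.injOn_coordProj hy'.1 hy.1 h
    subst this
    exact Set.disjoint_left.1 (hZ hij) hy.2 hy'.2
  · intro j
    refine MeasurableSet.image_of_continuousOn_injOn ?_ (coordProj P.e).continuous.continuousOn
      (P.injOn_coordProj.mono inter_subset_left)
    exact (P.isOpen.measurableSet.inter (isClosed_cone f).measurableSet).inter (hZm j)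

end Piece

theorem LocalCoordinates.continuous_toPoint (c : LocalCoordinates f n) :
    Continuous c.toPoint := by
  have h : Continuous fun u : c.domain => c.lift u :=
    continuousOn_iff_continuous_domRestrict.1 c.analytic.continuousOn
  exact continuous_mk.comp (h.subtype_mk fun u => c.lift_ne_zero u u.2)

variable [ProperSpace K] [IsUltrametricDist K] [MeasurableSpace K] [BorelSpace K]
  {μ : Measure K} [μ.IsAddHaarMeasure]

/-- The measure on a coordinate neighbourhood in terms of the Leray measure on the cone. -/
theorem LocalCoordinates.measure_eq_sum_leray (c : LocalCoordinates f n) {d δ : ℕ}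
    (hf : ∀ i, (f i).IsHomogeneous d) (hn : n + m = N) (hd : 1 ≤ d)
    (hδ : δ + m * d = N + 1) (hδ1 : 1 ≤ δ) (hμ : ScalesByNorm μ)
    (hli : ∀ y ∈ cone f, y ≠ 0 → LinearIndependent K
      (fun (i : Fin m) (j : Fin (N + 1)) => MvPolynomial.eval y (MvPolynomial.pderiv j (f i))))
    {ι : Type*} [Fintype ι] {P : ι → Piece f n}
    (hP : Pairwise (Function.onFun Disjoint fun i => (P i).carrier))
    (hcov : sphere 0 1 ∩ cone f ⊆ ⋃ i, (P i).carrier)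
    {A : Set (ℙ K (Fin (N + 1) → K))} (hA : MeasurableSet A) :
    μ (sphere 0 1) * c.measure δ μ A =
      ∑ i, (P i).leray μ (coneOver (A ∩ range c.toPoint)) := by
  have hdom := c.isOpen_domain.measurableSet
  have hA' : MeasurableSet (c.toPoint ⁻¹' A) := c.continuous_toPoint.measurable hA
  rw [measure, Measure.map_apply c.continuous_toPoint.measurable hA, withDensity_apply _ hA']
  have h1 := setLIntegral_subtype (μ := Measure.pi fun _ : Fin n => μ) hdom (c.toPoint ⁻¹' A)
    fun u => ENNReal.ofReal
      (anticanonicalNorm f δ (c.lift u) fun j => fderiv K c.lift u (Pi.single j 1))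
  simp only [density]
  -- After this only the sets on the cone have to be compared. The multiples of lifts and the cone
  -- over the image of the chart differ at most at the origin, which no piece contains.
  rw [h1, ← c.sum_leray_eq hf hn hd hδ hδ1 hμ hli hP hcov (Subtype.coe_image_subset _ _)
    ((MeasurableEmbedding.subtype_coe hdom).measurableSet_image.2 hA')]
  refine Finset.sum_congr rfl fun i _ => (P i).leray_congr fun y _ hy0 => ?_
  constructor
  · rintro ⟨_, ⟨u, hu, rfl⟩, t, ht⟩
    refine ⟨hy0, ?_⟩
    have : Projectivization.mk K y hy0 = c.toPoint u :=
      (Projectivization.mk_eq_mk_iff' K _ _ _ _).2 ⟨t, ht.symm⟩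
    rw [this]
    exact ⟨hu, mem_range_self u⟩
  · rintro ⟨_, hyA, u, hu⟩
    obtain ⟨t, ht⟩ := (Projectivization.mk_eq_mk_iff' K _ _ _ _).1 hu.symm
    exact ⟨u, ⟨u, by rwa [mem_preimage, hu], rfl⟩, t, ht.symm⟩

/-- The total mass of the measure `ω_H` in terms of the Leray measure on the cone. -/
theorem measure_sphere_mul_tamagawaMeasure {d δ : ℕ}
    (hf : ∀ i, (f i).IsHomogeneous d) (hn : n + m = N) (hd : 1 ≤ d)
    (hδ : δ + m * d = N + 1) (hδ1 : 1 ≤ δ) (hμ : ScalesByNorm μ)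
    (hli : ∀ y ∈ cone f, y ≠ 0 → LinearIndependent K
      (fun (i : Fin m) (j : Fin (N + 1)) => MvPolynomial.eval y (MvPolynomial.pderiv j (f i))))
    {ι : Type*} [Fintype ι] {P : ι → Piece f n}
    (hP : Pairwise (Function.onFun Disjoint fun i => (P i).carrier))
    (hcov : sphere 0 1 ∩ cone f ⊆ ⋃ i, (P i).carrier) :
    μ (sphere 0 1) * tamagawaMeasure f n δ μ (points f) = ∑ i, (P i).leray μ univ := by
  have hS0 : μ (sphere (0 : K) 1) ≠ 0 :=
    ((IsUltrametricDist.isOpen_sphere (0 : K) one_ne_zero).measure_pos μ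
      ⟨1, by simp⟩).ne'
  have hST : μ (sphere (0 : K) 1) ≠ ⊤ := (isCompact_sphere _ _).measure_lt_top.ne
  have hpm : MeasurableSet (points f) := (isClosed_points hf).measurableSet
  -- Every point of V has a representative of norm one, so compactness of the norm-one part of the
  -- cone yields finitely many charts.
  obtain ⟨k, c, O, hO, hOc, hOcov⟩ : ∃ (k : ℕ) (c : Fin k → LocalCoordinates f n)
      (O : Fin k → Set (ℙ K (Fin (N + 1) → K))), (∀ j, IsOpen (O j)) ∧
      (∀ j, O j ∩ points f ⊆ range (c j).toPoint) ∧ points f ⊆ ⋃ j, O j := by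
    have hne : ∀ y ∈ sphere (0 : Fin (N + 1) → K) 1 ∩ cone f, y ≠ 0 := by
      rintro _ ⟨hy, _⟩ rfl
      simp at hy
    choose c O hO hmem hOc using fun
      y : ↥(sphere (0 : Fin (N + 1) → K) 1 ∩ cone f) =>
        exists_localCoordinates hn hf hli (hne y y.2) y.2.2
    obtain ⟨t, ht⟩ := ((isCompact_sphere (0 : Fin (N + 1) → K) 1).inter_right
      (isClosed_cone f)).elim_nhds_subcover' (fun y hy => coneOver (O ⟨y, hy⟩)) fun y hy =>
        (isOpen_coneOver (hO ⟨y, hy⟩)).mem_nhds ⟨hne y hy, hmem ⟨y, hy⟩⟩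
    refine ⟨t.card, fun j => c (t.equivFin.symm j), fun j => O (t.equivFin.symm j),
      fun j => hO _, fun j => hOc _, ?_⟩
    intro x hx
    obtain ⟨l, hl⟩ := exists_norm_apply_eq x.rep
    have hl0 : x.rep l ≠ 0 := by
      rw [← norm_ne_zero_iff, hl]; exact norm_ne_zero_iff.2 x.rep_nonzero
    have hxc : x.rep ∈ cone f := fun i => hx x.rep x.rep_nonzero x.mk_rep i
    have hy : (x.rep l)⁻¹ • x.rep ∈ sphere (0 : Fin (N + 1) → K) 1 ∩ cone f := by
      refine ⟨?_, fun i => ?_⟩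
      · rw [mem_sphere_zero_iff_norm, norm_smul, norm_inv, hl]
        exact inv_mul_cancel₀ (norm_ne_zero_iff.2 x.rep_nonzero)
      · rw [eval_smul_of_isHomogeneous (hf i), hxc i, mul_zero]
    obtain ⟨y, hyt, hy0, hyO⟩ := mem_iUnion₂.1 (ht hy)
    have hxy : Projectivization.mk K ((x.rep l)⁻¹ • x.rep) hy0 = x := by
      conv_rhs => rw [← x.mk_rep]
      exact (Projectivization.mk_eq_mk_iff' K _ _ _ _).2 ⟨(x.rep l)⁻¹, rfl⟩
    rw [hxy] at hyO
    refine mem_iUnion.2 ⟨t.equivFin ⟨y, hyt⟩, ?_⟩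
    simpa using hyO
  let A : Fin k → Set (ℙ K (Fin (N + 1) → K)) := disjointed O
  have hAm : ∀ j, MeasurableSet (A j) := fun j =>
    disjointedRec (p := MeasurableSet) (fun _ _ ht => ht.diff (hO _).measurableSet)
      (hO j).measurableSet
  have hAd : Pairwise (Function.onFun Disjoint A) := disjoint_disjointed O
  have hAc : ∀ j, A j ∩ points f ⊆ range (c j).toPoint := fun j =>
    (inter_subset_inter_left _ (disjointed_subset O j)).trans (hOc j)
  have hAcov : points f ⊆ ⋃ j, A j := by rwa [iUnion_disjointed]
  have hmass : ∀ j, ∀ B : Set (ℙ K (Fin (N + 1) → K)), MeasurableSet B →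
      μ (sphere 0 1) * (c j).measure δ μ (B ∩ A j) =
        ∑ i, (P i).leray μ (coneOver (B ∩ A j)) := by
    intro j B hB
    rw [(c j).measure_eq_sum_leray hf hn hd hδ hδ1 hμ hli hP hcov (hB.inter (hAm j))]
    refine Finset.sum_congr rfl fun i _ => (P i).leray_congr fun y hy hy0 => ?_
    refine exists_congr fun h => and_iff_left_of_imp fun hyA => ?_
    exact hAc j ⟨hyA.2, (mem_points_mk hf _).2 hy⟩
  -- Candidate for the glued measure, formed with a disjoint refinement of the finite cover. It is
  -- to have the same mass on V as the supremum over all charts.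
  let ν : Measure (ℙ K (Fin (N + 1) → K)) := ∑ j, ((c j).measure δ μ).restrict (A j)
  have hν : ∀ B : Set (ℙ K (Fin (N + 1) → K)), MeasurableSet B →
      μ (sphere 0 1) * ν B = ∑ j, ∑ i, (P i).leray μ (coneOver (B ∩ A j)) := by
    intro B hB
    simp only [ν, Measure.finsetSum_apply, Measure.restrict_apply hB, Finset.mul_sum]
    exact Finset.sum_congr rfl fun j _ => hmass j B hB
  -- Multiplied by the volume of the units, every chart measure becomes the Leray measure on the
  -- cone, which does not refer to the chart. Hence an arbitrary chart is dominated by ν, and the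
  -- factor, positive and finite, cancels.
  have hle : tamagawaMeasure f n δ μ ≤ ν := by
    refine iSup_le fun c' => Measure.le_iff.2 fun B hB => ?_
    rw [← ENNReal.mul_le_mul_iff_right hS0 hST, hν B hB,
      c'.measure_eq_sum_leray hf hn hd hδ hδ1 hμ hli hP hcov hB, Finset.sum_comm]
    refine Finset.sum_le_sum fun i _ => (P i).leray_le_sum fun y hy hy0 hyB => ?_
    obtain ⟨h, hyB, -⟩ := hyB
    obtain ⟨j, hj⟩ := mem_iUnion.1 (hAcov ((mem_points_mk hf h).2 hy))
    exact ⟨j, h, hyB, hj⟩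
  have hge : ν (points f) ≤ tamagawaMeasure f n δ μ (points f) := by
    simp only [ν, Measure.finsetSum_apply, Measure.restrict_apply hpm]
    calc ∑ j, (c j).measure δ μ (points f ∩ A j)
        ≤ ∑ j, tamagawaMeasure f n δ μ (points f ∩ A j) :=
          Finset.sum_le_sum fun j _ => le_iSup (fun c : LocalCoordinates f n => c.measure δ μ)
            (c j) _
      _ = tamagawaMeasure f n δ μ (⋃ j, points f ∩ A j) := by
          rw [measure_iUnion, tsum_fintype]
          · exact fun i j hij => (hAd hij).mono inter_subset_right inter_subset_right
          · exact fun j => hpm.inter (hAm j)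
      _ ≤ _ := measure_mono (iUnion_subset fun j => inter_subset_left)
  have htot : μ (sphere 0 1) * ν (points f) = ∑ i, (P i).leray μ univ := by
    rw [hν _ hpm, Finset.sum_comm]
    refine Finset.sum_congr rfl fun i _ => le_antisymm ?_ ?_
    · refine (P i).sum_leray_le (fun j l hjl => ?_) fun j => ?_
      · refine Set.disjoint_left.2 ?_
        rintro y ⟨h, hy⟩ ⟨_, hy'⟩
        exact Set.disjoint_left.1 (hAd hjl) hy.2 hy'.2
      · rw [coneOver_eq_image]
        exact (MeasurableEmbedding.subtype_coe isOpen_ne.measurableSet).measurableSet_image.2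
          (continuous_mk.measurable (hpm.inter (hAm j)))
    · refine (P i).leray_le_sum fun y hy hy0 _ => ?_
      have hyp := (mem_points_mk hf hy0).2 hy
      obtain ⟨j, hj⟩ := mem_iUnion.1 (hAcov hyp)
      exact ⟨j, hy0, hyp, hj⟩
  rw [← htot, le_antisymm (hle _) hge]

end Gluing

end LocalDensity

namespace LocalDensity

open MeasureTheory Metric Set Filter Topology
open scoped Matrix

/-! ### The limit of the normalized tube volumes -/

section Density

/-- Dilation by a multiplies each equation by a^d. This reduces every shell of the unit ball to the
unit sphere, with a tube of changed radius. -/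
theorem smul_image_sphere_inter_tube {K : Type*} [NontriviallyNormedField K] {N m d : ℕ}
    {f : Fin m → MvPolynomial (Fin (N + 1)) K} (hf : ∀ i, (f i).IsHomogeneous d) {a : K}
    (ha : a ≠ 0) (ε : ℝ) :
    (a • ·) '' (sphere 0 1 ∩ tube f (ε / ‖a‖ ^ d)) = sphere 0 ‖a‖ ∩ tube f ε := by
  have hpos : 0 < ‖a‖ := norm_pos_iff.2 ha
  ext y
  constructor
  · rintro ⟨u, ⟨hu, hut⟩, rfl⟩
    refine ⟨?_, fun i => ?_⟩
    · rw [mem_sphere_zero_iff_norm] at hu ⊢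
      rw [norm_smul, hu, mul_one]
    · simp only
      rw [eval_smul_of_isHomogeneous (hf i), norm_mul, norm_pow, mul_comm,
        ← le_div_iff₀ (by positivity)]
      exact hut i
  · rintro ⟨hy, hyt⟩
    refine ⟨a⁻¹ • y, ⟨?_, fun i => ?_⟩, by simp [smul_smul, ha]⟩
    · rw [mem_sphere_zero_iff_norm] at hy ⊢
      rw [norm_smul, norm_inv, hy, inv_mul_cancel₀ hpos.ne']
    · rw [eval_smul_of_isHomogeneous (hf i), norm_mul, norm_pow, norm_inv, inv_pow, mul_comm,
        ← div_eq_mul_inv]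
      exact div_le_div_of_nonneg_right (hyt i) (by positivity)

variable {K : Type*} [NontriviallyNormedField K] [ProperSpace K]
  [MeasurableSpace K] [BorelSpace K] {μ : Measure K} [μ.IsAddHaarMeasure] {N m n : ℕ}
  {f : Fin m → MvPolynomial (Fin (N + 1)) K}

theorem measure_pi_image_smul {ι : Type*} [Fintype ι] (hμ : ScalesByNorm μ) {a : K} (ha : a ≠ 0)
    (S : Set (ι → K)) : (Measure.pi fun _ : ι => μ) ((a • ·) '' S) =
      ‖a‖ₑ ^ Fintype.card ι * (Measure.pi fun _ : ι => μ) S := by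
  have h := measure_image_continuousLinearEquiv hμ
    (ContinuousLinearEquiv.smulLeft (M₁ := ι → K) (R₁ := K) (Units.mk0 a ha)) S
  have hdet : LinearMap.det ((ContinuousLinearEquiv.smulLeft (M₁ := ι → K) (R₁ := K)
      (Units.mk0 a ha) : (ι → K) ≃L[K] (ι → K)) : (ι → K) →ₗ[K] (ι → K)) =
      a ^ Fintype.card ι := by
    have : ((ContinuousLinearEquiv.smulLeft (M₁ := ι → K) (R₁ := K)
      (Units.mk0 a ha) : (ι → K) ≃L[K] (ι → K)) : (ι → K) →ₗ[K] (ι → K)) =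
        a • LinearMap.id := rfl
    rw [this, LinearMap.det_smul, LinearMap.det_id, mul_one, Module.finrank_fintype_fun_eq_card]
  rw [hdet, enorm_pow] at h
  exact h

/-- The density of the solutions of `f = 0` modulo powers of a uniformizer `ϖ`, in terms of the
Leray measure on the cone. -/
theorem tendsto_measure_tube [IsUltrametricDist K] {d δ : ℕ}
    (hf : ∀ i, (f i).IsHomogeneous d) (hδ : δ + m * d = N + 1) (hδ1 : 1 ≤ δ)
    (hμ : ScalesByNorm μ) (h1 : μ (closedBall 0 1) = 1)
    {ι : Type*} [Fintype ι] {P : ι → Piece f n}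
    (hP : Pairwise (Function.onFun Disjoint fun i => (P i).carrier))
    (hcov : sphere 0 1 ∩ cone f ⊆ ⋃ i, (P i).carrier)
    {ϖ : K} (hϖ0 : ϖ ≠ 0) (hϖ1 : ‖ϖ‖ < 1)
    (hval : ∀ x : K, x ≠ 0 → ‖x‖ ≤ 1 → ∃ k : ℕ, ‖x‖ = ‖ϖ‖ ^ k) :
    Tendsto (fun r : ℕ => (Measure.pi fun _ : Fin (N + 1) => μ).real
      (closedBall 0 1 ∩ tube f (‖ϖ‖ ^ r)) / (‖ϖ‖ ^ r) ^ m) atTop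
      (𝓝 ((∑ i, (P i).leray μ univ).toReal / (1 - ‖ϖ‖ ^ δ))) := by
  set vol : Measure (Fin (N + 1) → K) := Measure.pi fun _ : Fin (N + 1) => μ with hvol
  set α : ℝ := (∑ i, (P i).leray μ univ).toReal with hα
  have hpos : 0 < ‖ϖ‖ := norm_pos_iff.2 hϖ0
  obtain ⟨ε₀, hε₀, htube⟩ := measure_tube_sphere hμ h1 hP hcov
  -- Normalized volume of the tube on the unit sphere: equal to α for small a, and bounded for all a
  -- ≠ 0 because the sphere has volume at most 1.
  let Γ : K → ℝ := fun a => vol.real (sphere 0 1 ∩ tube f ‖a‖) / ‖a‖ ^ m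
  have hΓα : ∀ a : K, a ≠ 0 → ‖a‖ < ε₀ → Γ a = α := by
    intro a ha hlt
    have : 0 < ‖a‖ := norm_pos_iff.2 ha
    simp only [Γ, Measure.real, hvol, htube a ha hlt, ENNReal.toReal_mul, ENNReal.toReal_pow,
      toReal_enorm]
    rw [mul_div_cancel_left₀ _ (by positivity)]
  have hα0 : 0 ≤ α := ENNReal.toReal_nonneg
  have hball : vol (closedBall 0 1) = 1 := by
    rw [hvol, Measure.pi_closedBall _ _ zero_le_one]
    simp [h1]
  have hsub : ∀ ε : ℝ, vol.real (sphere 0 1 ∩ tube f ε) ≤ 1 := by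
    intro ε
    refine ENNReal.toReal_le_of_le_ofReal zero_le_one ?_
    rw [ENNReal.ofReal_one, ← hball]
    exact measure_mono (inter_subset_left.trans sphere_subset_closedBall)
  have hΓ0 : ∀ a, 0 ≤ Γ a := fun a => by positivity
  have hΓC : ∀ a : K, a ≠ 0 → Γ a ≤ α + (ε₀ ^ m)⁻¹ := by
    intro a ha
    rcases lt_or_ge ‖a‖ ε₀ with h | h
    · rw [hΓα a ha h]
      have : 0 ≤ (ε₀ ^ m)⁻¹ := by positivity
      linarith
    · have : Γ a ≤ (ε₀ ^ m)⁻¹ := by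
        rw [← one_div]
        exact div_le_div₀ zero_le_one (hsub _) (by positivity)
          (pow_le_pow_left₀ hε₀.le h m)
      linarith
  -- The scaling factor of volume on the k-th shell splits by N + 1 = δ + md: the part md is
  -- absorbed by the rescaled radius of the tube, and the ratio of the geometric series remains.
  have hpow : ∀ k : ℕ, ‖ϖ‖ ^ (k * (N + 1)) = (‖ϖ‖ ^ δ) ^ k * (‖ϖ‖ ^ (k * d)) ^ m := by
    intro k
    rw [← hδ, ← pow_mul, ← pow_mul, ← pow_add]
    congr 1
    ring
  have hsum : ∀ r : ℕ, vol.real (closedBall 0 1 ∩ tube f (‖ϖ‖ ^ r)) / (‖ϖ‖ ^ r) ^ m =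
      ∑' k : ℕ, (‖ϖ‖ ^ δ) ^ k * Γ (ϖ ^ r / ϖ ^ (k * d)) := by
    intro r
    -- The shells exhaust the ball up to the origin, which is a null set.
    let S : ℕ → Set (Fin (N + 1) → K) := fun k => sphere 0 (‖ϖ‖ ^ k) ∩ tube f (‖ϖ‖ ^ r)
    have hSm : ∀ k, MeasurableSet (S k) := fun k =>
      (isClosed_sphere.inter (isClosed_tube f _)).measurableSet
    have hSd : Pairwise (Function.onFun Disjoint S) := by
      intro k l hkl
      refine Set.disjoint_left.2 fun y hy hy' => hkl ?_
      have h2 : ‖ϖ‖ ^ k = ‖ϖ‖ ^ l := by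
        rw [← mem_sphere_zero_iff_norm.1 hy.1, ← mem_sphere_zero_iff_norm.1 hy'.1]
      exact pow_right_injective₀ hpos hϖ1.ne h2
    have hunion : vol (closedBall 0 1 ∩ tube f (‖ϖ‖ ^ r)) = vol (⋃ k, S k) := by
      refine le_antisymm ?_ (measure_mono (iUnion_subset fun k y hy => ⟨?_, hy.2⟩))
      · have : closedBall 0 1 ∩ tube f (‖ϖ‖ ^ r) ⊆ (⋃ k, S k) ∪ {0} := by
          rintro y ⟨hy, hyt⟩
          by_cases hy0 : y = 0
          · exact Or.inr hy0
          · obtain ⟨j, hj⟩ := exists_norm_apply_eq y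
            rw [mem_closedBall_zero_iff] at hy
            have hyj : y j ≠ 0 := by
              rw [← norm_ne_zero_iff, hj]; exact norm_ne_zero_iff.2 hy0
            obtain ⟨k, hk⟩ := hval (y j) hyj (hj ▸ hy)
            exact Or.inl (mem_iUnion.2 ⟨k, mem_sphere_zero_iff_norm.2 (hj ▸ hk), hyt⟩)
        refine (measure_mono this).trans ((measure_union_le _ _).trans ?_)
        have h0 : vol {0} = 0 := by
          rw [hvol, Measure.pi_singleton]
          exact Finset.prod_eq_zero (Finset.mem_univ 0) (measure_singleton _)
        rw [h0, add_zero]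
      · rw [mem_closedBall_zero_iff, mem_sphere_zero_iff_norm.1 hy.1]
        exact pow_le_one₀ hpos.le hϖ1.le
    have hterm : ∀ k, vol (S k) = ‖ϖ ^ k‖ₑ ^ (N + 1) *
        vol (sphere 0 1 ∩ tube f ‖ϖ ^ r / ϖ ^ (k * d)‖) := by
      intro k
      have h2 := measure_pi_image_smul hμ (pow_ne_zero k hϖ0)
        (sphere (0 : Fin (N + 1) → K) 1 ∩ tube f (‖ϖ‖ ^ r / ‖ϖ ^ k‖ ^ d))
      rw [smul_image_sphere_inter_tube hf (pow_ne_zero k hϖ0), Fintype.card_fin, norm_pow] at h2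
      rw [norm_div, norm_pow, norm_pow, pow_mul]
      exact h2
    rw [Measure.real, hunion, measure_iUnion hSd hSm, ENNReal.tsum_toReal_eq, ← tsum_div_const]
    · refine tsum_congr fun k => ?_
      rw [hterm]
      simp only [ENNReal.toReal_mul, ENNReal.toReal_pow, toReal_enorm, Γ, Measure.real]
      rw [norm_div, norm_pow, norm_pow, norm_pow, ← pow_mul, hpow, div_pow]
      field_simp
    · intro k
      refine ((measure_mono (inter_subset_left.trans ?_)).trans_lt
        (isCompact_sphere (0 : Fin (N + 1) → K) (‖ϖ‖ ^ k)).measure_lt_top).ne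
      exact subset_rfl
  have hδlt : ‖ϖ‖ ^ δ < 1 := pow_lt_one₀ hpos.le hϖ1 (by omega)
  have hlim : α / (1 - ‖ϖ‖ ^ δ) = ∑' k : ℕ, (‖ϖ‖ ^ δ) ^ k * α := by
    rw [tsum_mul_right, tsum_geometric_of_lt_one (by positivity) hδlt, div_eq_inv_mul]
  simp only [hsum]
  rw [hlim]
  -- Each term is eventually constant in r, but not uniformly in k: once kd exceeds r the rescaled
  -- radius is larger than 1. The bound on Γ and δ ≥ 1 give a summable majorant.
  refine tendsto_tsum_of_dominated_convergence
    (bound := fun k => (‖ϖ‖ ^ δ) ^ k * (α + (ε₀ ^ m)⁻¹))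
    ((summable_geometric_of_lt_one (by positivity) hδlt).mul_right _) ?_ ?_
  · intro k
    refine Tendsto.const_mul _ (tendsto_const_nhds.congr' ?_)
    have ht : Tendsto (fun r : ℕ => ‖ϖ ^ r / ϖ ^ (k * d)‖) atTop (𝓝 0) := by
      have := (tendsto_pow_atTop_nhds_zero_of_lt_one hpos.le hϖ1).div_const ‖ϖ ^ (k * d)‖
      simpa using this
    filter_upwards [ht.eventually (gt_mem_nhds hε₀)] with r hr
    exact (hΓα _ (div_ne_zero (pow_ne_zero _ hϖ0) (pow_ne_zero _ hϖ0)) hr).symm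
  · refine Eventually.of_forall fun r k => ?_
    rw [Real.norm_of_nonneg (mul_nonneg (by positivity) (hΓ0 _))]
    exact mul_le_mul_of_nonneg_left
      (hΓC _ (div_ne_zero (pow_ne_zero _ hϖ0) (pow_ne_zero _ hϖ0))) (by positivity)

/-- The measure of the set of elements of norm one. -/
theorem measure_sphere_one (hμ : ScalesByNorm μ) (h1 : μ (closedBall 0 1) = 1)
    {ϖ : K} (hϖ0 : ϖ ≠ 0) (hϖ1 : ‖ϖ‖ < 1)
    (hval : ∀ x : K, x ≠ 0 → ‖x‖ ≤ 1 → ∃ k : ℕ, ‖x‖ = ‖ϖ‖ ^ k) :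
    μ (sphere 0 1) = ENNReal.ofReal (1 - ‖ϖ‖) := by
  have hpos : 0 < ‖ϖ‖ := norm_pos_iff.2 hϖ0
  have : sphere (0 : K) 1 = closedBall 0 1 \ closedBall 0 ‖ϖ‖ := by
    ext x
    simp only [mem_sphere_zero_iff_norm, Set.mem_sdiff, mem_closedBall_zero_iff, not_le]
    constructor
    · intro h
      exact ⟨h.le, h ▸ hϖ1⟩
    · rintro ⟨h, h'⟩
      obtain ⟨k, hk⟩ := hval x (norm_pos_iff.1 (hpos.trans h')) h
      rcases Nat.eq_zero_or_pos k with rfl | hk0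
      · simpa using hk
      · rw [hk] at h'
        exact absurd h' (not_lt.2 (pow_le_of_le_one hpos.le hϖ1.le hk0.ne'))
  rw [this, measure_sdiff (closedBall_subset_closedBall hϖ1.le)
    isClosed_closedBall.measurableSet.nullMeasurableSet
    (isCompact_closedBall _ _).measure_lt_top.ne, h1, measure_closedBall_norm hμ h1 hϖ0,
    ENNReal.ofReal_sub _ hpos.le, ENNReal.ofReal_one, ofReal_norm]

/-- The total mass of the measure `ω_H` in terms of the density of the solutions of `f = 0`. -/
theorem tamagawaMeasure_eq_of_isSmooth [IsUltrametricDist K] (hn : n + m = N) {d δ : ℕ} (hd : 1 ≤ d)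
    (hf : ∀ i, (f i).IsHomogeneous d) (hδ : δ + m * d = N + 1) (hδ1 : 1 ≤ δ)
    (hli : ∀ y ∈ cone f, y ≠ 0 → LinearIndependent K
      (fun (i : Fin m) (j : Fin (N + 1)) => MvPolynomial.eval y (MvPolynomial.pderiv j (f i))))
    (hμ : ScalesByNorm μ) (h1 : μ (closedBall 0 1) = 1)
    {ϖ : K} (hϖ0 : ϖ ≠ 0) (hϖ1 : ‖ϖ‖ < 1)
    (hval : ∀ x : K, x ≠ 0 → ‖x‖ ≤ 1 → ∃ k : ℕ, ‖x‖ = ‖ϖ‖ ^ k) :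
    ∃ L : ℝ, Tendsto (fun r : ℕ => (Measure.pi fun _ : Fin (N + 1) => μ).real
        (closedBall 0 1 ∩ tube f (‖ϖ‖ ^ r)) / (‖ϖ‖ ^ r) ^ m) atTop (𝓝 L) ∧
      tamagawaMeasure f n δ μ (points f) =
        ENNReal.ofReal ((1 - ‖ϖ‖ ^ δ) / (1 - ‖ϖ‖) * L) := by
  obtain ⟨ι, _, P, hP, hcov⟩ := exists_pieces f hn hli
  refine ⟨_, tendsto_measure_tube hf hδ hδ1 hμ h1 hP hcov hϖ0 hϖ1 hval, ?_⟩
  have h := measure_sphere_mul_tamagawaMeasure hf hn hd hδ hδ1 hμ hli hP hcov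
  have hfin : ∑ i, (P i).leray μ univ ≠ ⊤ := by
    refine ENNReal.sum_ne_top.2 fun i _ => ENNReal.mul_ne_top ?_ ?_
    · exact ENNReal.inv_ne_top.2 (by simpa using (P i).minor_ne_zero)
    · rw [inter_univ]
      exact (((P i).isCompact.inter_right (isClosed_cone f)).image
        (coordProj (P i).e).continuous).measure_lt_top.ne
  have hδlt : ‖ϖ‖ ^ δ < 1 := pow_lt_one₀ (norm_nonneg _) hϖ1 (by omega)
  have h1ϖ : 0 < 1 - ‖ϖ‖ := by linarith
  have h1δ : 1 - ‖ϖ‖ ^ δ ≠ 0 := by linarith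
  -- Now (1 - ‖ϖ‖) ω_H(V) = α, while L = α / (1 - ‖ϖ‖^δ); it remains to eliminate the finite number
  -- α.
  rw [measure_sphere_one hμ h1 hϖ0 hϖ1 hval, mul_comm] at h
  rw [ENNReal.eq_div_iff (by simpa using hϖ1) ENNReal.ofReal_ne_top |>.2 (mul_comm _ _ |>.trans h),
    div_mul_div_comm, mul_comm (1 - ‖ϖ‖ ^ δ), mul_div_mul_right _ _ h1δ, ENNReal.ofReal_div_of_pos h1ϖ, ENNReal.ofReal_toReal hfin]

end Density

end LocalDensity

namespace LocalDensity

open MeasureTheory Metric Set Filter Topology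
open scoped Matrix

/-! ### Norm, residue field and ideals of the completion at a finite place -/

section FinitePlace

open IsDedekindDomain IsDedekindDomain.HeightOneSpectrum WithZero

variable {F : Type*} [Field F] [NumberField F] (v : HeightOneSpectrum (𝓞 F))

theorem norm_adicCompletion_le_iff {x y : v.adicCompletion F} :
    ‖x‖ ≤ ‖y‖ ↔ Valued.v x ≤ Valued.v y :=
  Valued.toNormedField.norm_le_iff

theorem norm_adicCompletion_le_one_iff {x : v.adicCompletion F} :
    ‖x‖ ≤ 1 ↔ Valued.v x ≤ 1 :=
  Valued.toNormedField.norm_le_one_iff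

instance instIsUltrametricDistAdicCompletion : IsUltrametricDist (v.adicCompletion F) :=
  IsUltrametricDist.isUltrametricDist_of_isNonarchimedean_norm
    (Valued.isNonarchimedean_norm (v.adicCompletion F) (WithZero (Multiplicative ℤ)))

theorem closedBall_one_adicCompletion :
    closedBall (0 : v.adicCompletion F) 1 = v.adicCompletionIntegers F := by
  ext x
  rw [mem_closedBall_zero_iff, norm_adicCompletion_le_one_iff]
  rfl

theorem exists_adicCompletion_uniformizer :
    ∃ ϖ : v.adicCompletion F, Valued.v ϖ = exp (-1 : ℤ) :=
  valuedAdicCompletion_surjective F v _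

theorem mem_maximalIdeal_adicCompletionIntegers {x : v.adicCompletionIntegers F} :
    x ∈ IsLocalRing.maximalIdeal (v.adicCompletionIntegers F) ↔
      Valued.v (x : v.adicCompletion F) < 1 := by
  rw [IsLocalRing.mem_maximalIdeal, mem_nonunits_iff,
    adicCompletionIntegers.isUnit_iff_valued_eq_one]
  exact ⟨fun h => lt_of_le_of_ne x.2 h, fun h => h.ne⟩

/-- F is dense in its completion, and an element of F integral at v is congruent at v to a global
integer. -/
theorem exists_integer_valued_sub_lt_one (x : v.adicCompletionIntegers F) :
    ∃ a : 𝓞 F, Valued.v ((x - algebraMap (𝓞 F) (v.adicCompletionIntegers F) a :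
      v.adicCompletionIntegers F) : v.adicCompletion F) < 1 := by
  have hopen : IsOpen {y : v.adicCompletion F | Valued.v (y - x) < 1} := by
    have h := isOpen_ball (x := (x : v.adicCompletion F)) (ε := 1)
    convert h using 1
    ext y
    simp only [mem_ofPred_eq, mem_ball, dist_eq_norm]
    exact Valued.toNormedField.norm_lt_one_iff.symm
  obtain ⟨k, hk⟩ := (denseRange_algebraMap F v).exists_mem_open hopen ⟨x, by simp⟩
  have hk1 : v.valuation F k ≤ 1 := by
    rw [← valuedAdicCompletion_eq_valuation']
    have : (k : v.adicCompletion F) = ((k : v.adicCompletion F) - x) + x := by ring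
    rw [this]
    exact (Valuation.map_add _ _ _).trans (max_le (le_of_lt hk) x.2)
  obtain ⟨a, ha⟩ := v.exists_valuation_sub_lt_of_integer hk1 1
  refine ⟨a, ?_⟩
  have ha' : Valued.v (algebraMap F (v.adicCompletion F) (k - algebraMap (𝓞 F) F a)) < 1 := by
    rw [Valuation.map_sub_swap] at ha
    exact (valuedAdicCompletion_eq_valuation' v _).trans_lt ha
  rw [mem_ofPred_eq, Valuation.map_sub_swap] at hk
  have h := Valuation.map_add_lt Valued.v hk ha'
  rwa [map_sub, sub_add_sub_cancel] at h

/-- The global integers map onto the residue field with kernel v. The comparison is needed because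
the norm on the completion is built from the absolute norm of the ideal. -/
theorem residueCard_eq_absNorm : residueCard v = Ideal.absNorm v.asIdeal := by
  let φ : 𝓞 F →+* IsLocalRing.ResidueField (v.adicCompletionIntegers F) :=
    (IsLocalRing.residue _).comp (algebraMap (𝓞 F) (v.adicCompletionIntegers F))
  have hφ : Function.Surjective φ := by
    intro y
    obtain ⟨x, rfl⟩ := IsLocalRing.residue_surjective y
    obtain ⟨a, ha⟩ := exists_integer_valued_sub_lt_one v x
    refine ⟨a, ?_⟩
    rw [← mem_maximalIdeal_adicCompletionIntegers, ← IsLocalRing.residue_eq_zero_iff, map_sub,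
      sub_eq_zero] at ha
    exact ha.symm
  have hker : RingHom.ker φ = v.asIdeal := by
    ext a
    rw [RingHom.mem_ker, RingHom.comp_apply, IsLocalRing.residue_eq_zero_iff,
      mem_maximalIdeal_adicCompletionIntegers, ← v.valuation_lt_one_iff_mem (K := F),
      ← valuedAdicCompletion_eq_valuation']
    rfl
  rw [residueCard, Ideal.absNorm_apply, Submodule.cardQuot_apply, ← hker]
  exact (Nat.card_congr (RingHom.quotientKerEquivOfSurjective hφ).toEquiv).symm

theorem one_lt_residueCard : 1 < residueCard v := by
  rw [residueCard_eq_absNorm]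
  exact NumberField.HeightOneSpectrum.one_lt_absNorm v

theorem norm_of_valued_eq_exp {x : v.adicCompletion F} {k : ℕ}
    (hx : Valued.v x = exp (-(k : ℤ))) : ‖x‖ = ((residueCard v : ℝ)⁻¹) ^ k := by
  have h : ‖x‖ = (WithZeroMulInt.toNNReal (NumberField.HeightOneSpectrum.absNorm_ne_zero v)
    (Valued.v x) : ℝ) := NumberField.FinitePlace.norm_def v x
  rw [h, hx, residueCard_eq_absNorm, WithZeroMulInt.toNNReal_neg_apply _ exp_ne_zero]
  have h2 : (WithZero.unzero (exp_ne_zero (a := -(k : ℤ)))).toAdd = -(k : ℤ) := rfl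
  rw [h2, zpow_neg, zpow_natCast]
  simp

theorem exists_valued_eq_exp {x : v.adicCompletion F} (hx : x ≠ 0) (hx1 : ‖x‖ ≤ 1) :
    ∃ k : ℕ, Valued.v x = exp (-(k : ℤ)) := by
  rw [norm_adicCompletion_le_one_iff] at hx1
  have h0 : Valued.v x ≠ 0 := (Valuation.ne_zero_iff _).2 hx
  refine ⟨(-log (Valued.v x)).toNat, ?_⟩
  have : log (Valued.v x) ≤ 0 := by
    rw [← log_one]
    exact (log_le_log h0 one_ne_zero).2 hx1
  rw [Int.toNat_of_nonneg (by omega), neg_neg, exp_log h0]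

instance finite_residueField :
    Finite (IsLocalRing.ResidueField (v.adicCompletionIntegers F)) :=
  Nat.finite_of_card_ne_zero (by
    have := one_lt_residueCard v
    rw [residueCard] at this
    omega)

instance instProperSpaceAdicCompletion : ProperSpace (v.adicCompletion F) := by
  refine Valued.integer.properSpace_iff_completeSpace_and_isDiscreteValuationRing_integer_and_finite_residueField.2
    ⟨inferInstance, ?_, ?_⟩
  · exact (inferInstance : IsDiscreteValuationRing (v.adicCompletionIntegers F))
  · exact finite_residueField v

/-- The maximal ideal is generated by a uniformizer, and in a valuation ring divisibility is
comparison of absolute values. Congruences thereby become balls. -/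
theorem mem_maximalIdeal_pow_iff {x : v.adicCompletionIntegers F} {r : ℕ} :
    x ∈ IsLocalRing.maximalIdeal (v.adicCompletionIntegers F) ^ r ↔
      ‖(x : v.adicCompletion F)‖ ≤ ((residueCard v : ℝ)⁻¹) ^ r := by
  obtain ⟨ϖ, hϖ⟩ := exists_adicCompletion_uniformizer v
  have hϖ1 : Valued.v ϖ ≤ 1 := by
    rw [hϖ, ← exp_zero, exp_le_exp]
    norm_num
  have hϖn : ‖ϖ‖ = (residueCard v : ℝ)⁻¹ := by
    simpa using norm_of_valued_eq_exp v (x := ϖ) (k := 1) (by simpa using hϖ)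
  let p : v.adicCompletionIntegers F := ⟨ϖ, hϖ1⟩
  have hspan : IsLocalRing.maximalIdeal (v.adicCompletionIntegers F) = Ideal.span {p} := by
    ext y
    rw [mem_maximalIdeal_adicCompletionIntegers, Ideal.mem_span_singleton,
      (adicCompletionIntegers.integers F v).dvd_iff_le]
    change _ ↔ Valued.v (y : v.adicCompletion F) ≤ Valued.v ϖ
    rw [hϖ, ← lt_mul_exp_iff_le exp_ne_zero, ← exp_add]
    simp
  rw [hspan, Ideal.span_singleton_pow, Ideal.mem_span_singleton,
      (adicCompletionIntegers.integers F v).dvd_iff_le, ← hϖn, ← norm_pow,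
      norm_adicCompletion_le_iff]
  rfl

instance finite_modPow (r : ℕ) : Finite (ModPow v r) :=
  haveI : IsDiscreteValuationRing (Valued.integer (v.adicCompletion F)) :=
    inferInstanceAs (IsDiscreteValuationRing (v.adicCompletionIntegers F))
  Valued.integer.finite_quotient_maximalIdeal_pow_of_finite_residueField
    (K := v.adicCompletion F) (finite_residueField v) r

theorem card_modPow (r : ℕ) : Nat.card (ModPow v r) = residueCard v ^ r :=
  cardQuot_pow_of_prime (IsDiscreteValuationRing.not_a_field _)

end FinitePlace

end LocalDensity

namespace LocalDensity

open MeasureTheory Metric Set Filter Topology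
open scoped Matrix

/-! ### Counting solutions by Haar measure -/

section Counting

open IsDedekindDomain IsDedekindDomain.HeightOneSpectrum
open scoped Pointwise

variable {F : Type*} [Field F] [NumberField F] (v : HeightOneSpectrum (𝓞 F))
  [MeasurableSpace (v.adicCompletion F)] [BorelSpace (v.adicCompletion F)]

/-- A set of integral points that is defined by congruences modulo the `r`-th power of the maximal
ideal is a disjoint union of balls. -/
theorem measure_setOf_modPow_mem {κ : Type*} [Fintype κ] (r : ℕ) (T : Set (κ → ModPow v r))
    (ν : Measure (κ → v.adicCompletion F)) [ν.IsAddLeftInvariant] :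
    ν {y | ∃ z : κ → v.adicCompletionIntegers F, (fun i => (z i : v.adicCompletion F)) = y ∧
        (fun i => (Ideal.Quotient.mk _ (z i) : ModPow v r)) ∈ T} =
      Nat.card T * ν (closedBall 0 ((residueCard v : ℝ)⁻¹ ^ r)) := by
  have hq : 0 ≤ (residueCard v : ℝ)⁻¹ ^ r := by positivity
  let lift : (κ → ModPow v r) → κ → v.adicCompletionIntegers F :=
    fun t i => Quotient.out (t i)
  have hlift : ∀ t i, (Ideal.Quotient.mk _ (lift t i) : ModPow v r) = t i := fun t i =>
    Quotient.out_eq _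
  -- A residue class is the ball around any of its lifts, and all these balls are translates of one
  -- another.
  let B : T → Set (κ → v.adicCompletion F) := fun t =>
    closedBall (fun i => (lift t.1 i : v.adicCompletion F)) ((residueCard v : ℝ)⁻¹ ^ r)
  have hB : ∀ (t : T) (z : κ → v.adicCompletionIntegers F),
      (fun i => (z i : v.adicCompletion F)) ∈ B t ↔
        (fun i => (Ideal.Quotient.mk _ (z i) : ModPow v r)) = t.1 := by
    intro t z
    rw [mem_closedBall, dist_pi_le_iff hq, funext_iff]
    refine forall_congr' fun i => ?_
    rw [← hlift t.1 i, Ideal.Quotient.eq, mem_maximalIdeal_pow_iff, dist_eq_norm]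
    rfl
  have hint : ∀ (t : T), ∀ y ∈ B t, ∃ z : κ → v.adicCompletionIntegers F,
      (fun i => (z i : v.adicCompletion F)) = y := by
    intro t y hy
    rw [mem_closedBall, dist_pi_le_iff hq] at hy
    have h1 : ∀ i, y i ∈ v.adicCompletionIntegers F := by
      intro i
      have h2 : ‖y i - lift t.1 i‖ ≤ 1 := by
        rw [← dist_eq_norm]
        exact (hy i).trans (pow_le_one₀ (by positivity)
          (inv_le_one_of_one_le₀ (by exact_mod_cast (one_lt_residueCard v).le)))
      have h3 := add_mem ((norm_adicCompletion_le_one_iff v).1 h2) (lift t.1 i).2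
      rwa [sub_add_cancel] at h3
    exact ⟨fun i => ⟨y i, h1 i⟩, rfl⟩
  have hset : {y | ∃ z : κ → v.adicCompletionIntegers F,
      (fun i => (z i : v.adicCompletion F)) = y ∧
        (fun i => (Ideal.Quotient.mk _ (z i) : ModPow v r)) ∈ T} = ⋃ t, B t := by
    ext y
    rw [mem_iUnion]
    constructor
    · rintro ⟨z, rfl, hz⟩
      exact ⟨⟨_, hz⟩, (hB ⟨_, hz⟩ z).2 rfl⟩
    · rintro ⟨t, ht⟩
      obtain ⟨z, rfl⟩ := hint t y ht
      exact ⟨z, rfl, by rw [(hB t z).1 ht]; exact t.2⟩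
  have hdisj : Pairwise (Function.onFun Disjoint B) := by
    intro t t' htt'
    refine Set.disjoint_left.2 fun y hy hy' => htt' ?_
    obtain ⟨z, rfl⟩ := hint t y hy
    exact Subtype.ext (((hB t z).1 hy).symm.trans ((hB t' z).1 hy'))
  have : Fintype T := Fintype.ofFinite T
  rw [hset, measure_iUnion hdisj fun t => isClosed_closedBall.measurableSet, tsum_fintype]
  have hBv : ∀ t, ν (B t) = ν (closedBall 0 ((residueCard v : ℝ)⁻¹ ^ r)) := by
    intro t
    have h := measure_preimage_add ν (-(fun i => (lift t.1 i : v.adicCompletion F)))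
      (closedBall 0 ((residueCard v : ℝ)⁻¹ ^ r))
    rw [← h]
    congr 1
    ext y
    simp only [B, mem_preimage, mem_closedBall, dist_eq_norm, sub_zero, neg_add_eq_sub]
  simp only [hBv, Finset.sum_const, Finset.card_univ, nsmul_eq_mul, Nat.card_eq_fintype_card]

/-- The case of one variable and all residue classes: the ring of integers is the union of q^r
translates of the smaller ball. -/
theorem measure_closedBall_inv_pow (μ : Measure (v.adicCompletion F)) [μ.IsAddHaarMeasure] (r : ℕ) :
    μ (closedBall 0 1) =
      (residueCard v : ℝ≥0∞) ^ r * μ (closedBall 0 ((residueCard v : ℝ)⁻¹ ^ r)) := by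
  have h := measure_setOf_modPow_mem v r (univ : Set (Fin 1 → ModPow v r))
    (Measure.pi fun _ => μ)
  have hset : {y : Fin 1 → v.adicCompletion F | ∃ z : Fin 1 → v.adicCompletionIntegers F,
      (fun i => (z i : v.adicCompletion F)) = y ∧
        (fun i => (Ideal.Quotient.mk _ (z i) : ModPow v r)) ∈ (univ : Set (Fin 1 → ModPow v r))} =
      closedBall 0 1 := by
    ext y
    rw [mem_closedBall, dist_pi_le_iff zero_le_one]
    simp only [mem_univ, and_true, mem_ofPred_eq]
    have hy : ∀ i, dist (y i) ((0 : Fin 1 → v.adicCompletion F) i) ≤ 1 ↔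
        y i ∈ v.adicCompletionIntegers F := fun i => by
      rw [Pi.zero_apply, dist_zero_right, norm_adicCompletion_le_one_iff]
      rfl
    simp only [hy]
    exact ⟨by rintro ⟨z, rfl⟩ i; exact (z i).2, fun h => ⟨fun i => ⟨y i, h i⟩, rfl⟩⟩
  rw [hset, Measure.pi_closedBall _ _ zero_le_one, Measure.pi_closedBall _ _ (by positivity)] at h
  simpa [card_modPow, Nat.card_fun] using h

/-- The modulus of multiplication by a can be tested on the unit ball, which goes to the ball of
radius ‖a‖; for ‖a‖ ≤ 1 its measure is known from the index count. Larger a follow by passing to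
inverses, the modulus being a character. -/
theorem scalesByNorm_adicCompletion (μ : Measure (v.adicCompletion F)) [μ.IsAddHaarMeasure] :
    ScalesByNorm μ := by
  have hpos : 0 < (residueCard v : ℝ) := by exact_mod_cast zero_lt_one.trans (one_lt_residueCard v)
  have hfin : μ (closedBall 0 1) ≠ ⊤ := (isCompact_closedBall _ _).measure_lt_top.ne
  have h0 : μ (closedBall 0 1) ≠ 0 := (measure_closedBall_pos μ _ zero_lt_one).ne'
  have key1 : ∀ a : (v.adicCompletion F)ˣ, ‖(a : v.adicCompletion F)‖ ≤ 1 →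
      distribHaarChar (v.adicCompletion F) a = ‖(a : v.adicCompletion F)‖₊ := by
    intro a ha
    have ha0 : 0 < ‖(a : v.adicCompletion F)‖ := norm_pos_iff.2 a.ne_zero
    obtain ⟨k, hk⟩ := exists_valued_eq_exp v a.ne_zero ha
    have hk := norm_of_valued_eq_exp v hk
    refine distribHaarChar_eq_of_measure_smul_eq_mul h0 hfin (μ := μ) ?_
    have hball : a • closedBall (0 : v.adicCompletion F) 1 =
        closedBall 0 ‖(a : v.adicCompletion F)‖ := by
      have := smul_closedBall' (𝕜 := v.adicCompletion F) (E := v.adicCompletion F)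
        (c := (a : v.adicCompletion F)) a.ne_zero 0 1
      rw [smul_zero, mul_one] at this
      exact this
    rw [hball, measure_closedBall_inv_pow v μ k, ← hk, ← mul_assoc]
    have : (‖(a : v.adicCompletion F)‖₊ : ℝ≥0∞) * (residueCard v : ℝ≥0∞) ^ k = 1 := by
      have h2 : ‖(a : v.adicCompletion F)‖₊ * (residueCard v : NNReal) ^ k = 1 := by
        ext
        simp [hk, hpos.ne']
      exact_mod_cast congrArg ((↑) : NNReal → ℝ≥0∞) h2
    rw [this, one_mul]
  have key : ∀ a : (v.adicCompletion F)ˣ,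
      distribHaarChar (v.adicCompletion F) a = ‖(a : v.adicCompletion F)‖₊ := by
    intro a
    rcases le_total ‖(a : v.adicCompletion F)‖ 1 with ha | ha
    · exact key1 a ha
    · have := key1 a⁻¹ (by simpa using inv_le_one_of_one_le₀ ha)
      simpa using this
  intro a ha s
  have h := distribHaarChar_mul μ (Units.mk0 a ha) ((a * ·) ⁻¹' s)
  rw [key] at h
  refine h.trans (congrArg μ ?_)
  ext x
  rw [mem_smul_set_iff_inv_smul_mem]
  simp [Units.smul_def, ha]

theorem exists_isAddHaarMeasure_closedBall_eq_one :
    ∃ μ : Measure (v.adicCompletion F), μ.IsAddHaarMeasure ∧ μ (closedBall 0 1) = 1 :=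
  let K₀ : TopologicalSpace.PositiveCompacts (v.adicCompletion F) :=
    ⟨⟨closedBall 0 1, isCompact_closedBall _ _⟩,
      ⟨0, ball_subset_interior_closedBall (mem_ball_self zero_lt_one)⟩⟩
  ⟨Measure.addHaarMeasure K₀, inferInstance, Measure.addHaarMeasure_self⟩

/-- The number of solutions modulo a power of the prime as the measure of a tube. -/
theorem solutionCount_mul_eq_measure_tube (μ : Measure (v.adicCompletion F)) [μ.IsAddHaarMeasure]
    (h1 : μ (closedBall 0 1) = 1) {N m : ℕ} (f : Fin m → MvPolynomial (Fin (N + 1)) (𝓞 F)) (r : ℕ) :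
    (Measure.pi fun _ : Fin (N + 1) => μ).real (closedBall 0 1 ∩
      tube (fun i => MvPolynomial.map (algebraMap (𝓞 F) (v.adicCompletion F)) (f i))
        ((residueCard v : ℝ)⁻¹ ^ r)) =
      solutionCount v f r * ((residueCard v : ℝ)⁻¹ ^ r) ^ (N + 1) := by
  have h := measure_setOf_modPow_mem v r
    {x : Fin (N + 1) → ModPow v r | ∀ i, MvPolynomial.aeval x (f i) = 0} (Measure.pi fun _ => μ)
  have hball : μ (closedBall 0 ((residueCard v : ℝ)⁻¹ ^ r)) =
      ENNReal.ofReal ((residueCard v : ℝ)⁻¹ ^ r) := by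
    have h2 := measure_closedBall_inv_pow v μ r
    rw [h1, mul_comm] at h2
    rw [ENNReal.eq_inv_of_mul_eq_one_left h2.symm, ENNReal.ofReal_pow (by positivity),
      ENNReal.ofReal_inv_of_pos (by exact_mod_cast zero_lt_one.trans (one_lt_residueCard v)),
      ENNReal.ofReal_natCast, ENNReal.inv_pow]
  -- An equation modulo the r-th power of the prime is the inequality |f| ≤ q^(-r) at any integral
  -- lift, so solution classes fill out exactly the tube.
  have heval : ∀ (z : Fin (N + 1) → v.adicCompletionIntegers F) (i : Fin m),
      MvPolynomial.aeval (fun i => (Ideal.Quotient.mk _ (z i) : ModPow v r)) (f i) = 0 ↔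
        ‖MvPolynomial.eval (fun i => (z i : v.adicCompletion F))
          (MvPolynomial.map (algebraMap (𝓞 F) (v.adicCompletion F)) (f i))‖ ≤
            (residueCard v : ℝ)⁻¹ ^ r := by
    intro z i
    have e1 : MvPolynomial.aeval (fun i => (Ideal.Quotient.mk _ (z i) : ModPow v r)) (f i) =
        Ideal.Quotient.mk _ (MvPolynomial.aeval z (f i)) :=
      (MvPolynomial.comp_aeval_apply z (Ideal.Quotient.mkₐ (𝓞 F) _) (f i)).symm
    have e2 : MvPolynomial.eval (fun i => (z i : v.adicCompletion F))
        (MvPolynomial.map (algebraMap (𝓞 F) (v.adicCompletion F)) (f i)) =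
        (MvPolynomial.aeval z (f i) : v.adicCompletionIntegers F) := by
      have : IsScalarTower (𝓞 F) (v.adicCompletionIntegers F) (v.adicCompletion F) :=
        IsScalarTower.of_algebraMap_eq fun _ => rfl
      rw [MvPolynomial.eval_map, ← MvPolynomial.aeval_def]
      exact MvPolynomial.aeval_algebraMap_apply (v.adicCompletion F) z (f i)
    rw [e1, e2, Ideal.Quotient.eq_zero_iff_mem, mem_maximalIdeal_pow_iff]
  have hset : {y : Fin (N + 1) → v.adicCompletion F |
      ∃ z : Fin (N + 1) → v.adicCompletionIntegers F,
      (fun i => (z i : v.adicCompletion F)) = y ∧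
        (fun i => (Ideal.Quotient.mk _ (z i) : ModPow v r)) ∈
          {x : Fin (N + 1) → ModPow v r | ∀ i, MvPolynomial.aeval x (f i) = 0}} =
      closedBall 0 1 ∩
      tube (fun i => MvPolynomial.map (algebraMap (𝓞 F) (v.adicCompletion F)) (f i))
        ((residueCard v : ℝ)⁻¹ ^ r) := by
    ext y
    constructor
    · rintro ⟨z, rfl, hz⟩
      refine ⟨?_, fun i => (heval z i).1 (hz i)⟩
      rw [mem_closedBall_zero_iff, pi_norm_le_iff_of_nonneg zero_le_one]
      exact fun i => (norm_adicCompletion_le_one_iff v).2 (z i).2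
    · rintro ⟨hy, hy'⟩
      rw [mem_closedBall_zero_iff, pi_norm_le_iff_of_nonneg zero_le_one] at hy
      exact ⟨fun i => ⟨y i, (norm_adicCompletion_le_one_iff v).1 (hy i)⟩, rfl,
        fun i => (heval _ i).2 (hy' i)⟩
  rw [Measure.real, ← hset, h, Measure.pi_closedBall _ _ (by positivity)]
  simp only [Pi.zero_apply, hball, Finset.prod_const, Finset.card_univ, Fintype.card_fin,
    ENNReal.toReal_mul, ENNReal.toReal_pow, ENNReal.toReal_natCast]
  rw [ENNReal.toReal_ofReal (by positivity)]
  rfl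

end Counting

end LocalDensity

namespace LocalDensity

open MeasureTheory Metric Set Filter Topology
open scoped Matrix

/-! ### Transfer of the Jacobian criterion to the completion -/

section Smooth

variable {R F K : Type*} [CommRing R] [Field F] [Field K] [Algebra R F] [Algebra F K] [Algebra R K]
  [IsScalarTower R F K] {N m n : ℕ}

theorem linearIndependent_of_det_ne_zero (e : Fin m ⊕ Fin (n + 1) ≃ Fin (N + 1))
    {J : Matrix (Fin m) (Fin (N + 1)) K}
    (hJ : (Matrix.of fun i j : Fin m => J i (e (Sum.inl j))).det ≠ 0) : LinearIndependent K J := by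
  have h := Matrix.linearIndependent_rows_of_det_ne_zero hJ
  exact LinearIndependent.of_comp (LinearMap.funLeft K K fun j => e (Sum.inl j)) h

/-- The Jacobian criterion for a smooth complete intersection holds at the points over every
extension of the base field. -/
theorem IsSmoothCompleteIntersection.linearIndependent
    {f : Fin m → MvPolynomial (Fin (N + 1)) R}
    (hf : IsSmoothCompleteIntersection F f) (hn : n + m = N) {y : Fin (N + 1) → K} (hy : y ≠ 0)
    (hfy : ∀ i, MvPolynomial.aeval y (f i) = 0) :
    LinearIndependent K
      (fun (i : Fin m) (j : Fin (N + 1)) => MvPolynomial.aeval y (MvPolynomial.pderiv j (f i))) := by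
  let g : Fin m → MvPolynomial (Fin (N + 1)) F := fun i => MvPolynomial.map (algebraMap R F) (f i)
  let D : (Fin m ⊕ Fin (n + 1) ≃ Fin (N + 1)) → MvPolynomial (Fin (N + 1)) F := fun e =>
    (Matrix.of fun i j : Fin m => MvPolynomial.pderiv (e (Sum.inl j)) (g i)).det
  -- Equations together with the maximal Jacobian minors: smoothness says that over the algebraic
  -- closure they have no common zero except possibly the origin.
  let I : Ideal (MvPolynomial (Fin (N + 1)) F) := Ideal.span (range g ∪ range D)
  have hzero : MvPolynomial.zeroLocus (AlgebraicClosure F) I ⊆ {0} := by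
    intro x hx
    rw [MvPolynomial.zeroLocus_span] at hx
    by_contra hx0
    have hfx : ∀ i, MvPolynomial.aeval x (f i) = 0 := fun i => by
      rw [← MvPolynomial.aeval_map_algebraMap F]
      exact hx (g i) (Or.inl ⟨i, rfl⟩)
    obtain ⟨e, he⟩ := exists_equiv_det_ne_zero hn (hf x hx0 hfx)
    refine he ?_
    have h := hx (D e) (Or.inr ⟨e, rfl⟩)
    rw [AlgHom.map_det] at h
    rw [← h]
    congr 1
    ext i j
    simp [g, MvPolynomial.pderiv_map, MvPolynomial.aeval_map_algebraMap]
  obtain ⟨j, hj⟩ := Function.ne_iff.1 hy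
  -- By the Nullstellensatz some power of X_j lies in I already over F, a relation that can be
  -- evaluated in any extension K. Since y_j ≠ 0, some generator is nonzero at y; it is not an
  -- equation, so it is a minor.
  have hrad : (MvPolynomial.X j : MvPolynomial (Fin (N + 1)) F) ∈ I.radical := by
    rw [← MvPolynomial.vanishingIdeal_zeroLocus_eq_radical (K := AlgebraicClosure F)]
    intro x hx
    rw [mem_singleton_iff.1 (hzero hx)]
    simp
  obtain ⟨k, hk⟩ := hrad
  have hyI : MvPolynomial.aeval y (MvPolynomial.X j ^ k : MvPolynomial (Fin (N + 1)) F) ≠ 0 := by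
    simpa using fun h => absurd h hj
  have hnot : y ∉ MvPolynomial.zeroLocus K I := fun h => hyI (h _ hk)
  rw [MvPolynomial.zeroLocus_span] at hnot
  simp only [mem_ofPred_eq, not_forall] at hnot
  obtain ⟨p, ⟨i, rfl⟩ | ⟨e, rfl⟩, hp⟩ := hnot
  · exact absurd ((MvPolynomial.aeval_map_algebraMap F y (f i)).trans (hfy i)) hp
  · refine linearIndependent_of_det_ne_zero e fun h => hp ?_
    rw [AlgHom.map_det, ← h]
    congr 1
    ext i j
    simp [g, MvPolynomial.pderiv_map, MvPolynomial.aeval_map_algebraMap]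

end Smooth

/-! ### Dependence on the normalization of Haar measure -/

section Scaling

variable {K : Type*} [NontriviallyNormedField K] [MeasurableSpace K] {N m : ℕ}

theorem pi_smul_measure {X ι : Type*} [MeasurableSpace X] [Fintype ι] (μ : Measure X)
    [SigmaFinite μ] (c : NNReal) :
    (Measure.pi fun _ : ι => c • μ) = c ^ Fintype.card ι • Measure.pi fun _ : ι => μ := by
  refine Measure.pi_eq fun s _ => ?_
  simp only [Measure.smul_apply, Measure.pi_pi, ENNReal.smul_def, smul_eq_mul,
    Finset.prod_mul_distrib, Finset.prod_const, Finset.card_univ, ENNReal.coe_pow]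

/-- Each chart measure uses n copies of μ. An invertible scalar commutes with the supremum of
measures, as one sees by multiplying back with its inverse. -/
theorem tamagawaMeasure_smul (f : Fin m → MvPolynomial (Fin (N + 1)) K) (n δ : ℕ) (μ : Measure K)
    [SigmaFinite μ] {c : NNReal} (hc : c ≠ 0) :
    tamagawaMeasure f n δ (c • μ) = c ^ n • tamagawaMeasure f n δ μ := by
  have hc' : c ^ n ≠ 0 := pow_ne_zero n hc
  have h : ∀ (u : LocalCoordinates f n), u.measure δ (c • μ) = c ^ n • u.measure δ μ := by
    intro u
    rw [LocalCoordinates.measure, pi_smul_measure μ, ENNReal.smul_def, Measure.comap_smul,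
      withDensity_smul_measure, Measure.map_smul, Fintype.card_fin]
    rfl
  simp only [tamagawaMeasure, h]
  refine le_antisymm (iSup_le fun u => ?_) ?_
  · gcongr
    exact le_iSup (fun u : LocalCoordinates f n => u.measure δ μ) u
  · calc c ^ n • ⨆ u : LocalCoordinates f n, u.measure δ μ
        ≤ c ^ n • (c ^ n)⁻¹ • ⨆ u : LocalCoordinates f n, c ^ n • u.measure δ μ := by
          gcongr
          refine iSup_le fun u => ?_
          calc u.measure δ μ = (c ^ n)⁻¹ • c ^ n • u.measure δ μ := by
                rw [smul_smul, inv_mul_cancel₀ hc', one_smul]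
            _ ≤ _ := by
                gcongr
                exact le_iSup (fun u : LocalCoordinates f n => c ^ n • u.measure δ μ) u
      _ = _ := by rw [smul_smul, mul_inv_cancel₀ hc', one_smul]

end Scaling

end LocalDensity

namespace LocalDensity

open MeasureTheory Metric Set Filter Topology

/-! ### Assembly at a finite place, and both normalizations -/

section Main

open IsDedekindDomain IsDedekindDomain.HeightOneSpectrum

variable {F : Type*} [Field F] [NumberField F] (v : HeightOneSpectrum (𝓞 F))
  [MeasurableSpace (v.adicCompletion F)] [BorelSpace (v.adicCompletion F)]

/-- The limit of the densities of the solutions of `f = 0` modulo powers of the prime exists, and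
determines the total mass of the measure `ω_H`, for each normalisation of the Haar measure. -/
theorem exists_tendsto_and_tamagawaMeasure_eq {N m n d δ : ℕ}
    {f : Fin m → MvPolynomial (Fin (N + 1)) (𝓞 F)} (hd : 1 ≤ d) (hf : ∀ i, (f i).IsHomogeneous d)
    (hsmooth : IsSmoothCompleteIntersection F f)
    (hn : n + m = N) (hδ : δ + m * d = N + 1) (hδ1 : 1 ≤ δ) :
    ∃ L : ℝ,
      Tendsto (fun r : ℕ => (solutionCount v f r : ℝ) / (residueCard v : ℝ) ^ (r * (n + 1)))
        atTop (𝓝 L) ∧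
      ∀ (μ : Measure (v.adicCompletion F)) [μ.IsAddHaarMeasure],
        tamagawaMeasure
            (fun i => MvPolynomial.map (algebraMap (𝓞 F) (v.adicCompletion F)) (f i)) n δ μ
            (points fun i => MvPolynomial.map (algebraMap (𝓞 F) (v.adicCompletion F)) (f i)) =
          μ (v.adicCompletionIntegers F : Set (v.adicCompletion F)) ^ n *
            ENNReal.ofReal ((1 - ((residueCard v : ℝ) ^ δ)⁻¹) / (1 - (residueCard v : ℝ)⁻¹) * L) := by
  set fv : Fin m → MvPolynomial (Fin (N + 1)) (v.adicCompletion F) :=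
    fun i => MvPolynomial.map (algebraMap (𝓞 F) (v.adicCompletion F)) (f i) with hfv
  have hq1 : 1 < (residueCard v : ℝ) := by exact_mod_cast one_lt_residueCard v
  have hq0 : 0 < (residueCard v : ℝ) := by linarith
  obtain ⟨μ₁, hμ₁, h1⟩ := exists_isAddHaarMeasure_closedBall_eq_one v
  obtain ⟨ϖ, hϖ⟩ := exists_adicCompletion_uniformizer v
  have hϖn : ‖ϖ‖ = (residueCard v : ℝ)⁻¹ := by
    simpa using norm_of_valued_eq_exp v (x := ϖ) (k := 1) (by simpa using hϖ)
  have hϖ0 : ϖ ≠ 0 := by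
    rw [← norm_pos_iff, hϖn]
    positivity
  have hϖ1 : ‖ϖ‖ < 1 := by
    rw [hϖn]
    exact inv_lt_one_of_one_lt₀ hq1
  have hval : ∀ x : v.adicCompletion F, x ≠ 0 → ‖x‖ ≤ 1 → ∃ k : ℕ, ‖x‖ = ‖ϖ‖ ^ k := by
    intro x hx hx1
    obtain ⟨k, hk⟩ := exists_valued_eq_exp v hx hx1
    exact ⟨k, by rw [hϖn, norm_of_valued_eq_exp v hk]⟩
  have hli : ∀ y ∈ cone fv, y ≠ 0 → LinearIndependent (v.adicCompletion F)
      (fun (i : Fin m) (j : Fin (N + 1)) =>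
        MvPolynomial.eval y (MvPolynomial.pderiv j (fv i))) := by
    intro y hy hy0
    have h := hsmooth.linearIndependent (K := v.adicCompletion F) hn hy0 fun i => by
      rw [MvPolynomial.aeval_def, ← MvPolynomial.eval_map]
      exact hy i
    convert h using 3
    rw [MvPolynomial.aeval_def, ← MvPolynomial.eval_map, hfv, MvPolynomial.pderiv_map]
  obtain ⟨L, hL, hmain⟩ := tamagawaMeasure_eq_of_isSmooth hn hd (fun i => (hf i).map _) hδ hδ1 hli
    (scalesByNorm_adicCompletion v μ₁) h1 hϖ0 hϖ1 hval
  refine ⟨L, hL.congr fun r => ?_, fun μ _ => ?_⟩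
  · rw [hϖn, solutionCount_mul_eq_measure_tube v μ₁ h1 f r]
    -- The normalization of the tube cancels m of the N + 1 factors q^(-r) and leaves the exponent
    -- dim W = n + 1.
    have : N + 1 = (n + 1) + m := by omega
    rw [this, pow_add _ (n + 1) m, ← mul_assoc, mul_div_cancel_right₀ _ (by positivity), ← pow_mul,
      inv_pow, div_eq_mul_inv]
  · rw [hϖn, inv_pow] at hmain
    -- Uniqueness of Haar measure: μ is c times the measure normalized on the integers, so c is the
    -- μ-volume of the integers.
    have hsmul := Measure.isAddLeftInvariant_eq_smul μ μ₁
    set c := μ.addHaarScalarFactor μ₁ with hc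
    have hc0 : c ≠ 0 := (Measure.addHaarScalarFactor_pos_of_isAddHaarMeasure μ μ₁).ne'
    rw [← closedBall_one_adicCompletion, hsmul, tamagawaMeasure_smul fv n δ μ₁ hc0,
      Measure.smul_apply, Measure.smul_apply, h1, hmain]
    simp only [ENNReal.smul_def, smul_eq_mul, mul_one, ENNReal.coe_pow]

end Main

end LocalDensity

theorem mainTheorem4 {F : Type*} [Field F] [NumberField F]
    (v : IsDedekindDomain.HeightOneSpectrum (𝓞 F))
    [MeasurableSpace (v.adicCompletion F)] [BorelSpace (v.adicCompletion F)]
    (N m n d δ : ℕ) (f : Fin m → MvPolynomial (Fin (N + 1)) (𝓞 F))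
    (hd : 1 ≤ d) (hf : ∀ i, (f i).IsHomogeneous d)
    (hsmooth : LocalDensity.IsSmoothCompleteIntersection F f)
    (hn : n + m = N) (hδ : δ + m * d = N + 1) (hδ1 : 1 ≤ δ) :
    let q : ℝ := LocalDensity.residueCard v
    let fv : Fin m → MvPolynomial (Fin (N + 1)) (v.adicCompletion F) :=
      fun i => MvPolynomial.map (algebraMap (𝓞 F) (v.adicCompletion F)) (f i)
    ∃ L : ℝ,
      Filter.Tendsto (fun r : ℕ => (LocalDensity.solutionCount v f r : ℝ) / q ^ (r * (n + 1)))
        Filter.atTop (nhds L) ∧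
      (∀ (μ : MeasureTheory.Measure (v.adicCompletion F)) [μ.IsAddHaarMeasure],
        μ (v.adicCompletionIntegers F : Set (v.adicCompletion F)) = 1 →
          LocalDensity.tamagawaMeasure fv n δ μ (LocalDensity.points fv) =
            ENNReal.ofReal ((1 - (q ^ δ)⁻¹) / (1 - q⁻¹) * L)) ∧
      (∀ (μ : MeasureTheory.Measure (v.adicCompletion F)) [μ.IsAddHaarMeasure],
        μ (v.adicCompletionIntegers F : Set (v.adicCompletion F)) =
            ENNReal.ofReal ((LocalDensity.differentIndex v : ℝ) ^ (-(1 / 2) : ℝ)) →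
          LocalDensity.tamagawaMeasure fv n δ μ (LocalDensity.points fv) =
            ENNReal.ofReal ((LocalDensity.differentIndex v : ℝ) ^ (-(n / 2) : ℝ) *
              ((1 - (q ^ δ)⁻¹) / (1 - q⁻¹) * L))) := by
  intro q fv
  obtain ⟨L, hL, hmain⟩ := LocalDensity.exists_tendsto_and_tamagawaMeasure_eq v hd hf hsmooth hn
    hδ hδ1
  refine ⟨L, hL, fun μ _ hμ => ?_, fun μ _ hμ => ?_⟩
  · rw [hmain μ, hμ, one_pow, one_mul]
  -- The n-th power of the volume of the integers turns the exponent -1/2 of the index of the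
  -- different into -n/2.
  · rw [hmain μ, hμ, ← ENNReal.ofReal_pow (by positivity), ← Real.rpow_mul_natCast (by positivity),
      ← ENNReal.ofReal_mul (by positivity)]
    congr 3
    ring
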